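/- **Setting.** Let $\mathbb T^2=\mathbb R^2/\mathbb Z^2$, with Lebesgue measure of total mass one. Fix two smooth radial functions $\tilde\chi,\chi:\mathbb R^2\to\mathbb R$, with $\tilde\chi$ supported in the ball $B(0,\frac43)$ and $\chi$ in the annulus $B(0,\frac83)\setminus B(0,\frac34)$, such that $\tilde\chi(\zeta)+\sum_{\kappa\ge0}\chi(\zeta/2^\kappa)=1$ for all $\zeta$; put $\chi_{-1}=\tilde\chi$ and $\chi_\kappa=\chi(\cdot/2^\kappa)$ for $\kappa\ge 0$. For a real distribution $u$ on $\mathbb T^2$ let $\delta_\kappa u(z)=\sum_{m\in\mathbb Z^2}\chi_\kappa(m)\hat u(m)e^{2\pi i m\cdot z}$ and $\|u\|_{\mathcal C^s}=\sup_{\kappa\ge-1}2^{s\kappa}\|\delta_\kappa u\|_{L^\infty}$. Let $\mathcal C^s$ be the completion of $C^\infty(\mathbb T^2)$ in this norm (a space of distributions). For $0<\alpha<\beta$, the $L^2$ inner product extends to $u\in\mathcal C^{-\alpha}$ and $f\in\mathcal C^\beta$ by $\langle u,f\rangle=\sum_{\kappa\ge-1}\int(\delta_\kappa u) f$, and the product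 $fu$ is the distribution $\varphi\mapsto\langle u,f\varphi\rangle$. Let $n\ge3$ be odd, $p\ge2$ an even integer, $\lambda=\frac{p+n-1}{p}$, $0<\alpha<\frac1{(p+n-1)(n-1)}$, $a_n>0$ and $\alpha'>0$. For $T>0$ and $\beta>\alpha$ let $\underline Z=(Z^{(1)},\dots,Z^{(n)})\in C([0,T];\mathcal C^{-\alpha})\times C((0,T];\mathcal C^{-\alpha})^{n-1}$, put $Z^{(0)}=a_n$, and let $x\in\mathcal C^{-\alpha_0}$ with $0<\alpha_0<\frac1n$. A weak solution on $(0,T]$ of $$\partial_t v=\Delta v-v-\sum_{j=0}^n v^jZ^{(n-j)},\qquad v(0,\cdot)=x,$$ is a $v\in C((0,T];\mathcal C^\beta)$ such that, for all $\varphi\in C^\infty(\mathbb T^2)$ and $0<s\le t\le T$, $$\langle v_t,\varphi\rangle-\langle v_s,\varphi\rangle=\int_s^t\Big(\langle v_r,\Delta\varphi-\varphi\rangle-\sum_{j=0}^n\langle v_r^jZ^{(n-j)}_r,\varphi\rangle\Big)\,dr,$$ and $\langle v_t,\varphi\rangle\to\langle x,\varphi\rangle$ as $t\downarrow0$. **Proposition.**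 There are exponents $p_i^j>0$ ($0\le j\le n-1$, $1\le i\le5$), which depend only on $n,p,\alpha$, and a constant $C>0$, which depends only on $n,p,\alpha,\alpha',a_n$ and $(\tilde\chi,\chi)$, such that for all $\alpha_0,\beta,T,x,\underline Z$ as above, every weak solution $v$ and every $0<t\le T$, $$\|v_t\|_{L^p}^p\le C\left[t^{-\frac1{\lambda-1}}\vee\left(\sum_{j=0}^{n-1}\sum_{i=1}^5t^{-\alpha'p_i^j}\sup_{0\le r\le t}\Big(r^{\alpha'p_i^j}\|Z^{(n-j)}_r\|_{\mathcal C^{-\alpha}}^{p_i^j}\Big)\right)^{\frac1\lambda}\right]$$ (the expression under the supremum is $0$ at $r=0$, and the right-hand side may be $+\infty$). In particular, the bound does not depend on $x$, nor on $\underline Z$ outside $[0,t]$. -/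

import Mathlib

open MeasureTheory Set Filter Topology
open scoped ENNReal ContDiff

namespace TorusSPDE

noncomputable section

/-- The two-dimensional torus of size `1`. -/
abbrev T2 : Type := UnitAddTorus (Fin 2)

/-- Lebesgue measure on the torus (total mass one). -/
abbrev torusMeasure : Measure T2 :=
  Measure.pi fun _ : Fin 2 => (AddCircle.haarAddCircle : Measure UnitAddCircle)

/-- The periodic function on `ℝ²` that corresponds to a function on the torus. -/
def periodicLift (f : T2 → ℝ) : (Fin 2 → ℝ) → ℝ :=
  fun z => f fun i => (z i : UnitAddCircle)

/-- Real-valued smooth functions on the torus, as a subspace of the continuous functions. -/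
def SmoothT2 : Submodule ℝ C(T2, ℝ) where
  carrier := {f | ContDiff ℝ ∞ (periodicLift f)}
  add_mem' := by
    intro f g hf hg
    rw [mem_ofPred_eq] at hf hg ⊢
    exact hf.add hg
  zero_mem' := by
    rw [mem_ofPred_eq]
    exact contDiff_const
  smul_mem' := by
    intro c f hf
    rw [mem_ofPred_eq] at hf ⊢
    exact hf.const_smul c

/-- Distributions on the torus: real linear functionals on smooth functions that are continuous
for the usual Fréchet topology, i.e. bounded by the `C^N` norm for some `N`. -/
def DistT2 : Submodule ℝ (SmoothT2 →ₗ[ℝ] ℝ) where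
  carrier := {u | ∃ (C : ℝ) (N : ℕ), ∀ (φ : SmoothT2) (M : ℝ),
    (∀ k ≤ N, ∀ z, ‖iteratedFDeriv ℝ k (periodicLift φ.1) z‖ ≤ M) → |u φ| ≤ C * M}
  add_mem' := by
    rintro u w ⟨C, N, hu⟩ ⟨C', N', hw⟩
    refine ⟨C + C', max N N', fun φ M h => ?_⟩
    have h1 := hu φ M fun k hk => h k (hk.trans (le_max_left _ _))
    have h2 := hw φ M fun k hk => h k (hk.trans (le_max_right _ _))
    calc |(u + w) φ| ≤ |u φ| + |w φ| := abs_add_le _ _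
      _ ≤ (C + C') * M := by linarith
  zero_mem' := ⟨0, 0, fun φ M _ => by simp⟩
  smul_mem' := by
    rintro c u ⟨C, N, hu⟩
    refine ⟨|c| * C, N, fun φ M h => ?_⟩
    have h1 := mul_le_mul_of_nonneg_left (hu φ M h) (abs_nonneg c)
    simpa [abs_mul, mul_assoc] using h1

/-- The distribution `φ ↦ ∫ f φ` given by a continuous function `f`. -/
def distOf (f : C(T2, ℝ)) : DistT2 :=
  ⟨{ toFun := fun φ => ∫ z, f z * φ.1 z ∂torusMeasure
     map_add' := fun φ ψ => by
       have hi : ∀ g : C(T2, ℝ), Integrable (fun z => f z * g z) torusMeasure := fun g =>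
         (f * g).continuous.integrable_of_hasCompactSupport
           (HasCompactSupport.of_compactSpace _)
       rw [← integral_add (hi φ.1) (hi ψ.1)]
       simp [mul_add]
     map_smul' := fun c φ => by
       simp [← integral_const_mul, mul_left_comm] },
   ⟨‖f‖, 0, fun φ M h => by
      have hM : ∀ z, |φ.1 z| ≤ M := fun z => by
        obtain ⟨y, hy⟩ : ∃ y : Fin 2 → ℝ, (fun i => (y i : UnitAddCircle)) = z :=
          ⟨fun i => (z i).out, funext fun i => Quotient.out_eq _⟩
        have := h 0 le_rfl y
        simpa [periodicLift, hy] using this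
      have := norm_integral_le_of_norm_le_const (μ := torusMeasure) (C := ‖f‖ * M)
        (f := fun z => f z * φ.1 z) (ae_of_all _ fun z => by
          rw [norm_mul]
          exact mul_le_mul (f.norm_coe_le_norm z) (hM z) (norm_nonneg _) (norm_nonneg _))
      simpa using this⟩⟩

theorem contDiff_lift_mFourier (m : Fin 2 → ℤ) :
    ContDiff ℝ ∞ fun z : Fin 2 → ℝ =>
      UnitAddTorus.mFourier m (fun i => (z i : UnitAddCircle)) := by
  simp only [UnitAddTorus.mFourier, ContinuousMap.coe_mk, fourier_coe_apply]
  refine contDiff_prod fun i _ => ContDiff.cexp ?_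
  have : ContDiff ℝ ∞ fun z : Fin 2 → ℝ => ((z i : ℝ) : ℂ) :=
    Complex.ofRealCLM.contDiff.comp (contDiff_apply ℝ ℝ i)
  fun_prop

/-- The smooth function `z ↦ cos (2π m·z)`. -/
def cosMode (m : Fin 2 → ℤ) : SmoothT2 :=
  ⟨⟨fun z => (UnitAddTorus.mFourier m z).re,
      Complex.continuous_re.comp (UnitAddTorus.mFourier m).continuous⟩,
    Complex.reCLM.contDiff.comp (contDiff_lift_mFourier m)⟩

/-- The smooth function `z ↦ sin (2π m·z)`. -/
def sinMode (m : Fin 2 → ℤ) : SmoothT2 :=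
  ⟨⟨fun z => (UnitAddTorus.mFourier m z).im,
      Complex.continuous_im.comp (UnitAddTorus.mFourier m).continuous⟩,
    Complex.imCLM.contDiff.comp (contDiff_lift_mFourier m)⟩

/-- The Fourier coefficient `⟨u, e^{2πi m·}⟩`, where the inner product is conjugate linear in
its second argument. -/
def distFourierCoeff (u : DistT2) (m : Fin 2 → ℤ) : ℂ :=
  (u.1 (cosMode m) : ℂ) - Complex.I * (u.1 (sinMode m) : ℂ)

/-- A dyadic partition of unity on `ℝ²` made of two smooth radial functions,
`low` supported in the ball of radius `4/3` and `ann` supported in the annulus with radii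
`3/4` and `8/3`. -/
structure DyadicPartition where
  low : EuclideanSpace ℝ (Fin 2) → ℝ
  ann : EuclideanSpace ℝ (Fin 2) → ℝ
  low_smooth : ContDiff ℝ ∞ low
  ann_smooth : ContDiff ℝ ∞ ann
  low_radial : ∀ ζ ζ', ‖ζ‖ = ‖ζ'‖ → low ζ = low ζ'
  ann_radial : ∀ ζ ζ', ‖ζ‖ = ‖ζ'‖ → ann ζ = ann ζ'
  low_support : Function.support low ⊆ Metric.ball 0 (4 / 3)
  ann_support : Function.support ann ⊆ Metric.ball 0 (8 / 3) \ Metric.ball 0 (3 / 4)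
  sum_eq_one : ∀ ζ, HasSum (fun κ : ℕ => ann (((2 : ℝ) ^ κ)⁻¹ • ζ)) (1 - low ζ)

/-- The cut-off functions `χ_{-1}, χ_0, χ_1, …`; the index is shifted by one, so that
`cutoff 0` is `χ_{-1}` and `cutoff (κ + 1)` is `χ_κ = χ(· / 2^κ)`. -/
def DyadicPartition.cutoff (P : DyadicPartition) : ℕ → EuclideanSpace ℝ (Fin 2) → ℝ
  | 0 => P.low
  | κ + 1 => fun ζ => P.ann (((2 : ℝ) ^ κ)⁻¹ • ζ)

/-- The Littlewood–Paley block `δ_{κ-1} u = ∑ₘ χ_{κ-1}(m) û(m) e^{2πi m·z}`. The sum has finitely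
many nonzero terms and is real, as the cut-off is radial and `û(-m)` is conjugate to `û(m)`. -/
def lpBlock (P : DyadicPartition) (κ : ℕ) (u : DistT2) (z : T2) : ℝ :=
  (∑' m : Fin 2 → ℤ, (P.cutoff κ (WithLp.toLp 2 fun i => (m i : ℝ)) : ℂ) *
    distFourierCoeff u m * UnitAddTorus.mFourier m z).re

/-- The Besov norm of `B^s_{∞,∞}`, with value `∞` allowed. -/
def besovNorm (P : DyadicPartition) (s : ℝ) (u : DistT2) : ℝ≥0∞ :=
  ⨆ κ : ℕ, ENNReal.ofReal ((2 : ℝ) ^ (s * ((κ : ℝ) - 1))) * ⨆ z : T2, ‖lpBlock P κ u z‖ₑ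

/-- Membership in the space `C^s`, the completion of the smooth functions in the norm of
`B^s_{∞,∞}`. -/
def MemC (P : DyadicPartition) (s : ℝ) (u : DistT2) : Prop :=
  ∀ ε : ℝ≥0∞, 0 < ε → ∃ φ : SmoothT2, besovNorm P s (u - distOf φ.1) < ε

/-- The curve `u` restricted to the time set `I` is an element of `C(I; C^s)`. -/
def ContinuousInC (P : DyadicPartition) (s : ℝ) (I : Set ℝ) (u : ℝ → DistT2) : Prop :=
  ∀ t ∈ I, MemC P s (u t) ∧ Tendsto (fun r => besovNorm P s (u r - u t)) (𝓝[I] t) (𝓝 0)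

/-- The extension `⟨u, f⟩ = ∑_κ ∫ (δ_κ u) f` of the `L²` inner product to `u ∈ C^{-α}` and
`f ∈ C^β` with `0 < α < β`; the series converges absolutely in this case. -/
def pairing (P : DyadicPartition) (u : DistT2) (f : C(T2, ℝ)) : ℝ :=
  ∑' κ : ℕ, ∫ z, lpBlock P κ u z * f z ∂torusMeasure

/-- The Laplacian of a function on the torus. -/
def laplace (φ : T2 → ℝ) (z : T2) : ℝ :=
  ∑ i : Fin 2, iteratedDeriv 2 (fun h : ℝ => φ (z + Pi.single i (h : UnitAddCircle))) 0

/-- The nonlinearity `F(v, Z) = ∑_{j=0}^{n} v^j Z^{(n-j)}`, with `Z^{(0)} = a` constant, tested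
against `φ`; the product `v^j Z^{(n-j)}` acts on `φ` as `⟨Z^{(n-j)}, v^j φ⟩`. -/
def nonlinearity (P : DyadicPartition) (n : ℕ) (a : ℝ) (v : C(T2, ℝ)) (Z : ℕ → DistT2)
    (φ : C(T2, ℝ)) : ℝ :=
  a * (∫ z, v z ^ n * φ z ∂torusMeasure) +
    ∑ j ∈ Finset.range n, pairing P (Z (n - j)) (v ^ j * φ)

/-- `Z = (Z^{(1)}, …, Z^{(n)})` belongs to `C([0,T]; C^{-α}) × C((0,T]; C^{-α})^{n-1}`. -/
def NoiseSpace (P : DyadicPartition) (n : ℕ) (α T : ℝ) (Z : ℕ → ℝ → DistT2) : Prop :=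
  ContinuousInC P (-α) (Icc 0 T) (Z 1) ∧
    ∀ k ∈ Finset.Icc 2 n, ContinuousInC P (-α) (Ioc 0 T) (Z k)

/-- `v ∈ C((0,T]; C^β)` is a weak solution of `∂ₜ v = Δ v - v - ∑_{j=0}^{n} v^j Z^{(n-j)}`,
`Z^{(0)} = a`, with initial condition `x`, which is attained in the sense of distributions. -/
structure IsWeakSolution (P : DyadicPartition) (n : ℕ) (a β T : ℝ) (x : DistT2)
    (Z : ℕ → ℝ → DistT2) (v : ℝ → C(T2, ℝ)) : Prop where
  continuous : ContinuousInC P β (Ioc 0 T) fun t => distOf (v t)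
  equation : ∀ (φ : SmoothT2) (s t : ℝ), 0 < s → s ≤ t → t ≤ T →
    (∫ z, v t z * φ.1 z ∂torusMeasure) - ∫ z, v s z * φ.1 z ∂torusMeasure =
      ∫ r in s..t, ((∫ z, v r z * (laplace φ.1 z - φ.1 z) ∂torusMeasure) -
        nonlinearity P n a (v r) (fun k => Z k r) φ.1)
  initial : ∀ φ : SmoothT2,
    Tendsto (fun t => ∫ z, v t z * φ.1 z ∂torusMeasure) (𝓝[>] 0) (𝓝 (x.1 φ))

end

end TorusSPDE

namespace TorusSPDE

noncomputable section

/-! ### Means and translations -/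

/-! This is an energy estimate in which the damping `a v^n` is strong enough to forget the past. Put
`r = p+n-1`, `q = p/2`, `F = ∫ v^p`, `B = ∫ v^r` and `D = ∫ (-Δv) v^(p-1) ≥ 0`. Formally, testing
the equation with `v^(p-1)` gives `F'/p = -D - F - a B - ∑_j ⟨Z^(n-j), v^(p+j-1)⟩`.

A distribution in `C^{-α}` pairs with any function that has an `L¹` modulus of continuity of order
`θ > α` (`abs_pairing_le`); here `θ = 1/(n-1)`. The inequality of Stroock and Varopoulos bounds the
`L²` increments of `w = v|v|^(q-1)` by `|h| D^(1/2)`, up to a constant. Interpolating between `w`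
and `L^r`, the modulus of `v^k` is of order `D^(θ/2) B^((k-qθ)/r)`. For `k = p+j-1` these two
exponents sum to less than one exactly when `θ(n-1)/2 < n-j`. Young's inequality then absorbs the
noise into `D + (a/2) B`, at the cost of powers of the norms of the noise (`exists_pairing_pow_le`).
Since `B ≥ F^λ` by Jensen, `F' ≤ -c F^λ + K`. As `λ > 1`, comparison on `[t/2, t]` bounds `F(t)`
whatever `F(t/2)` is (`le_max_of_deriv_le_neg_rpow`).

To make this rigorous, `v` is replaced by `V = K * v` with a Jackson kernel `K`. This is a
trigonometric polynomial, so the energy identity involves only finitely many Fourier coefficients of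
`v`, each with a continuous time derivative (`IsWeakSolution.hasDerivAt_energy`). The commutators
`v^j K*(V^(p-1)) - V^(j+p-1)` stay bounded in a Hölder class and tend to zero uniformly, so by
interpolation their pairings with the noise vanish in the limit (`eventually_nonlinearity_conv`).

The harmonic analysis rests on two explicit kernels. The nonnegative Jackson kernel, with second
moment `O(N⁻²)`, gives approximation rates and the decay of Littlewood–Paley blocks against moduli
of continuity. A reproducing kernel with `L¹` modulus `O(N|h|)` gives Bernstein's inequality, hence
the embedding of Besov into Hölder classes. -/

theorem integrable_continuousMap (f : C(T2, ℝ)) : Integrable (fun z => f z) torusMeasure :=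
  f.continuous.integrable_of_hasCompactSupport (HasCompactSupport.of_compactSpace _)

/-- The mean of a continuous function on the torus. -/
def mean : C(T2, ℝ) →L[ℝ] ℝ :=
  LinearMap.mkContinuous
    { toFun := fun f => ∫ z, f z ∂torusMeasure
      map_add' := fun f g => by
        simpa using integral_add (integrable_continuousMap f) (integrable_continuousMap g)
      map_smul' := fun c f => by simp [integral_const_mul] } 1 fun f => by
    have := norm_integral_le_of_norm_le_const (μ := torusMeasure) (C := ‖f‖) (f := fun z => f z)
      (ae_of_all _ fun z => f.norm_coe_le_norm z)
    simpa using this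

theorem mean_apply (f : C(T2, ℝ)) : mean f = ∫ z, f z ∂torusMeasure := rfl

theorem mean_mono {f g : C(T2, ℝ)} (h : ∀ z, f z ≤ g z) : mean f ≤ mean g :=
  integral_mono (integrable_continuousMap f) (integrable_continuousMap g) h

theorem mean_nonneg {f : C(T2, ℝ)} (h : ∀ z, 0 ≤ f z) : 0 ≤ mean f := integral_nonneg h

theorem mean_const (c : ℝ) : mean (ContinuousMap.const _ c) = c := by simp [mean_apply]

theorem abs_mean_le (f : C(T2, ℝ)) : |mean f| ≤ mean |f| := by
  rw [abs_le, ← map_neg]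
  exact ⟨by rw [← neg_le_neg_iff, ← map_neg, ← map_neg, neg_neg]
            exact mean_mono fun z => neg_le_abs (f z), mean_mono fun z => le_abs_self (f z)⟩

theorem mean_le_of_le {f : C(T2, ℝ)} {K : ℝ} (h : ∀ z, f z ≤ K) : mean f ≤ K := by
  rw [← mean_const K]
  exact mean_mono h

/-- The translate `z ↦ f (z + h)`. -/
def translate (h : T2) (f : C(T2, ℝ)) : C(T2, ℝ) := ⟨fun z => f (z + h), by fun_prop⟩

@[simp] theorem translate_apply (h : T2) (f : C(T2, ℝ)) (z : T2) : translate h f z = f (z + h) :=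
  rfl

theorem mean_translate (h : T2) (f : C(T2, ℝ)) : mean (translate h f) = mean f :=
  integral_add_right_eq_self (μ := torusMeasure) (fun z => f z) h

theorem integral_mean_swap (F : T2 → T2 → ℝ) (hF : Continuous (Function.uncurry F)) :
    ∫ x, ∫ y, F x y ∂torusMeasure ∂torusMeasure = ∫ y, ∫ x, F x y ∂torusMeasure ∂torusMeasure :=
  integral_integral_swap_of_hasCompactSupport hF (HasCompactSupport.of_compactSpace _)

/-! ### Fourier modes -/

local notation "𝐞" => UnitAddTorus.mFourier (d := Fin 2)

theorem integral_mFourier (m : Fin 2 → ℤ) :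
    ∫ z, 𝐞 m z ∂torusMeasure = if m = 0 then 1 else 0 := by
  split_ifs with h
  · simp [h, UnitAddTorus.mFourier_zero]
  · obtain ⟨i, hi⟩ := Function.ne_iff.mp h
    have h1 := integral_fintype_prod_eq_prod (𝕜 := ℂ)
      (μ := fun _ : Fin 2 => (AddCircle.haarAddCircle : Measure UnitAddCircle))
      (fun (i : Fin 2) (x : UnitAddCircle) => fourier (m i) x)
    refine h1.trans (Finset.prod_eq_zero (Finset.mem_univ i) ?_)
    -- Translation by half a period of this mode reverses its sign, so the integral of this factor
    -- is zero.
    have h2 := integral_eq_zero_of_add_right_eq_neg (μ := AddCircle.haarAddCircle)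
      (fourier_add_half_inv_index (T := 1) hi one_pos)
    exact h2

theorem mFourier_apply_add (m : Fin 2 → ℤ) (z h : T2) : 𝐞 m (z + h) = 𝐞 m z * 𝐞 m h := by
  simp only [UnitAddTorus.mFourier, ContinuousMap.coe_mk, Pi.add_apply, fourier_apply, smul_add,
    AddCircle.toCircle_add, Circle.coe_mul, Finset.prod_mul_distrib]

theorem norm_mFourier_apply (m : Fin 2 → ℤ) (z : T2) : ‖𝐞 m z‖ = 1 := by
  simp only [UnitAddTorus.mFourier, ContinuousMap.coe_mk, fourier_apply, norm_prod, Circle.norm_coe,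
    Finset.prod_const_one]

/-- The function `z ↦ cos (2π m·z)`. -/
abbrev cosC (m : Fin 2 → ℤ) : C(T2, ℝ) := (cosMode m).1

/-- The function `z ↦ sin (2π m·z)`. -/
abbrev sinC (m : Fin 2 → ℤ) : C(T2, ℝ) := (sinMode m).1

theorem cosC_apply (m : Fin 2 → ℤ) (z : T2) : cosC m z = (𝐞 m z).re := rfl

theorem sinC_apply (m : Fin 2 → ℤ) (z : T2) : sinC m z = (𝐞 m z).im := rfl

theorem cosC_sq_add_sinC_sq (m : Fin 2 → ℤ) (z : T2) : cosC m z ^ 2 + sinC m z ^ 2 = 1 := by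
  have h := Complex.sq_norm (𝐞 m z)
  rw [norm_mFourier_apply, Complex.normSq_apply] at h
  rw [cosC_apply, sinC_apply]
  linarith

theorem cosC_apply_add (m : Fin 2 → ℤ) (z h : T2) :
    cosC m (z + h) = cosC m z * cosC m h - sinC m z * sinC m h := by
  simp [cosC_apply, sinC_apply, mFourier_apply_add]

theorem sinC_apply_add (m : Fin 2 → ℤ) (z h : T2) :
    sinC m (z + h) = sinC m z * cosC m h + cosC m z * sinC m h := by
  simp [cosC_apply, sinC_apply, mFourier_apply_add]
  ring

theorem cosC_zero_right (m : Fin 2 → ℤ) : cosC m 0 = 1 := by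
  simp [cosC_apply, UnitAddTorus.mFourier]

theorem sinC_zero_right (m : Fin 2 → ℤ) : sinC m 0 = 0 := by
  simp [sinC_apply, UnitAddTorus.mFourier]

/-- The addition formulas at `y + (-y) = 0` form a linear system for the two modes at `-y`, with
determinant `cos² + sin² = 1`. -/
theorem cosC_apply_neg (m : Fin 2 → ℤ) (y : T2) : cosC m (-y) = cosC m y := by
  have ha := cosC_apply_add m y (-y)
  have hb := sinC_apply_add m y (-y)
  have hc := cosC_sq_add_sinC_sq m y
  rw [add_neg_cancel, cosC_zero_right] at ha
  rw [add_neg_cancel, sinC_zero_right] at hb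
  linear_combination (-(cosC m y)) * ha - sinC m y * hb - hc * cosC m (-y)

theorem sinC_apply_neg (m : Fin 2 → ℤ) (y : T2) : sinC m (-y) = -sinC m y := by
  have ha := cosC_apply_add m y (-y)
  have hb := sinC_apply_add m y (-y)
  have hc := cosC_sq_add_sinC_sq m y
  rw [add_neg_cancel, cosC_zero_right] at ha
  rw [add_neg_cancel, sinC_zero_right] at hb
  linear_combination sinC m y * ha - cosC m y * hb - hc * sinC m (-y)

theorem cosC_add (m k : Fin 2 → ℤ) (z : T2) :
    cosC (m + k) z = cosC m z * cosC k z - sinC m z * sinC k z := by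
  simp [cosC_apply, sinC_apply, UnitAddTorus.mFourier_add]

theorem sinC_add (m k : Fin 2 → ℤ) (z : T2) :
    sinC (m + k) z = sinC m z * cosC k z + cosC m z * sinC k z := by
  simp [cosC_apply, sinC_apply, UnitAddTorus.mFourier_add]
  ring

theorem cosC_neg (m : Fin 2 → ℤ) : cosC (-m) = cosC m := by
  ext z
  simp [cosC_apply, UnitAddTorus.mFourier_neg]

theorem sinC_neg (m : Fin 2 → ℤ) : sinC (-m) = -sinC m := by
  ext z
  simp [sinC_apply, UnitAddTorus.mFourier_neg]

theorem cosMode_neg (m : Fin 2 → ℤ) : cosMode (-m) = cosMode m := Subtype.ext (cosC_neg m)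

theorem sinMode_neg (m : Fin 2 → ℤ) : sinMode (-m) = -sinMode m := Subtype.ext (sinC_neg m)

theorem integrable_mFourier (m : Fin 2 → ℤ) : Integrable (fun z => 𝐞 m z) torusMeasure :=
  (𝐞 m).continuous.integrable_of_hasCompactSupport (HasCompactSupport.of_compactSpace _)

theorem mean_cosC (m : Fin 2 → ℤ) : mean (cosC m) = if m = 0 then 1 else 0 := by
  have h := integral_re (integrable_mFourier m)
  rw [integral_mFourier] at h
  rw [mean_apply]
  refine h.trans ?_
  split_ifs <;> simp

theorem mean_sinC (m : Fin 2 → ℤ) : mean (sinC m) = 0 := by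
  have h := integral_im (integrable_mFourier m)
  rw [integral_mFourier] at h
  rw [mean_apply]
  refine h.trans ?_
  split_ifs <;> simp

theorem mean_cosC_mul_cosC (k m : Fin 2 → ℤ) : mean (cosC k * cosC m) =
    ((if k = m then 1 else 0) + if k = -m then 1 else 0) / 2 := by
  have h : cosC k * cosC m = (2 : ℝ)⁻¹ • (cosC (k + -m) + cosC (k + m)) := by
    ext z
    simp only [ContinuousMap.mul_apply, ContinuousMap.smul_apply, ContinuousMap.add_apply,
      cosC_add, cosC_neg, sinC_neg, ContinuousMap.neg_apply, smul_eq_mul]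
    ring
  rw [h, map_smul, map_add, mean_cosC, mean_cosC, smul_eq_mul]
  simp only [add_eq_zero_iff_eq_neg, neg_neg]
  ring

theorem mean_sinC_mul_sinC (k m : Fin 2 → ℤ) : mean (sinC k * sinC m) =
    ((if k = m then 1 else 0) - if k = -m then 1 else 0) / 2 := by
  have h : sinC k * sinC m = (2 : ℝ)⁻¹ • (cosC (k + -m) - cosC (k + m)) := by
    ext z
    simp only [ContinuousMap.mul_apply, ContinuousMap.smul_apply, ContinuousMap.sub_apply,
      cosC_add, cosC_neg, sinC_neg, ContinuousMap.neg_apply, smul_eq_mul]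
    ring
  rw [h, map_smul, map_sub, mean_cosC, mean_cosC, smul_eq_mul]
  simp only [add_eq_zero_iff_eq_neg, neg_neg]
  ring

theorem mean_sinC_mul_cosC (k m : Fin 2 → ℤ) : mean (sinC k * cosC m) = 0 := by
  have h : sinC k * cosC m = (2 : ℝ)⁻¹ • (sinC (k + -m) + sinC (k + m)) := by
    ext z
    simp only [ContinuousMap.mul_apply, ContinuousMap.smul_apply, ContinuousMap.add_apply,
      sinC_add, cosC_neg, sinC_neg, ContinuousMap.neg_apply, smul_eq_mul]
    ring
  rw [h, map_smul, map_add, mean_sinC, mean_sinC]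
  simp

theorem mean_cosC_mul_sinC (k m : Fin 2 → ℤ) : mean (cosC k * sinC m) = 0 := by
  rw [mul_comm, mean_sinC_mul_cosC]

/-! ### The distance to the origin and the modes -/

theorem exists_real_rep (x : UnitAddCircle) : ∃ y : ℝ, (y : UnitAddCircle) = x ∧ |y| = ‖x‖ ∧
    |y| ≤ 1 / 2 := by
  obtain ⟨y, rfl⟩ := QuotientAddGroup.mk_surjective x
  refine ⟨y - round y, ?_, (UnitAddCircle.norm_eq).symm, abs_sub_round y⟩
  have : ((round y : ℝ) : UnitAddCircle) = 0 := by
    have := AddCircle.coe_zsmul (p := (1 : ℝ)) (n := round y) (x := 1)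
    rw [zsmul_one, AddCircle.coe_period, smul_zero] at this
    exact this
  rw [AddCircle.coe_sub, this, sub_zero]

theorem norm_one_sub_fourier_coe (k : ℤ) (y : ℝ) :
    ‖1 - fourier k (y : UnitAddCircle)‖ = 2 * |Real.sin (Real.pi * k * y)| := by
  rw [fourier_coe_apply, norm_sub_rev]
  have := Complex.norm_exp_I_mul_ofReal_sub_one (2 * Real.pi * k * y)
  rw [show 2 * Real.pi * k * y / 2 = Real.pi * k * y by ring, norm_mul, Real.norm_eq_abs,
    Real.norm_eq_abs, abs_two] at this
  rw [← this]
  congr 3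
  push_cast
  ring

/-- Jordan's inequality `|sin s| ≥ (2/π)|s|` on `|s| ≤ π/2`; this is where the representative in
`[-1/2, 1/2]` is needed. -/
theorem norm_le_norm_one_sub_fourier (x : UnitAddCircle) : ‖x‖ ≤ ‖1 - fourier 1 x‖ := by
  obtain ⟨y, rfl, hy, hy'⟩ := exists_real_rep x
  rw [norm_one_sub_fourier_coe, ← hy]
  have hpi := Real.pi_pos
  have h1 : |Real.pi * ((1 : ℤ) : ℝ) * y| ≤ Real.pi / 2 := by
    rw [Int.cast_one, mul_one, abs_mul, abs_of_pos hpi]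
    nlinarith
  have h2 := Real.mul_abs_le_abs_sin h1
  rw [Int.cast_one, mul_one, abs_mul, abs_of_pos hpi, ← mul_assoc,
    div_mul_cancel₀ _ hpi.ne'] at h2
  rw [Int.cast_one, mul_one]
  linarith [abs_nonneg y]

theorem norm_one_sub_fourier_le (k : ℤ) (x : UnitAddCircle) :
    ‖1 - fourier k x‖ ≤ 2 * Real.pi * |(k : ℝ)| * ‖x‖ := by
  obtain ⟨y, rfl, hy, -⟩ := exists_real_rep x
  rw [norm_one_sub_fourier_coe, ← hy]
  have h := Real.abs_sin_le_abs (x := Real.pi * k * y)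
  rw [abs_mul, abs_mul, abs_of_pos Real.pi_pos] at h
  linarith

theorem norm_one_sub_mFourier_le (m : Fin 2 → ℤ) (h : T2) :
    ‖1 - 𝐞 m h‖ ≤ 2 * Real.pi * (|(m 0 : ℝ)| + |(m 1 : ℝ)|) * ‖h‖ := by
  have e : 1 - 𝐞 m h = (1 - fourier (m 0) (h 0)) + fourier (m 0) (h 0) * (1 - fourier (m 1) (h 1)) := by
    simp only [UnitAddTorus.mFourier, ContinuousMap.coe_mk, Fin.prod_univ_two]
    ring
  have h0 := norm_one_sub_fourier_le (m 0) (h 0)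
  have h1 := norm_one_sub_fourier_le (m 1) (h 1)
  have n0 := norm_le_pi_norm h 0
  have n1 := norm_le_pi_norm h 1
  have e1 : ‖(fourier (m 0) (h 0) : ℂ)‖ = 1 := by rw [fourier_apply, Circle.norm_coe]
  rw [e]
  refine (norm_add_le _ _).trans ?_
  rw [norm_mul, e1, one_mul]
  have := Real.pi_pos
  calc _ ≤ 2 * Real.pi * |(m 0 : ℝ)| * ‖h 0‖ + 2 * Real.pi * |(m 1 : ℝ)| * ‖h 1‖ := add_le_add h0 h1
    _ ≤ 2 * Real.pi * |(m 0 : ℝ)| * ‖h‖ + 2 * Real.pi * |(m 1 : ℝ)| * ‖h‖ := by gcongr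
    _ = _ := by ring

theorem norm_sq_le_sum_norm_one_sub_fourier (h : T2) :
    ‖h‖ ^ 2 ≤ ∑ i, ‖1 - fourier 1 (h i)‖ ^ 2 := by
  obtain ⟨i, hi⟩ : ∃ i, ‖h‖ ≤ ‖h i‖ := by
    by_contra! hc
    have := (pi_norm_lt_iff ((norm_nonneg _).trans_lt (hc 0))).2 hc
    exact lt_irrefl _ this
  calc ‖h‖ ^ 2 ≤ ‖1 - fourier 1 (h i)‖ ^ 2 := by
        gcongr
        exact hi.trans (norm_le_norm_one_sub_fourier _)
    _ ≤ _ := Finset.single_le_sum (f := fun i => ‖1 - fourier 1 (h i)‖ ^ 2)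
        (fun _ _ => by positivity) (Finset.mem_univ i)

theorem norm_torus_le_one (h : T2) : ‖h‖ ≤ 1 := by
  refine (pi_norm_le_iff_of_nonneg zero_le_one).2 fun i => ?_
  obtain ⟨y, -, hy, hy'⟩ := exists_real_rep (h i)
  rw [← hy]
  linarith

/-! ### Trigonometric kernels -/

/-- An even real trigonometric polynomial `∑ₘ qₘ cos (2π m·z)`. -/
structure TrigKernel where
  freq : Finset (Fin 2 → ℤ)
  coeff : (Fin 2 → ℤ) → ℝ

namespace TrigKernel

/-- The kernel as a continuous function. -/
def ker (K : TrigKernel) : C(T2, ℝ) := ∑ m ∈ K.freq, K.coeff m • cosC m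

/-- Convolution with the kernel. -/
def conv (K : TrigKernel) (f : C(T2, ℝ)) : C(T2, ℝ) :=
  ∑ m ∈ K.freq, K.coeff m • (mean (f * cosC m) • cosC m + mean (f * sinC m) • sinC m)

/-- The kernel contains only cosines, hence is even, so convolution is the weighted average of
translates. Positivity of the kernel is exploited through this formula, while the defining Fourier
sum serves for the equation. -/
theorem conv_apply (K : TrigKernel) (f : C(T2, ℝ)) (z : T2) :
    K.conv f z = mean (K.ker * translate z f) := by
  have h1 : K.ker * translate z f = translate z (translate (-z) K.ker * f) := by
    ext y
    simp
  have h2 : translate (-z) K.ker * f = ∑ m ∈ K.freq, K.coeff m •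
      (cosC m z • (f * cosC m) + sinC m z • (f * sinC m)) := by
    ext y
    have h3 : ∀ m, cosC m (y + -z) = cosC m z * cosC m y + sinC m z * sinC m y := fun m => by
      rw [cosC_apply_add, cosC_apply_neg, sinC_apply_neg]
      ring
    simp only [ker, ContinuousMap.mul_apply, translate_apply, ContinuousMap.sum_apply,
      ContinuousMap.smul_apply, ContinuousMap.add_apply, smul_eq_mul, h3, Finset.sum_mul]
    exact Finset.sum_congr rfl fun m _ => by ring
  rw [h1, mean_translate, h2, map_sum, conv, ContinuousMap.sum_apply]
  refine Finset.sum_congr rfl fun m _ => ?_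
  simp only [map_smul, map_add, ContinuousMap.smul_apply, ContinuousMap.add_apply, smul_eq_mul]
  ring

theorem conv_add (K : TrigKernel) (f g : C(T2, ℝ)) : K.conv (f + g) = K.conv f + K.conv g := by
  ext z
  have : translate z (f + g) = translate z f + translate z g := rfl
  simp [conv_apply, this, mul_add]

theorem conv_smul (K : TrigKernel) (c : ℝ) (f : C(T2, ℝ)) : K.conv (c • f) = c • K.conv f := by
  ext z
  have : translate z (c • f) = c • translate z f := rfl
  simp [conv_apply, this]

theorem conv_sub (K : TrigKernel) (f g : C(T2, ℝ)) : K.conv (f - g) = K.conv f - K.conv g := by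
  ext z
  have : translate z (f - g) = translate z f - translate z g := rfl
  simp [conv_apply, this, mul_sub]

theorem conv_translate (K : TrigKernel) (h : T2) (f : C(T2, ℝ)) :
    K.conv (translate h f) = translate h (K.conv f) := by
  ext z
  have : translate z (translate h f) = translate (z + h) f := by
    ext y
    simp [add_assoc]
  simp [conv_apply, this]

/-- Convolution is symmetric. -/
theorem mean_conv_mul (K : TrigKernel) (f g : C(T2, ℝ)) :
    mean (K.conv f * g) = mean (f * K.conv g) := by
  have h : ∀ f g : C(T2, ℝ), mean (K.conv f * g) = ∑ m ∈ K.freq, K.coeff m *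
      (mean (f * cosC m) * mean (g * cosC m) + mean (f * sinC m) * mean (g * sinC m)) := by
    intro f g
    rw [conv, Finset.sum_mul, map_sum]
    refine Finset.sum_congr rfl fun m _ => ?_
    simp only [smul_mul_assoc, add_mul, map_smul, map_add, smul_eq_mul, mul_comm (cosC m) g,
      mul_comm (sinC m) g]
  rw [h, mul_comm f, h]
  exact Finset.sum_congr rfl fun m _ => by ring

/-- The kernel `q ∑ₓ cos (2π φ(x)·z)`. -/
def ofSum {ι : Type*} (X : Finset ι) (φ : ι → Fin 2 → ℤ) (q : ℝ) : TrigKernel where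
  freq := X.image φ
  coeff m := q * (X.filter fun x => φ x = m).card

theorem ker_ofSum {ι : Type*} (X : Finset ι) (φ : ι → Fin 2 → ℤ) (q : ℝ) :
    (ofSum X φ q).ker = q • ∑ x ∈ X, cosC (φ x) := by
  rw [ker, Finset.sum_comp (fun m => cosC m) φ, Finset.smul_sum]
  refine Finset.sum_congr rfl fun m _ => ?_
  simp only [ofSum, mul_smul, Nat.cast_smul_eq_nsmul]

end TrigKernel

/-! ### Trigonometric sums -/

/-- The trigonometric sum `∑ₓ c(x) e^{2πi φ(x)·z}`. -/
def trigSum {ι : Type*} (X : Finset ι) (c : ι → ℂ) (φ : ι → Fin 2 → ℤ) (z : T2) : ℂ :=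
  ∑ x ∈ X, c x * 𝐞 (φ x) z

@[fun_prop]
theorem continuous_trigSum {ι : Type*} (X : Finset ι) (c : ι → ℂ) (φ : ι → Fin 2 → ℤ) :
    Continuous (trigSum X c φ) := by
  unfold trigSum
  fun_prop

/-- Both kernels below are built as such products: frequencies appear as differences, so
coefficients become counts of pairs, while sizes can be estimated in `L²`. -/
theorem trigSum_mul_conj_re {ι κ : Type*} (X : Finset ι) (φ : ι → Fin 2 → ℤ) (Y : Finset κ)
    (ψ : κ → Fin 2 → ℤ) (z : T2) :
    (trigSum X 1 φ z * (starRingEnd ℂ) (trigSum Y 1 ψ z)).re =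
      (∑ p ∈ X ×ˢ Y, cosC (φ p.1 - ψ p.2)) z := by
  simp only [trigSum, Pi.one_apply, one_mul, map_sum, Finset.sum_mul_sum, Complex.re_sum,
    ContinuousMap.sum_apply, Finset.sum_product]
  refine Finset.sum_congr rfl fun x _ => Finset.sum_congr rfl fun y _ => ?_
  rw [← UnitAddTorus.mFourier_neg, ← UnitAddTorus.mFourier_add, cosC_apply, sub_eq_add_neg]

theorem mean_sum_cosC_sub {ι κ : Type*} (X : Finset ι) (φ : ι → Fin 2 → ℤ) (Y : Finset κ)
    (ψ : κ → Fin 2 → ℤ) : mean (∑ p ∈ X ×ˢ Y, cosC (φ p.1 - ψ p.2)) =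
      ((X ×ˢ Y).filter fun p => φ p.1 = ψ p.2).card := by
  simp only [map_sum, mean_cosC, sub_eq_zero, Finset.sum_boole]

/-- The squared modulus of a trigonometric sum. -/
def trigSumSq {ι : Type*} (X : Finset ι) (c : ι → ℂ) (φ : ι → Fin 2 → ℤ) : C(T2, ℝ) :=
  ⟨fun z => ‖trigSum X c φ z‖ ^ 2, by fun_prop⟩

/-- Parseval's identity for a finite sum of distinct frequencies. -/
theorem mean_trigSumSq (S : Finset (Fin 2 → ℤ)) (c : (Fin 2 → ℤ) → ℂ) :
    mean (trigSumSq S c id) = ∑ a ∈ S, ‖c a‖ ^ 2 := by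
  have h1 : ∀ z, ((trigSumSq S c id z : ℝ) : ℂ) =
      ∑ a ∈ S, ∑ b ∈ S, c a * (starRingEnd ℂ) (c b) * 𝐞 (a - b) z := fun z => by
    simp only [trigSumSq, ContinuousMap.coe_mk, Complex.ofReal_pow]
    rw [← Complex.mul_conj', trigSum, map_sum, Finset.sum_mul_sum]
    refine Finset.sum_congr rfl fun a _ => Finset.sum_congr rfl fun b _ => ?_
    rw [sub_eq_add_neg, UnitAddTorus.mFourier_add, UnitAddTorus.mFourier_neg, map_mul, id, id]
    ring
  have h2 : ((mean (trigSumSq S c id) : ℝ) : ℂ) = ((∑ a ∈ S, ‖c a‖ ^ 2 : ℝ) : ℂ) := by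
    rw [mean_apply, ← integral_complex_ofReal]
    simp_rw [h1]
    rw [integral_finsetSum _ fun a _ => integrable_finsetSum _ fun b _ =>
      (integrable_mFourier _).const_mul _]
    push_cast
    refine Finset.sum_congr rfl fun a ha => ?_
    rw [integral_finsetSum _ fun b _ => (integrable_mFourier _).const_mul _]
    simp_rw [integral_const_mul, integral_mFourier, sub_eq_zero]
    rw [← Complex.mul_conj']
    simp [ha]
  exact_mod_cast h2

/-! ### Boxes of frequencies -/

/-- The box `[a, b)²` of integer frequencies. -/
def freqBox (a b : ℤ) : Finset (Fin 2 → ℤ) := Fintype.piFinset fun _ => Finset.Ico a b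

theorem mem_freqBox {a b : ℤ} {m : Fin 2 → ℤ} : m ∈ freqBox a b ↔ ∀ i, a ≤ m i ∧ m i < b := by
  simp [freqBox]

theorem card_freqBox {a b : ℤ} (h : a ≤ b) : ((freqBox a b).card : ℝ) = ((b : ℝ) - a) ^ 2 := by
  have : (((b - a).toNat : ℤ) : ℝ) = (b : ℝ) - a := by
    rw [Int.toNat_of_nonneg (by omega)]
    push_cast
    rfl
  rw [freqBox, Fintype.card_piFinset]
  simp only [Int.card_Ico, Finset.prod_const, Finset.card_univ, Fintype.card_fin, Nat.cast_pow]
  rw [← this, Int.cast_natCast]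

theorem trigSum_freqBox (N : ℕ) (z : T2) : trigSum (freqBox 0 N) 1 id z =
    ∏ i, ∑ k ∈ Finset.range N, (fourier 1 (z i) : ℂ) ^ k := by
  have h : ∀ x : UnitAddCircle, ∑ k ∈ Finset.range N, (fourier 1 x : ℂ) ^ k =
      ∑ k ∈ Finset.Ico (0 : ℤ) N, (fourier k x : ℂ) := fun x => by
    refine Finset.sum_nbij (fun k => (k : ℤ)) (by simp) (by intro; simp) ?_ ?_
    · intro k hk
      simp only [Finset.coe_Ico, Set.mem_Ico] at hk
      exact ⟨k.toNat, by simp; omega, by simp; omega⟩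
    · intro k _
      simp [fourier_apply, AddCircle.toCircle_nsmul]
  simp_rw [h, Finset.prod_univ_sum]
  simp [trigSum, freqBox, UnitAddTorus.mFourier]

/-- The sum over a box is a product of two geometric sums: in direction `i` it telescopes to at most
`2`, and in the other it has `N` terms of modulus one. -/
theorem norm_one_sub_fourier_mul_trigSum_le (N : ℕ) (z : T2) (i : Fin 2) :
    ‖1 - fourier 1 (z i)‖ * ‖trigSum (freqBox 0 N) 1 id z‖ ≤ 2 * N := by
  have hn : ∀ j, ‖(fourier 1 (z j) : ℂ)‖ = 1 := fun j => by rw [fourier_apply, Circle.norm_coe]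
  have h1 : ∀ j, ‖∑ k ∈ Finset.range N, (fourier 1 (z j) : ℂ) ^ k‖ ≤ N := fun j => by
    refine (norm_sum_le _ _).trans ?_
    simp only [norm_pow, hn, one_pow, Finset.sum_const, Finset.card_range, nsmul_eq_mul, mul_one,
      le_refl]
  have h2 : ∀ j, ‖1 - (fourier 1 (z j) : ℂ)‖ * ‖∑ k ∈ Finset.range N, (fourier 1 (z j) : ℂ) ^ k‖
      ≤ 2 := fun j => by
    rw [← norm_mul, mul_comm, geom_sum_mul_neg]
    refine (norm_sub_le _ _).trans ?_
    simp only [norm_one, norm_pow, hn, one_pow]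
    norm_num
  rw [trigSum_freqBox, Fin.prod_univ_two, norm_mul]
  fin_cases i
  · rw [← mul_assoc]
    exact mul_le_mul (h2 0) (h1 1) (norm_nonneg _) (by norm_num)
  · rw [mul_left_comm, mul_comm]
    exact mul_le_mul (h2 1) (h1 0) (norm_nonneg _) (by norm_num)

/-! ### The Jackson kernel -/

/-- The distance to the origin as a continuous function on the torus. -/
def normC : C(T2, ℝ) := ⟨fun h => ‖h‖, continuous_norm⟩

@[simp] theorem normC_apply (h : T2) : normC h = ‖h‖ := rfl

/-- A nonnegative trigonometric kernel of mean one, of degree less than `2 N`, with second moment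
of order `N⁻²`. -/
structure IsMollifier (K : TrigKernel) (N : ℕ) : Prop where
  nonneg : ∀ h, 0 ≤ K.ker h
  mean_ker : mean K.ker = 1
  freq_lt : ∀ m ∈ K.freq, ∀ i, |m i| < 2 * N
  moment : mean (K.ker * normC ^ 2) ≤ 32 / (N : ℝ) ^ 2

/-- The right side is `∫ |D|⁴` for the Dirichlet sum `D` over the box of side `N`, the normalisation
of the Jackson kernel. Cauchy–Schwarz against the Dirichlet sum over the doubled box, which contains
all frequencies of `D²`, gives `(N⁴)² ≤ (∫ |D|⁴) (2N)²`. -/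
theorem mean_sum_cosC_sq_ge {N : ℕ} (hN : 0 < N) :
    (N : ℝ) ^ 6 / 4 ≤ mean (∑ p ∈ (freqBox 0 N ×ˢ freqBox 0 N) ×ˢ (freqBox 0 N ×ˢ freqBox 0 N),
      cosC ((p.1.1 + p.1.2) - (p.2.1 + p.2.2))) := by
  set S := freqBox 0 N
  set X := S ×ˢ S
  set φ : (Fin 2 → ℤ) × (Fin 2 → ℤ) → Fin 2 → ℤ := fun x => x.1 + x.2
  set E := freqBox 0 (2 * N)
  have hS : (S.card : ℝ) = (N : ℝ) ^ 2 := by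
    have := card_freqBox (a := 0) (b := N) (by omega)
    simpa using this
  have hE : (E.card : ℝ) = (2 * N : ℝ) ^ 2 := by
    have := card_freqBox (a := 0) (b := 2 * N) (by omega)
    simpa using this
  have hN' : (0 : ℝ) < N := by exact_mod_cast hN
  have h1 : (N : ℝ) ^ 4 ≤ mean (∑ p ∈ X ×ˢ E, cosC (φ p.1 - id p.2)) := by
    rw [mean_sum_cosC_sub]
    have hc : X.card ≤ ((X ×ˢ E).filter fun p => φ p.1 = id p.2).card := by
      refine Finset.card_le_card_of_injOn (fun x => (x, φ x)) ?_ ?_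
      · intro x hx
        have hx' := Finset.mem_product.1 (Finset.mem_coe.1 hx)
        have ha := mem_freqBox.1 hx'.1
        have hb := mem_freqBox.1 hx'.2
        simp only [Finset.coe_filter, Finset.mem_product, Set.mem_ofPred_eq, id, and_true]
        refine ⟨hx, mem_freqBox.2 fun i => ?_⟩
        have := ha i
        have := hb i
        simp only [φ, Pi.add_apply]
        omega
      · intro x _ y _ hxy
        exact (Prod.ext_iff.1 hxy).1
    have hX : (X.card : ℝ) = (N : ℝ) ^ 4 := by
      rw [Finset.card_product, Nat.cast_mul, hS]
      ring
    rw [← hX]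
    exact_mod_cast hc
  have h2 : mean (∑ p ∈ E ×ˢ E, cosC (id p.1 - id p.2)) = (2 * N : ℝ) ^ 2 := by
    rw [mean_sum_cosC_sub, ← hE]
    congr 1
    refine (Finset.card_nbij' (fun p => p.1) (fun x => (x, x)) ?_ ?_ ?_ ?_)
    · intro p hp
      simp at hp ⊢
      exact hp.1.1
    · intro x hx
      simpa using hx
    · intro p hp
      simp at hp
      exact Prod.ext rfl hp.2
    · intro x _
      rfl
  have h3 : mean (∑ p ∈ X ×ˢ E, cosC (φ p.1 - id p.2)) ≤
      mean ((2 / (N : ℝ) ^ 2) • (∑ p ∈ X ×ˢ X, cosC (φ p.1 - φ p.2)) +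
        ((N : ℝ) ^ 2 / 8) • (∑ p ∈ E ×ˢ E, cosC (id p.1 - id p.2))) := by
    refine mean_mono fun z => ?_
    simp only [ContinuousMap.add_apply, ContinuousMap.smul_apply, smul_eq_mul,
      ← trigSum_mul_conj_re]
    set A := trigSum X 1 φ z
    set B := trigSum E 1 id z
    have ha : (A * (starRingEnd ℂ) A).re = ‖A‖ ^ 2 := by
      rw [Complex.mul_conj']
      norm_cast
    have hb : (B * (starRingEnd ℂ) B).re = ‖B‖ ^ 2 := by
      rw [Complex.mul_conj']
      norm_cast
    have hab : (A * (starRingEnd ℂ) B).re ≤ ‖A‖ * ‖B‖ := by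
      refine (Complex.re_le_norm _).trans ?_
      rw [norm_mul, RCLike.norm_conj]
    rw [ha, hb]
    refine hab.trans ?_
    -- Cauchy–Schwarz as a weighted square; this weight gives the doubled box a share `N⁴/2`, half
    -- of the lower bound for the cross term.
    have : 0 ≤ 2 / (N : ℝ) ^ 2 * (‖A‖ - (N : ℝ) ^ 2 / 4 * ‖B‖) ^ 2 := by positivity
    have h4 : 2 / (N : ℝ) ^ 2 * (‖A‖ - (N : ℝ) ^ 2 / 4 * ‖B‖) ^ 2 =
        2 / (N : ℝ) ^ 2 * ‖A‖ ^ 2 - ‖A‖ * ‖B‖ + (N : ℝ) ^ 2 / 8 * ‖B‖ ^ 2 := by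
      field_simp
      ring
    linarith
  rw [map_add, map_smul, map_smul, h2, smul_eq_mul, smul_eq_mul] at h3
  have h4 := h1.trans h3
  have h5 : (N : ℝ) ^ 4 / 2 ≤
      2 / (N : ℝ) ^ 2 * mean (∑ p ∈ X ×ˢ X, cosC (φ p.1 - φ p.2)) := by linarith
  rw [div_mul_eq_mul_div, le_div_iff₀ (by positivity)] at h5
  change _ ≤ mean (∑ p ∈ X ×ˢ X, cosC (φ p.1 - φ p.2))
  linarith

/-- The kernel is `|D|⁴` divided by its mean. In the second moment, `|z|²` is absorbed by two of the
four factors `D`, since `|z|² |D|² ≤ 8 N²`; the other two contribute `∫ |D|² = N²`. -/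
theorem exists_isMollifier {N : ℕ} (hN : 0 < N) : ∃ K : TrigKernel, IsMollifier K N := by
  set S := freqBox 0 N with hSdef
  set X := S ×ˢ S
  set φ : (Fin 2 → ℤ) × (Fin 2 → ℤ) → Fin 2 → ℤ := fun x => x.1 + x.2
  have hN' : (0 : ℝ) < N := by exact_mod_cast hN
  set c := mean (∑ p ∈ X ×ˢ X, cosC (φ p.1 - φ p.2)) with hc
  have hc1 : (N : ℝ) ^ 6 / 4 ≤ c := mean_sum_cosC_sq_ge hN
  have hc0 : 0 < c := lt_of_lt_of_le (by positivity) hc1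
  set K := TrigKernel.ofSum (X ×ˢ X) (fun p => φ p.1 - φ p.2) c⁻¹
  have hK : ∀ z, K.ker z = c⁻¹ * ‖trigSum S 1 id z‖ ^ 4 := fun z => by
    rw [TrigKernel.ker_ofSum, ContinuousMap.smul_apply, ← trigSum_mul_conj_re, Complex.mul_conj',
      smul_eq_mul]
    have : trigSum X 1 φ z = trigSum S 1 id z * trigSum S 1 id z := by
      simp only [trigSum, Finset.sum_mul_sum, X, Finset.sum_product, φ,
        UnitAddTorus.mFourier_add, Pi.one_apply, one_mul, id]
    rw [this, norm_mul]
    norm_cast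
    ring
  have hnn : ∀ h, 0 ≤ K.ker h := fun h => by
    rw [hK]
    positivity
  refine ⟨K, hnn, ?_, ?_, ?_⟩
  · rw [TrigKernel.ker_ofSum, map_smul, ← hc, smul_eq_mul, inv_mul_cancel₀ hc0.ne']
  · intro m hm i
    obtain ⟨p, hp, rfl⟩ := Finset.mem_image.1 hm
    simp only [X, Finset.mem_product] at hp
    have h1 := mem_freqBox.1 hp.1.1 i
    have h2 := mem_freqBox.1 hp.1.2 i
    have h3 := mem_freqBox.1 hp.2.1 i
    have h4 := mem_freqBox.1 hp.2.2 i
    simp only [φ, Pi.sub_apply, Pi.add_apply]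
    rw [abs_lt]
    omega
  · have h1 : mean (K.ker * normC ^ 2) ≤ mean ((c⁻¹ * (8 * (N : ℝ) ^ 2)) • trigSumSq S 1 id) := by
      refine mean_mono fun z => ?_
      simp only [ContinuousMap.mul_apply, ContinuousMap.pow_apply, normC_apply,
        ContinuousMap.smul_apply, smul_eq_mul, trigSumSq, ContinuousMap.coe_mk, hK]
      set D := ‖trigSum S 1 id z‖
      have h2 : ∀ i, ‖1 - fourier 1 (z i)‖ ^ 2 * D ^ 2 ≤ 4 * (N : ℝ) ^ 2 := fun i => by
        have := norm_one_sub_fourier_mul_trigSum_le N z i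
        rw [← mul_pow]
        calc _ ≤ (2 * (N : ℝ)) ^ 2 := by gcongr
          _ = _ := by ring
      have h3 : ‖z‖ ^ 2 * D ^ 2 ≤ 8 * (N : ℝ) ^ 2 := by
        have h4 := norm_sq_le_sum_norm_one_sub_fourier z
        rw [Fin.sum_univ_two] at h4
        have := mul_le_mul_of_nonneg_right h4 (sq_nonneg D)
        have := h2 0
        have := h2 1
        linarith
      calc c⁻¹ * D ^ 4 * ‖z‖ ^ 2 = c⁻¹ * (‖z‖ ^ 2 * D ^ 2) * D ^ 2 := by ring
        _ ≤ c⁻¹ * (8 * (N : ℝ) ^ 2) * D ^ 2 := by gcongr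
    have h2 : mean (trigSumSq S 1 id) = (N : ℝ) ^ 2 := by
      rw [mean_trigSumSq]
      have := card_freqBox (a := 0) (b := N) (by omega)
      simpa using this
    rw [map_smul, h2, smul_eq_mul] at h1
    refine h1.trans ?_
    have h3 : c⁻¹ ≤ 4 / (N : ℝ) ^ 6 := by
      rw [← one_div, div_le_div_iff₀ hc0 (by positivity)]
      linarith
    calc c⁻¹ * (8 * (N : ℝ) ^ 2) * (N : ℝ) ^ 2
        ≤ 4 / (N : ℝ) ^ 6 * (8 * (N : ℝ) ^ 2) * (N : ℝ) ^ 2 := by gcongr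
      _ = _ := by field_simp; norm_num

/-- The modulus `z ↦ |z|^θ` as a continuous function. -/
def normPow (θ : ℝ) (hθ : 0 ≤ θ) : C(T2, ℝ) :=
  ⟨fun h => ‖h‖ ^ θ, continuous_norm.rpow_const fun _ => Or.inr hθ⟩

theorem IsMollifier.moment_rpow {K : TrigKernel} {N : ℕ} (hK : IsMollifier K N) (hN : 0 < N)
    {θ : ℝ} (hθ : 0 ≤ θ) (hθ2 : θ ≤ 2) :
    mean (K.ker * normPow θ hθ) ≤ 33 * (N : ℝ) ^ (-θ) := by
  have hN' : (0 : ℝ) < N := by exact_mod_cast hN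
  have h1 : mean (K.ker * normPow θ hθ) ≤
      mean ((N : ℝ) ^ (-θ) • (K.ker + (N : ℝ) ^ 2 • (K.ker * normC ^ 2))) := by
    refine mean_mono fun z => ?_
    simp only [ContinuousMap.mul_apply, ContinuousMap.smul_apply, ContinuousMap.add_apply,
      ContinuousMap.pow_apply, normC_apply, smul_eq_mul, normPow, ContinuousMap.coe_mk]
    -- The two terms integrate to at most `1` and `32`, whence the constant `33`.
    have h2 : (N * ‖z‖ : ℝ) ^ θ ≤ 1 + (N * ‖z‖) ^ 2 := by
      rcases le_total (N * ‖z‖) 1 with h | h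
      · have := Real.rpow_le_one (by positivity) h hθ
        nlinarith [sq_nonneg (N * ‖z‖)]
      · have := Real.rpow_le_rpow_of_exponent_le h hθ2
        rw [Real.rpow_two] at this
        linarith
    have h3 : ‖z‖ ^ θ = (N : ℝ) ^ (-θ) * (N * ‖z‖ : ℝ) ^ θ := by
      rw [Real.mul_rpow hN'.le (norm_nonneg _), ← mul_assoc, ← Real.rpow_add hN']
      simp
    rw [h3]
    have := hK.nonneg z
    calc K.ker z * ((N : ℝ) ^ (-θ) * (N * ‖z‖ : ℝ) ^ θ)
        ≤ K.ker z * ((N : ℝ) ^ (-θ) * (1 + (N * ‖z‖) ^ 2)) := by gcongr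
      _ = _ := by ring
  refine h1.trans ?_
  rw [map_smul, map_add, map_smul, hK.mean_ker, smul_eq_mul, smul_eq_mul, mul_comm]
  have h4 : (N : ℝ) ^ 2 * mean (K.ker * normC ^ 2) ≤ 32 := by
    calc _ ≤ (N : ℝ) ^ 2 * (32 / (N : ℝ) ^ 2) := by gcongr; exact hK.moment
      _ = 32 := by field_simp
  gcongr
  linarith

/-! ### The reproducing kernel and Bernstein's inequality -/

/-- Each `a` in `[0, N)²` pairs with exactly one frequency `a + m`, and the larger box is chosen to
contain it. Thus the kernel `N⁻²` times the sum over pairs has full weight on all frequencies below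
`N`. -/
theorem sum_freqBox_indicator {N : ℕ} {m : Fin 2 → ℤ} (hm : ∀ i, |m i| < N) :
    ∑ p ∈ freqBox (-N) (2 * N) ×ˢ freqBox 0 N, (if p.1 - p.2 = m then (1 : ℝ) else 0) =
      (N : ℝ) ^ 2 := by
  have hS : ((freqBox 0 N).card : ℝ) = (N : ℝ) ^ 2 := by
    have := card_freqBox (a := 0) (b := N) (by omega)
    simpa using this
  rw [Finset.sum_product_right, ← hS, Finset.card_eq_sum_ones, Nat.cast_sum]
  refine Finset.sum_congr rfl fun a ha => ?_
  simp only [sub_eq_iff_eq_add]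
  rw [Finset.sum_ite_eq', if_pos, Nat.cast_one]
  refine mem_freqBox.2 fun i => ?_
  have h1 := abs_lt.1 (hm i)
  have h2 := mem_freqBox.1 ha i
  simp only [Pi.add_apply]
  omega

theorem mean_trigSumSq_translate_le {a b : ℤ} (hab : a ≤ b) {R : ℝ}
    (hR : ∀ m ∈ freqBox a b, ∀ i, |(m i : ℝ)| ≤ R) (h : T2) :
    mean (trigSumSq (freqBox a b) (fun m => 𝐞 m h - 1) id) ≤
      ((b : ℝ) - a) ^ 2 * (4 * Real.pi * R * ‖h‖) ^ 2 := by
  rw [mean_trigSumSq, ← card_freqBox hab, ← nsmul_eq_mul]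
  refine Finset.sum_le_card_nsmul _ _ _ fun m hm => ?_
  have h1 := norm_one_sub_mFourier_le m h
  have h2 := hR m hm
  have hpi := Real.pi_pos
  rw [norm_sub_rev]
  gcongr
  refine h1.trans ?_
  have := h2 0
  have := h2 1
  calc 2 * Real.pi * (|(m 0 : ℝ)| + |(m 1 : ℝ)|) * ‖h‖ ≤ 2 * Real.pi * (R + R) * ‖h‖ := by gcongr
    _ = _ := by ring

theorem trigSum_apply_add {S : Finset (Fin 2 → ℤ)} (z h : T2) :
    trigSum S 1 id (z + h) = trigSum S 1 id z + trigSum S (fun m => 𝐞 m h - 1) id z := by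
  simp only [trigSum, Pi.one_apply, one_mul, id, mFourier_apply_add, ← Finset.sum_add_distrib]
  exact Finset.sum_congr rfl fun m _ => by ring

/-- The kernel is `N⁻²` times a product of two trigonometric sums. Its increment is treated by the
product rule, and each term by Cauchy–Schwarz and Parseval. -/
theorem mean_abs_translate_sub_ofSum_le {N : ℕ} (hN : 0 < N) (h : T2) :
    mean |translate h (TrigKernel.ofSum (freqBox (-N) (2 * N) ×ˢ freqBox 0 N)
        (fun p => p.1 - p.2) ((N : ℝ) ^ 2)⁻¹).ker - (TrigKernel.ofSum
        (freqBox (-N) (2 * N) ×ˢ freqBox 0 N) (fun p => p.1 - p.2) ((N : ℝ) ^ 2)⁻¹).ker| ≤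
      80 * Real.pi * N * ‖h‖ := by
  have hN' : (0 : ℝ) < N := by exact_mod_cast hN
  set S := freqBox 0 N with hS
  set S' := freqBox (-N) (2 * N) with hS'
  set K := TrigKernel.ofSum (S' ×ˢ S) (fun p => p.1 - p.2) ((N : ℝ) ^ 2)⁻¹ with hKdef
  have hK : ∀ z, K.ker z = ((N : ℝ) ^ 2)⁻¹ *
      (trigSum S' 1 id z * (starRingEnd ℂ) (trigSum S 1 id z)).re := fun z => by
    rw [trigSum_mul_conj_re, hKdef, TrigKernel.ker_ofSum, ContinuousMap.smul_apply, smul_eq_mul]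
    rfl
  rcases eq_or_ne h 0 with rfl | hh
  · have : |translate 0 K.ker - K.ker| = 0 := by
      ext z
      simp
    rw [this, map_zero]
    positivity
  -- A bound for `|e(m·h) - 1|` over both boxes, where `|mᵢ| ≤ 2N`; as weight in the
  -- arithmetic-geometric inequality it balances the two terms.
  set s := 8 * Real.pi * N * ‖h‖ with hs
  have hs0 : 0 < s := by
    have := norm_pos_iff.2 hh
    have := Real.pi_pos
    positivity
  set d : (Fin 2 → ℤ) → ℂ := fun m => 𝐞 m h - 1
  have key : mean |translate h K.ker - K.ker| ≤ mean (((N : ℝ) ^ 2)⁻¹ •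
      ((2 * s)⁻¹ • trigSumSq S' d id + (s / 2) • translate h (trigSumSq S 1 id) +
       ((2 * s)⁻¹ • trigSumSq S d id + (s / 2) • trigSumSq S' 1 id))) := by
    refine mean_mono fun z => ?_
    have amgm : ∀ x y : ℝ, x * y ≤ (2 * s)⁻¹ * x ^ 2 + s / 2 * y ^ 2 := fun x y => by
      have h1 : 0 ≤ (2 * s)⁻¹ * (x - s * y) ^ 2 := by positivity
      have h2 : (2 * s)⁻¹ * (x - s * y) ^ 2 = (2 * s)⁻¹ * x ^ 2 + s / 2 * y ^ 2 - x * y := by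
        field_simp
        ring
      linarith
    simp only [ContinuousMap.abs_apply, ContinuousMap.sub_apply, translate_apply, hK,
      ContinuousMap.smul_apply, ContinuousMap.add_apply, smul_eq_mul, trigSumSq,
      ContinuousMap.coe_mk]
    rw [← mul_sub, abs_mul, abs_of_nonneg (by positivity : 0 ≤ ((N : ℝ) ^ 2)⁻¹)]
    gcongr
    rw [← Complex.sub_re]
    refine (Complex.abs_re_le_norm _).trans ?_
    have h1 : trigSum S' 1 id (z + h) * (starRingEnd ℂ) (trigSum S 1 id (z + h)) -
        trigSum S' 1 id z * (starRingEnd ℂ) (trigSum S 1 id z) =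
        trigSum S' d id z * (starRingEnd ℂ) (trigSum S 1 id (z + h)) +
        (starRingEnd ℂ) (trigSum S d id z) * trigSum S' 1 id z := by
      simp only [trigSum_apply_add, map_add, d]
      ring
    rw [h1]
    refine (norm_add_le _ _).trans ?_
    rw [norm_mul, norm_mul, RCLike.norm_conj, RCLike.norm_conj]
    exact add_le_add (amgm _ _) (amgm _ _)
  refine key.trans ?_
  have c1 := card_freqBox (a := 0) (b := N) (by omega)
  have c2 := card_freqBox (a := -N) (b := 2 * N) (by omega)
  have e1 : mean (trigSumSq S 1 id) = (N : ℝ) ^ 2 := by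
    rw [mean_trigSumSq]
    simpa using c1
  have e2 : mean (trigSumSq S' 1 id) = (3 * N : ℝ) ^ 2 := by
    rw [mean_trigSumSq]
    simp only [Pi.one_apply, norm_one, one_pow, Finset.sum_const, nsmul_eq_mul, mul_one, S', c2]
    push_cast
    ring
  have b1 : mean (trigSumSq S d id) ≤ (N : ℝ) ^ 2 * s ^ 2 := by
    have := mean_trigSumSq_translate_le (a := 0) (b := N) (by omega) (R := 2 * N)
      (fun m hm i => by
        have := mem_freqBox.1 hm i
        exact_mod_cast abs_le.2 ⟨by omega, by omega⟩) h
    refine this.trans (le_of_eq ?_)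
    rw [hs]
    push_cast
    ring
  have b2 : mean (trigSumSq S' d id) ≤ (3 * N : ℝ) ^ 2 * s ^ 2 := by
    have := mean_trigSumSq_translate_le (a := -N) (b := 2 * N) (by omega) (R := 2 * N)
      (fun m hm i => by
        have := mem_freqBox.1 hm i
        exact_mod_cast abs_le.2 ⟨by omega, by omega⟩) h
    refine this.trans (le_of_eq ?_)
    rw [hs]
    push_cast
    ring
  simp only [map_smul, map_add, mean_translate, smul_eq_mul, e1, e2]
  calc _ ≤ ((N : ℝ) ^ 2)⁻¹ * ((2 * s)⁻¹ * ((3 * N : ℝ) ^ 2 * s ^ 2) + s / 2 * (N : ℝ) ^ 2 +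
        ((2 * s)⁻¹ * ((N : ℝ) ^ 2 * s ^ 2) + s / 2 * (3 * N : ℝ) ^ 2)) := by gcongr
    _ = 10 * s := by
      field_simp
      ring
    _ = _ := by rw [hs]; ring

theorem exists_reproducing_kernel {N : ℕ} (hN : 0 < N) : ∃ K : TrigKernel,
    (∀ m : Fin 2 → ℤ, (∀ i, |m i| < N) →
      K.conv (cosC m) = cosC m ∧ K.conv (sinC m) = sinC m) ∧
    ∀ h, mean |translate h K.ker - K.ker| ≤ 80 * Real.pi * N * ‖h‖ := by
  have hN' : (0 : ℝ) < N := by exact_mod_cast hN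
  refine ⟨_, fun m hm => ?_, mean_abs_translate_sub_ofSum_le hN⟩
  set S := freqBox 0 N
  set S' := freqBox (-N) (2 * N)
  set K := TrigKernel.ofSum (S' ×ˢ S) (fun p => p.1 - p.2) ((N : ℝ) ^ 2)⁻¹ with hK
  -- The cosine modes of `m` and `-m` coincide and each contributes one half.
  have h1 : mean (K.ker * cosC m) = 1 := by
    have h2 := sum_freqBox_indicator hm
    have h3 := sum_freqBox_indicator (N := N) (m := -m) (by simpa using hm)
    rw [hK, TrigKernel.ker_ofSum, smul_mul_assoc, Finset.sum_mul, map_smul, map_sum]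
    simp only [mean_cosC_mul_cosC, smul_eq_mul]
    rw [← Finset.sum_div, Finset.sum_add_distrib, h2, h3]
    field_simp
    norm_num
  have h2 : mean (K.ker * sinC m) = 0 := by
    rw [hK, TrigKernel.ker_ofSum, smul_mul_assoc, Finset.sum_mul, map_smul, map_sum]
    simp [mean_cosC_mul_sinC]
  constructor
  · ext z
    have h3 : K.ker * translate z (cosC m) =
        cosC m z • (K.ker * cosC m) - sinC m z • (K.ker * sinC m) := by
      ext y
      simp only [ContinuousMap.mul_apply, translate_apply, cosC_apply_add,
        ContinuousMap.sub_apply, ContinuousMap.smul_apply, smul_eq_mul]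
      ring
    rw [K.conv_apply, h3, map_sub, map_smul, map_smul, h1, h2]
    simp
  · ext z
    have h3 : K.ker * translate z (sinC m) =
        sinC m z • (K.ker * cosC m) + cosC m z • (K.ker * sinC m) := by
      ext y
      simp only [ContinuousMap.mul_apply, translate_apply, sinC_apply_add,
        ContinuousMap.add_apply, ContinuousMap.smul_apply, smul_eq_mul]
      ring
    rw [K.conv_apply, h3, map_add, map_smul, map_smul, h1, h2]
    simp

/-- If `g` reproduces itself under the kernel, its translation can be moved onto the kernel, whose
`L¹` modulus is known. -/
theorem abs_translate_sub_le_of_conv_eq {K : TrigKernel} {g : C(T2, ℝ)} {C M : ℝ}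
    (hg : K.conv g = g) (hC : ∀ h, mean |translate h K.ker - K.ker| ≤ C * ‖h‖)
    (hM : ∀ z, |g z| ≤ M) (z h : T2) : |g (z + h) - g z| ≤ C * M * ‖h‖ := by
  have h1 : g (z + h) = mean (translate (-h) K.ker * translate z g) := by
    rw [← hg, K.conv_apply, hg, ← mean_translate (-h)]
    congr 1
    ext y
    simp only [translate_apply, ContinuousMap.mul_apply]
    congr 2
    abel
  have h2 : g z = mean (K.ker * translate z g) := by
    rw [← K.conv_apply, hg]
  have hM0 : 0 ≤ M := (abs_nonneg _).trans (hM 0)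
  rw [h1, h2, ← map_sub, ← sub_mul]
  calc _ ≤ mean |(translate (-h) K.ker - K.ker) * translate z g| := abs_mean_le _
    _ ≤ mean (M • |translate (-h) K.ker - K.ker|) := by
        refine mean_mono fun y => ?_
        simp only [ContinuousMap.abs_apply, ContinuousMap.mul_apply, ContinuousMap.smul_apply,
          smul_eq_mul, abs_mul]
        rw [mul_comm]
        gcongr
        exact hM _
    _ = M * mean |translate (-h) K.ker - K.ker| := by rw [map_smul, smul_eq_mul]
    _ ≤ M * (C * ‖-h‖) := by gcongr; exact hC _
    _ = _ := by rw [norm_neg]; ring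

/-! ### Littlewood–Paley blocks -/

/-- An integer frequency as a point of the plane. -/
abbrev freqVec (m : Fin 2 → ℤ) : EuclideanSpace ℝ (Fin 2) := WithLp.toLp 2 fun i => (m i : ℝ)

theorem norm_freqVec_sq (m : Fin 2 → ℤ) : ‖freqVec m‖ ^ 2 = (m 0 : ℝ) ^ 2 + (m 1 : ℝ) ^ 2 := by
  simp [EuclideanSpace.norm_sq_eq]

theorem abs_le_norm_freqVec (m : Fin 2 → ℤ) (i : Fin 2) : |(m i : ℝ)| ≤ ‖freqVec m‖ := by
  have h := norm_freqVec_sq m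
  refine abs_le_of_sq_le_sq ?_ (norm_nonneg _)
  rw [h]
  fin_cases i <;> simp <;> positivity

theorem DyadicPartition.abs_lt_of_cutoff_ne_zero (P : DyadicPartition) {κ : ℕ} {m : Fin 2 → ℤ}
    (h : P.cutoff κ (freqVec m) ≠ 0) (i : Fin 2) : |m i| < 2 ^ (κ + 1) := by
  have h1 := abs_le_norm_freqVec m i
  suffices hs : ‖freqVec m‖ < 2 ^ (κ + 1) by
    have := h1.trans_lt hs
    exact_mod_cast this
  cases κ with
  | zero =>
    have := P.low_support (Function.mem_support.2 h)
    rw [mem_ball_zero_iff] at this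
    norm_num
    linarith
  | succ k =>
    have := (P.ann_support (Function.mem_support.2 h)).1
    rw [mem_ball_zero_iff, norm_smul, norm_inv, norm_pow, Real.norm_two,
      inv_mul_lt_iff₀ (by positivity)] at this
    have hp : (0 : ℝ) < 2 ^ k := by positivity
    rw [pow_succ, pow_succ]
    linarith

theorem DyadicPartition.cutoff_succ_eq_zero (P : DyadicPartition) {κ : ℕ} {m : Fin 2 → ℤ}
    (h : ∀ i, 2 * |m i| < 2 ^ κ) : P.cutoff (κ + 1) (freqVec m) = 0 := by
  by_contra hne
  have h1 := (P.ann_support (Function.mem_support.2 hne)).2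
  rw [mem_ball_zero_iff, norm_smul, norm_inv, norm_pow, Real.norm_two, not_lt,
    le_inv_mul_iff₀ (by positivity)] at h1
  have h2 : ∀ i, (m i : ℝ) ^ 2 ≤ (2 ^ κ / 2) ^ 2 := fun i => by
    have : 2 * |(m i : ℝ)| < 2 ^ κ := by exact_mod_cast h i
    rw [← sq_abs]
    gcongr
    linarith
  have h3 := norm_freqVec_sq m
  have h4 : (2 ^ κ * (3 / 4) : ℝ) ^ 2 ≤ ‖freqVec m‖ ^ 2 := by gcongr
  have hp : (0 : ℝ) < (2 ^ κ) ^ 2 := by positivity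
  -- In units of `4^κ`, the squared length of `m` is at most `1/4 + 1/4`, below the `9/16` required
  -- by the annulus.
  nlinarith [h2 0, h2 1]

/-- The Littlewood–Paley block as a continuous function. -/
def lpC (P : DyadicPartition) (κ : ℕ) (u : DistT2) : C(T2, ℝ) :=
  ∑ m ∈ freqBox (-2 ^ (κ + 1)) (2 ^ (κ + 1)), P.cutoff κ (freqVec m) •
    (u.1 (cosMode m) • cosC m + u.1 (sinMode m) • sinC m)

theorem lpBlock_eq (P : DyadicPartition) (κ : ℕ) (u : DistT2) (z : T2) :
    lpBlock P κ u z = lpC P κ u z := by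
  rw [lpBlock, tsum_eq_sum (s := freqBox (-2 ^ (κ + 1)) (2 ^ (κ + 1))), Complex.re_sum, lpC,
    ContinuousMap.sum_apply]
  · refine Finset.sum_congr rfl fun m _ => ?_
    simp only [distFourierCoeff, ContinuousMap.smul_apply, ContinuousMap.add_apply, smul_eq_mul,
      cosC_apply, sinC_apply]
    simp [mul_assoc]
  · intro m hm
    have : P.cutoff κ (freqVec m) = 0 := by
      by_contra hne
      refine hm (mem_freqBox.2 fun i => ?_)
      have := abs_lt.1 (P.abs_lt_of_cutoff_ne_zero hne i)
      exact ⟨this.1.le, this.2⟩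
    simp [this]

theorem lpC_sub (P : DyadicPartition) (κ : ℕ) (u w : DistT2) :
    lpC P κ (u - w) = lpC P κ u - lpC P κ w := by
  simp only [lpC, ← Finset.sum_sub_distrib, ← smul_sub]
  refine Finset.sum_congr rfl fun m _ => ?_
  congr 1
  have : ∀ φ, (u - w).1 φ = u.1 φ - w.1 φ := fun φ => rfl
  rw [this, this, sub_smul, sub_smul]
  abel

theorem sum_freqBox_ite (P : DyadicPartition) (κ : ℕ) (g : (Fin 2 → ℤ) → ℝ) (m : Fin 2 → ℤ) :
    ∑ k ∈ freqBox (-2 ^ (κ + 1)) (2 ^ (κ + 1)), P.cutoff κ (freqVec k) * (g k *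
      (if k = m then 1 else 0)) = P.cutoff κ (freqVec m) * g m := by
  simp only [mul_ite, mul_one, mul_zero, Finset.sum_ite_eq']
  split_ifs with h
  · rfl
  · have : P.cutoff κ (freqVec m) = 0 := by
      by_contra hne
      refine h (mem_freqBox.2 fun i => ?_)
      have := abs_lt.1 (P.abs_lt_of_cutoff_ne_zero hne i)
      exact ⟨this.1.le, this.2⟩
    rw [this, zero_mul]

/-- The frequencies `m` and `-m` carry the same cosine mode, so the multiplier is the average of the
cut-off at both. -/
theorem mean_lpC_mul_cosC (P : DyadicPartition) (κ : ℕ) (u : DistT2) (m : Fin 2 → ℤ) :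
    mean (lpC P κ u * cosC m) =
      (P.cutoff κ (freqVec m) + P.cutoff κ (freqVec (-m))) / 2 * u.1 (cosMode m) := by
  rw [lpC, Finset.sum_mul, map_sum]
  have h : ∀ k, mean ((P.cutoff κ (freqVec k) • (u.1 (cosMode k) • cosC k +
      u.1 (sinMode k) • sinC k)) * cosC m) =
      (P.cutoff κ (freqVec k) * (u.1 (cosMode k) * if k = m then 1 else 0) +
       P.cutoff κ (freqVec k) * (u.1 (cosMode k) * if k = -m then 1 else 0)) / 2 := fun k => by
    rw [smul_mul_assoc, add_mul, smul_mul_assoc, smul_mul_assoc, map_smul, map_add, map_smul,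
      map_smul, mean_cosC_mul_cosC, mean_sinC_mul_cosC]
    simp only [smul_eq_mul]
    ring
  simp_rw [h]
  rw [← Finset.sum_div, Finset.sum_add_distrib, sum_freqBox_ite P κ (fun k => u.1 (cosMode k)),
    sum_freqBox_ite P κ (fun k => u.1 (cosMode k)), cosMode_neg]
  ring

theorem mean_lpC_mul_sinC (P : DyadicPartition) (κ : ℕ) (u : DistT2) (m : Fin 2 → ℤ) :
    mean (lpC P κ u * sinC m) =
      (P.cutoff κ (freqVec m) + P.cutoff κ (freqVec (-m))) / 2 * u.1 (sinMode m) := by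
  rw [lpC, Finset.sum_mul, map_sum]
  have h : ∀ k, mean ((P.cutoff κ (freqVec k) • (u.1 (cosMode k) • cosC k +
      u.1 (sinMode k) • sinC k)) * sinC m) =
      (P.cutoff κ (freqVec k) * (u.1 (sinMode k) * if k = m then 1 else 0) -
       P.cutoff κ (freqVec k) * (u.1 (sinMode k) * if k = -m then 1 else 0)) / 2 := fun k => by
    rw [smul_mul_assoc, add_mul, smul_mul_assoc, smul_mul_assoc, map_smul, map_add, map_smul,
      map_smul, mean_sinC_mul_sinC, mean_cosC_mul_sinC]
    simp only [smul_eq_mul]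
    ring
  simp_rw [h]
  rw [← Finset.sum_div, Finset.sum_sub_distrib, sum_freqBox_ite P κ (fun k => u.1 (sinMode k)),
    sum_freqBox_ite P κ (fun k => u.1 (sinMode k)), sinMode_neg, map_neg]
  ring

theorem DyadicPartition.hasSum_cutoff (P : DyadicPartition) (ζ : EuclideanSpace ℝ (Fin 2)) :
    HasSum (fun κ => P.cutoff κ ζ) 1 := by
  rw [← hasSum_nat_add_iff' 1]
  rw [Finset.sum_range_one]
  exact P.sum_eq_one ζ

/-- Bernstein's inequality for a Littlewood–Paley block. -/
theorem abs_lpC_apply_add_sub_le (P : DyadicPartition) (κ : ℕ) (u : DistT2) {M : ℝ}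
    (hM : ∀ z, |lpC P κ u z| ≤ M) (z h : T2) :
    |lpC P κ u (z + h) - lpC P κ u z| ≤ 160 * Real.pi * 2 ^ κ * M * ‖h‖ := by
  -- All frequencies of the block are below `2^(κ+1)`.
  obtain ⟨K, hK, hC⟩ := exists_reproducing_kernel (N := 2 ^ (κ + 1)) (by positivity)
  have hg : K.conv (lpC P κ u) = lpC P κ u := by
    have hsum : ∀ (s : Finset (Fin 2 → ℤ)) (F : (Fin 2 → ℤ) → C(T2, ℝ)),
        K.conv (∑ m ∈ s, F m) = ∑ m ∈ s, K.conv (F m) := fun s F => by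
      have h0 : K.conv 0 = 0 := by simpa using K.conv_smul 0 0
      exact map_sum (⟨⟨K.conv, h0⟩, K.conv_add⟩ : C(T2, ℝ) →+ C(T2, ℝ)) F s
    rw [lpC, hsum]
    refine Finset.sum_congr rfl fun m _ => ?_
    by_cases hne : P.cutoff κ (freqVec m) = 0
    · rw [hne, K.conv_smul, zero_smul, zero_smul]
    · have h1 := hK m fun i => by
        have := P.abs_lt_of_cutoff_ne_zero hne i
        exact_mod_cast this
      rw [K.conv_smul, K.conv_add, K.conv_smul, K.conv_smul, h1.1, h1.2]
  have := abs_translate_sub_le_of_conv_eq hg hC hM z h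
  refine this.trans (le_of_eq ?_)
  push_cast
  ring

theorem abs_lpC_le_of_besovNorm_le {P : DyadicPartition} {s R : ℝ} (hR : 0 ≤ R) {u : DistT2}
    (hu : besovNorm P s u ≤ ENNReal.ofReal R) (κ : ℕ) (z : T2) :
    |lpC P κ u z| ≤ (2 : ℝ) ^ (-(s * ((κ : ℝ) - 1))) * R := by
  have h1 : ENNReal.ofReal ((2 : ℝ) ^ (s * ((κ : ℝ) - 1))) * ‖lpBlock P κ u z‖ₑ ≤
      ENNReal.ofReal R := by
    refine le_trans ?_ hu
    refine le_trans ?_ (le_iSup _ κ)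
    gcongr
    exact le_iSup (fun z => ‖lpBlock P κ u z‖ₑ) z
  rw [lpBlock_eq, ← ofReal_norm, ← ENNReal.ofReal_mul (by positivity),
    ENNReal.ofReal_le_ofReal_iff hR, Real.norm_eq_abs] at h1
  rw [Real.rpow_neg zero_le_two, inv_mul_eq_div, le_div_iff₀ (by positivity)]
  linarith

/-! ### Approximation by convolution -/

theorem IsMollifier.abs_conv_le {K : TrigKernel} {N : ℕ} (hK : IsMollifier K N) {f : C(T2, ℝ)}
    {M : ℝ} (hM : ∀ z, |f z| ≤ M) (z : T2) : |K.conv f z| ≤ M := by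
  rw [K.conv_apply]
  calc _ ≤ mean |K.ker * translate z f| := abs_mean_le _
    _ ≤ mean (M • K.ker) := by
        refine mean_mono fun y => ?_
        simp only [ContinuousMap.abs_apply, ContinuousMap.mul_apply, ContinuousMap.smul_apply,
          smul_eq_mul, abs_mul, abs_of_nonneg (hK.nonneg y)]
        rw [mul_comm]
        exact mul_le_mul_of_nonneg_right (hM _) (hK.nonneg y)
    _ = M := by rw [map_smul, hK.mean_ker, smul_eq_mul, mul_one]

theorem IsMollifier.abs_conv_sub_le_mean {K : TrigKernel} {N : ℕ} (hK : IsMollifier K N)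
    (f : C(T2, ℝ)) (z : T2) :
    |K.conv f z - f z| ≤ mean (K.ker * |translate z f - ContinuousMap.const _ (f z)|) := by
  have h1 : K.conv f z - f z = mean (K.ker * (translate z f - ContinuousMap.const _ (f z))) := by
    have h2 : K.ker * ContinuousMap.const _ (f z) = f z • K.ker := by
      ext y
      simp [mul_comm]
    rw [mul_sub, map_sub, h2, map_smul, hK.mean_ker, K.conv_apply]
    simp
  rw [h1]
  refine (abs_mean_le _).trans (mean_mono fun y => ?_)
  simp only [ContinuousMap.abs_apply, ContinuousMap.mul_apply, abs_mul,
    abs_of_nonneg (hK.nonneg y), le_refl]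

theorem IsMollifier.abs_conv_sub_le {K : TrigKernel} {N : ℕ} (hK : IsMollifier K N) (hN : 0 < N)
    {θ : ℝ} (hθ : 0 ≤ θ) (hθ2 : θ ≤ 2) {f : C(T2, ℝ)} {M : ℝ} (hM : 0 ≤ M)
    (hf : ∀ z h, |f (z + h) - f z| ≤ M * ‖h‖ ^ θ) (z : T2) :
    |K.conv f z - f z| ≤ M * (33 * (N : ℝ) ^ (-θ)) := by
  refine (hK.abs_conv_sub_le_mean f z).trans ?_
  calc _ ≤ mean (M • (K.ker * normPow θ hθ)) := by
        refine mean_mono fun y => ?_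
        simp only [ContinuousMap.abs_apply, ContinuousMap.mul_apply, ContinuousMap.smul_apply,
          ContinuousMap.sub_apply, translate_apply, ContinuousMap.const_apply, smul_eq_mul,
          normPow, ContinuousMap.coe_mk]
        have := mul_le_mul_of_nonneg_left (hf z y) (hK.nonneg y)
        rw [add_comm y z]
        linarith
    _ ≤ _ := by
        rw [map_smul, smul_eq_mul]
        gcongr
        exact hK.moment_rpow hN hθ hθ2

theorem continuous_integral_param {F : T2 → T2 → ℝ} (hF : Continuous (Function.uncurry F)) :
    Continuous fun x => ∫ y, F x y ∂torusMeasure := by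
  have := continuous_parametric_integral_of_continuous (μ := torusMeasure) hF isCompact_univ
  simpa using this

theorem IsMollifier.mean_abs_conv_sub_le {K : TrigKernel} {N : ℕ} (hK : IsMollifier K N)
    (hN : 0 < N) {θ : ℝ} (hθ : 0 ≤ θ) (hθ2 : θ ≤ 2) {f : C(T2, ℝ)} {L : ℝ} (hL : 0 ≤ L)
    (hf : ∀ h, mean |translate h f - f| ≤ L * ‖h‖ ^ θ) :
    mean |K.conv f - f| ≤ L * (33 * (N : ℝ) ^ (-θ)) := by
  have hc : Continuous (Function.uncurry fun z y : T2 => K.ker y * |f (y + z) - f z|) := by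
    fun_prop
  have hcz := continuous_integral_param hc
  have hcy := continuous_integral_param (F := fun y z => K.ker y * |f (y + z) - f z|) (by fun_prop)
  calc mean |K.conv f - f| ≤ mean ⟨_, hcz⟩ := mean_mono fun z => by
        simpa using! hK.abs_conv_sub_le_mean f z
    -- Exchanging the integrals leaves, for each shift `y`, the `L¹` increment of `f` weighted by
    -- the kernel.
    _ = mean ⟨_, hcy⟩ := integral_mean_swap _ hc
    _ ≤ mean (L • (K.ker * normPow θ hθ)) := by
        refine mean_mono fun y => ?_
        have h1 : ∫ z, |f (y + z) - f z| ∂torusMeasure ≤ L * ‖y‖ ^ θ := by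
          refine le_trans (le_of_eq ?_) (hf y)
          rw [mean_apply]
          simp [add_comm y]
        simp only [ContinuousMap.coe_mk, integral_const_mul, ContinuousMap.mul_apply,
          ContinuousMap.smul_apply, smul_eq_mul, normPow]
        have := mul_le_mul_of_nonneg_left h1 (hK.nonneg y)
        linarith
    _ ≤ _ := by
        rw [map_smul, smul_eq_mul]
        gcongr
        exact hK.moment_rpow hN hθ hθ2

/-! ### Hölder classes and the pairing -/

/-- `f` is bounded in `L¹` by `L`, with `L¹` modulus of continuity `L |h|^θ`. -/
def HasL1Modulus (θ L : ℝ) (f : C(T2, ℝ)) : Prop :=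
  mean |f| ≤ L ∧ ∀ h, mean |translate h f - f| ≤ L * ‖h‖ ^ θ

/-- `f` is bounded by `K`, and Hölder continuous of exponent `θ` with constant `K`. -/
def IsHolder (θ K : ℝ) (f : C(T2, ℝ)) : Prop :=
  (∀ z, |f z| ≤ K) ∧ ∀ z h, |f (z + h) - f z| ≤ K * ‖h‖ ^ θ

theorem HasL1Modulus.nonneg {θ L : ℝ} {f : C(T2, ℝ)} (hf : HasL1Modulus θ L f) : 0 ≤ L :=
  (mean_nonneg fun z => abs_nonneg (f z)).trans hf.1

theorem IsHolder.nonneg {θ K : ℝ} {f : C(T2, ℝ)} (hf : IsHolder θ K f) : 0 ≤ K :=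
  (abs_nonneg _).trans (hf.1 0)

theorem IsHolder.mono {θ K K' : ℝ} {f : C(T2, ℝ)} (hf : IsHolder θ K f) (h : K ≤ K') :
    IsHolder θ K' f :=
  ⟨fun z => (hf.1 z).trans h, fun z y => (hf.2 z y).trans (by gcongr)⟩

theorem IsHolder.hasL1Modulus {θ K : ℝ} {f : C(T2, ℝ)} (hf : IsHolder θ K f) :
    HasL1Modulus θ K f :=
  ⟨mean_le_of_le fun z => hf.1 z, fun h => mean_le_of_le fun z => hf.2 z h⟩

theorem IsHolder.neg {θ K : ℝ} {f : C(T2, ℝ)} (hf : IsHolder θ K f) : IsHolder θ K (-f) := by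
  refine ⟨fun z => by simpa using hf.1 z, fun z h => ?_⟩
  have : (-f) (z + h) - (-f) z = -(f (z + h) - f z) := by simp; ring
  rw [this, abs_neg]
  exact hf.2 z h

theorem IsHolder.add {θ K L : ℝ} {f g : C(T2, ℝ)} (hf : IsHolder θ K f) (hg : IsHolder θ L g) :
    IsHolder θ (K + L) (f + g) := by
  refine ⟨fun z => (abs_add_le _ _).trans (add_le_add (hf.1 z) (hg.1 z)), fun z h => ?_⟩
  have : (f + g) (z + h) - (f + g) z = (f (z + h) - f z) + (g (z + h) - g z) := by simp; ring
  rw [this, add_mul]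
  exact (abs_add_le _ _).trans (add_le_add (hf.2 z h) (hg.2 z h))

theorem IsHolder.sub {θ K L : ℝ} {f g : C(T2, ℝ)} (hf : IsHolder θ K f) (hg : IsHolder θ L g) :
    IsHolder θ (K + L) (f - g) := by
  rw [sub_eq_add_neg]
  exact hf.add hg.neg

theorem IsHolder.mul {θ K L : ℝ} {f g : C(T2, ℝ)} (hf : IsHolder θ K f) (hg : IsHolder θ L g) :
    IsHolder θ (2 * K * L) (f * g) := by
  have hK := hf.nonneg
  have hL := hg.nonneg
  refine ⟨fun z => ?_, fun z h => ?_⟩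
  · rw [ContinuousMap.mul_apply, abs_mul]
    have := mul_le_mul (hf.1 z) (hg.1 z) (abs_nonneg _) hK
    nlinarith [mul_nonneg hK hL]
  · have : (f * g) (z + h) - (f * g) z =
        (f (z + h) - f z) * g (z + h) + f z * (g (z + h) - g z) := by simp; ring
    rw [this]
    refine (abs_add_le _ _).trans ?_
    rw [abs_mul, abs_mul]
    have h1 := mul_le_mul (hf.2 z h) (hg.1 (z + h)) (abs_nonneg _) (by positivity)
    have h2 := mul_le_mul (hf.1 z) (hg.2 z h) (abs_nonneg _) hK
    linarith

theorem IsHolder.one (θ : ℝ) : IsHolder θ 1 1 :=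
  ⟨fun z => by simp, fun z h => by simp; positivity⟩

/-- The new constant is uniform over the Hölder ball, hence later uniform in time and in the
mollification. -/
theorem exists_isHolder_pow (θ K : ℝ) (k : ℕ) :
    ∃ K', ∀ f, IsHolder θ K f → IsHolder θ K' (f ^ k) := by
  induction k with
  | zero => exact ⟨1, fun f _ => by rw [pow_zero]; exact IsHolder.one θ⟩
  | succ k ih =>
    obtain ⟨K', h⟩ := ih
    exact ⟨2 * K' * K, fun f hf => by rw [pow_succ]; exact (h f hf).mul hf⟩

theorem IsMollifier.isHolder_conv {K : TrigKernel} {N : ℕ} (hK : IsMollifier K N) {θ M : ℝ}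
    {f : C(T2, ℝ)} (hf : IsHolder θ M f) : IsHolder θ M (K.conv f) := by
  refine ⟨fun z => hK.abs_conv_le hf.1 z, fun z h => ?_⟩
  have : K.conv f (z + h) - K.conv f z = K.conv (translate h f - f) z := by
    rw [K.conv_sub, K.conv_translate]
    rfl
  rw [this]
  exact hK.abs_conv_le (fun z => hf.2 z h) z

theorem pairing_eq_tsum (P : DyadicPartition) (u : DistT2) (f : C(T2, ℝ)) :
    pairing P u f = ∑' κ, mean (lpC P κ u * f) := by
  simp only [pairing, lpBlock_eq]
  rfl

theorem abs_mean_mul_le {g f : C(T2, ℝ)} {M : ℝ} (hM : ∀ z, |g z| ≤ M) :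
    |mean (g * f)| ≤ M * mean |f| := by
  calc _ ≤ mean |g * f| := abs_mean_le _
    _ ≤ mean (M • |f|) := mean_mono fun z => by
        simp only [ContinuousMap.abs_apply, ContinuousMap.mul_apply, ContinuousMap.smul_apply,
          abs_mul, smul_eq_mul]
        exact mul_le_mul_of_nonneg_right (hM z) (abs_nonneg _)
    _ = _ := by rw [map_smul, smul_eq_mul]

/-- A high block is orthogonal to trigonometric polynomials of low degree, so a Jackson mean of `f`
can be subtracted for free. The `L¹` error of that mean is `2^(-θκ)` up to a constant, and it beats
the growth `2^(ακ)` of the block. -/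
theorem abs_mean_lpC_mul_le {P : DyadicPartition} {α θ R L : ℝ} (hR : 0 ≤ R) (hθ : 0 ≤ θ)
    (hθ2 : θ ≤ 2) {u : DistT2} (hu : besovNorm P (-α) u ≤ ENNReal.ofReal R) {f : C(T2, ℝ)}
    (hf : HasL1Modulus θ L f) (κ : ℕ) :
    |mean (lpC P κ u * f)| ≤ 33 * (2 : ℝ) ^ (3 * θ - α) * ((2 : ℝ) ^ (α - θ)) ^ κ * (R * L) := by
  have hL := hf.nonneg
  have hb := abs_lpC_le_of_besovNorm_le hR hu κ
  have hexp : (2 : ℝ) ^ (3 * θ - α) * ((2 : ℝ) ^ (α - θ)) ^ κ =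
      (2 : ℝ) ^ (-(-α * ((κ : ℝ) - 1))) * (2 : ℝ) ^ (θ * (3 - κ)) := by
    rw [← Real.rpow_natCast, ← Real.rpow_mul zero_le_two, ← Real.rpow_add zero_lt_two,
      ← Real.rpow_add zero_lt_two]
    congr 1
    ring
  rw [mul_assoc 33, hexp]
  -- For the first three blocks no cancellation is needed: the factor `2^(θ(3-κ))` in the bound is
  -- at least one.
  rcases lt_or_ge κ 3 with hκ | hκ
  · have h1 := abs_mean_mul_le (f := f) hb
    have h2 : (1 : ℝ) ≤ (2 : ℝ) ^ (θ * (3 - κ)) := by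
      refine Real.one_le_rpow one_le_two (mul_nonneg hθ ?_)
      have : (κ : ℝ) ≤ 3 := by exact_mod_cast hκ.le
      linarith
    calc _ ≤ _ := h1
      _ ≤ (2 : ℝ) ^ (-(-α * ((κ : ℝ) - 1))) * R * L := by gcongr; exact hf.1
      _ ≤ 33 * ((2 : ℝ) ^ (-(-α * ((κ : ℝ) - 1))) * (2 : ℝ) ^ (θ * (3 - κ))) * (R * L) := by
        have : 0 ≤ (2 : ℝ) ^ (-(-α * ((κ : ℝ) - 1))) * R * L := by positivity
        nlinarith
  · obtain ⟨k, rfl⟩ := Nat.exists_eq_add_of_le' hκ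
    -- Its frequencies are below `2^(k+1)` in each coordinate, inside the hole of the annulus of
    -- block `k+3`.
    obtain ⟨K, hK⟩ := exists_isMollifier (N := 2 ^ k) (by positivity)
    have hz : K.conv (lpC P (k + 3) u) = 0 := by
      refine Finset.sum_eq_zero fun m hm => ?_
      have h1 : ∀ i, 2 * |m i| < 2 ^ (k + 2) := fun i => by
        have := hK.freq_lt m hm i
        push_cast at this
        rw [pow_succ, pow_succ]
        linarith
      rw [mean_lpC_mul_cosC, mean_lpC_mul_sinC, P.cutoff_succ_eq_zero h1,
        P.cutoff_succ_eq_zero (m := -m) (by simpa using h1)]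
      simp
    have h0 : mean (lpC P (k + 3) u * K.conv f) = 0 := by
      rw [← K.mean_conv_mul, hz, zero_mul, map_zero]
    have h1 : |mean (lpC P (k + 3) u * f)| =
        |mean (lpC P (k + 3) u * (K.conv f - f))| := by
      rw [mul_sub, map_sub, h0, zero_sub, abs_neg]
    have h2 := hK.mean_abs_conv_sub_le (by positivity) hθ hθ2 hL hf.2
    have h3 : (((2 ^ k : ℕ) : ℝ)) ^ (-θ) = (2 : ℝ) ^ (θ * (3 - ((k + 3 : ℕ) : ℝ))) := by
      push_cast
      rw [← Real.rpow_natCast, ← Real.rpow_mul zero_le_two]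
      congr 1
      ring
    rw [h1]
    refine (abs_mean_mul_le hb).trans ?_
    calc _ ≤ (2 : ℝ) ^ (-(-α * (((k + 3 : ℕ) : ℝ) - 1))) * R *
          (L * (33 * (((2 ^ k : ℕ) : ℝ)) ^ (-θ))) := by gcongr
      _ = _ := by rw [h3]; ring

theorem two_rpow_lt_one {α θ : ℝ} (h : α < θ) : (2 : ℝ) ^ (α - θ) < 1 :=
  Real.rpow_lt_one_of_one_lt_of_neg one_lt_two (by linarith)

/-- The constant in the duality bound for the pairing. -/
def pairConst (α θ : ℝ) : ℝ := 33 * (2 : ℝ) ^ (3 * θ - α) * (1 - (2 : ℝ) ^ (α - θ))⁻¹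

theorem pairConst_pos {α θ : ℝ} (h : α < θ) : 0 < pairConst α θ := by
  have := two_rpow_lt_one h
  have : 0 < 1 - (2 : ℝ) ^ (α - θ) := by linarith
  unfold pairConst
  positivity

theorem hasSum_pairConst {α θ : ℝ} (h : α < θ) (c : ℝ) :
    HasSum (fun κ : ℕ => 33 * (2 : ℝ) ^ (3 * θ - α) * ((2 : ℝ) ^ (α - θ)) ^ κ * c)
      (pairConst α θ * c) :=
  ((hasSum_geometric_of_lt_one (by positivity) (two_rpow_lt_one h)).mul_left _).mul_right _

section Pairing

variable {P : DyadicPartition} {α θ R L : ℝ} {u : DistT2} {f : C(T2, ℝ)}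

theorem summable_pairing (hR : 0 ≤ R) (hθ : 0 ≤ θ) (hαθ : α < θ) (hθ2 : θ ≤ 2)
    (hu : besovNorm P (-α) u ≤ ENNReal.ofReal R) (hf : HasL1Modulus θ L f) :
    Summable fun κ => mean (lpC P κ u * f) :=
  Summable.of_norm_bounded (hasSum_pairConst hαθ _).summable
    (abs_mean_lpC_mul_le hR hθ hθ2 hu hf)

/-- The duality bound between `C^{-α}` and the functions with an `L¹` modulus of continuity of
order `θ > α`. -/
theorem abs_pairing_le (hR : 0 ≤ R) (hθ : 0 ≤ θ) (hαθ : α < θ) (hθ2 : θ ≤ 2)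
    (hu : besovNorm P (-α) u ≤ ENNReal.ofReal R) (hf : HasL1Modulus θ L f) :
    |pairing P u f| ≤ pairConst α θ * (R * L) := by
  rw [pairing_eq_tsum]
  rw [← Real.norm_eq_abs]
  exact tsum_of_norm_bounded (hasSum_pairConst hαθ _) (abs_mean_lpC_mul_le hR hθ hθ2 hu hf)

theorem pairing_sub_left (hR : 0 ≤ R) (hθ : 0 ≤ θ) (hαθ : α < θ) (hθ2 : θ ≤ 2) {w : DistT2}
    {R' : ℝ} (hR' : 0 ≤ R')
    (hu : besovNorm P (-α) u ≤ ENNReal.ofReal R) (hw : besovNorm P (-α) w ≤ ENNReal.ofReal R')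
    (hf : HasL1Modulus θ L f) : pairing P (u - w) f = pairing P u f - pairing P w f := by
  simp only [pairing_eq_tsum]
  rw [← (summable_pairing hR hθ hαθ hθ2 hu hf).tsum_sub
    (summable_pairing hR' hθ hαθ hθ2 hw hf)]
  refine tsum_congr fun κ => ?_
  rw [lpC_sub, sub_mul, map_sub]

theorem pairing_sum (hR : 0 ≤ R) (hθ : 0 ≤ θ) (hαθ : α < θ) (hθ2 : θ ≤ 2)
    (hu : besovNorm P (-α) u ≤ ENNReal.ofReal R) {ι : Type*} (s : Finset ι) (c : ι → ℝ)
    (F : ι → C(T2, ℝ)) (hF : ∀ i ∈ s, ∃ L, HasL1Modulus θ L (F i)) :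
    pairing P u (∑ i ∈ s, c i • F i) = ∑ i ∈ s, c i * pairing P u (F i) := by
  simp only [pairing_eq_tsum, ← tsum_mul_left]
  rw [← Summable.tsum_finsetSum fun i hi => ?_]
  · refine tsum_congr fun κ => ?_
    rw [Finset.mul_sum, map_sum]
    refine Finset.sum_congr rfl fun i _ => ?_
    rw [mul_smul_comm, map_smul, smul_eq_mul]
  · obtain ⟨L, hL⟩ := hF i hi
    exact (summable_pairing hR hθ hαθ hθ2 hu hL).mul_left _

theorem pairing_sub_right (hR : 0 ≤ R) (hθ : 0 ≤ θ) (hαθ : α < θ) (hθ2 : θ ≤ 2)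
    (hu : besovNorm P (-α) u ≤ ENNReal.ofReal R) {g : C(T2, ℝ)} {L' : ℝ}
    (hf : HasL1Modulus θ L f) (hg : HasL1Modulus θ L' g) :
    pairing P u (f - g) = pairing P u f - pairing P u g := by
  simp only [pairing_eq_tsum]
  rw [← (summable_pairing hR hθ hαθ hθ2 hu hf).tsum_sub (summable_pairing hR hθ hαθ hθ2 hu hg)]
  refine tsum_congr fun κ => ?_
  rw [mul_sub, map_sub]

end Pairing

/-- On bounded sets of Hölder functions, uniformly small functions have small pairings. -/
theorem exists_forall_abs_pairing_le (P : DyadicPartition) {α θ : ℝ} (hα : 0 < α) (hαθ : α < θ)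
    (hθ2 : θ ≤ 2) {K R : ℝ} (hK : 0 ≤ K) (hR : 0 ≤ R) {ε : ℝ} (hε : 0 < ε) :
    ∃ δ > 0, ∀ (u : DistT2) (f : C(T2, ℝ)), besovNorm P (-α) u ≤ ENNReal.ofReal R →
      IsHolder θ K f → (∀ z, |f z| ≤ δ) → |pairing P u f| ≤ ε := by
  -- Chosen so that `θ s` is the midpoint of `α` and `θ`. The increments are split into powers `1-s`
  -- and `s`: the second keeps a modulus of order above `α`, the first makes the constant small with
  -- `δ`.
  set s := (α + θ) / (2 * θ) with hs
  have hθ : 0 < θ := hα.trans hαθ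
  have hs0 : 0 < s := by positivity
  have hs1 : s < 1 := by
    rw [hs, div_lt_one (by positivity)]
    linarith
  have hθs : θ * s = (α + θ) / 2 := by
    rw [hs]
    field_simp
  have hcont : Continuous fun δ : ℝ =>
      pairConst α (θ * s) * (R * max δ ((2 * δ) ^ (1 - s) * K ^ s)) := by
    have : Continuous fun δ : ℝ => (2 * δ) ^ (1 - s) :=
      (continuous_const.mul continuous_id).rpow_const fun _ => Or.inr (by linarith)
    fun_prop
  have ht := hcont.tendsto 0
  rw [mul_zero, Real.zero_rpow (by linarith), zero_mul, max_self, mul_zero, mul_zero] at ht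
  have h1 : ∀ᶠ δ in 𝓝[>] (0 : ℝ),
      pairConst α (θ * s) * (R * max δ ((2 * δ) ^ (1 - s) * K ^ s)) < ε :=
    (ht.mono_left nhdsWithin_le_nhds).eventually (gt_mem_nhds hε)
  obtain ⟨δ, hδ, hδ0⟩ := (h1.and self_mem_nhdsWithin).exists
  refine ⟨δ, hδ0, fun u f hu hf hfδ => ?_⟩
  have hδ0' : (0 : ℝ) < δ := hδ0
  have hmod : HasL1Modulus (θ * s) (max δ ((2 * δ) ^ (1 - s) * K ^ s)) f := by
    refine ⟨(mean_le_of_le fun z => hfδ z).trans (le_max_left _ _),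
      fun h => mean_le_of_le fun z => ?_⟩
    have h2 : |f (z + h) - f z| ≤ 2 * δ := by
      refine (abs_sub _ _).trans ?_
      linarith [hfδ (z + h), hfδ z]
    have h3 := hf.2 z h
    simp only [ContinuousMap.abs_apply, ContinuousMap.sub_apply, translate_apply]
    set a := |f (z + h) - f z| with ha
    have ha0 : 0 ≤ a := abs_nonneg _
    calc a = a ^ (1 - s) * a ^ s := by
          rw [← Real.rpow_add_of_nonneg ha0 (by linarith) hs0.le]
          simp
      _ ≤ (2 * δ) ^ (1 - s) * (K * ‖h‖ ^ θ) ^ s := by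
          have : 0 ≤ 1 - s := by linarith
          gcongr
      _ = (2 * δ) ^ (1 - s) * K ^ s * ‖h‖ ^ (θ * s) := by
          rw [Real.mul_rpow hK (by positivity), ← Real.rpow_mul (norm_nonneg _)]
          ring
      _ ≤ _ := by gcongr; exact le_max_right _ _
  exact (abs_pairing_le hR (by positivity) (by rw [hθs]; linarith) (by rw [hθs]; linarith) hu
    hmod).trans hδ.le

/-! ### From Besov to Hölder regularity -/

/-- A sequence of Jackson kernels. -/
def jackson (N : ℕ) : TrigKernel := (exists_isMollifier N.succ_pos).choose

theorem isMollifier_jackson (N : ℕ) : IsMollifier (jackson N) (N + 1) :=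
  (exists_isMollifier N.succ_pos).choose_spec

/-- Near the origin uniform continuity applies, and away from it the increment is dominated by a
multiple of `‖y‖²`, whose kernel average tends to zero. Mere continuity must suffice here, since
this serves to prove Hölder regularity. -/
theorem tendsto_conv_jackson (f : C(T2, ℝ)) (z : T2) :
    Tendsto (fun N => (jackson N).conv f z) atTop (𝓝 (f z)) := by
  rw [Metric.tendsto_atTop]
  intro ε hε
  have huc := CompactSpace.uniformContinuous_of_continuous f.continuous
  obtain ⟨δ, hδ, hd⟩ := Metric.uniformContinuous_iff.1 huc (ε / 2) (by positivity)
  have hb : ∀ (N : ℕ), |(jackson N).conv f z - f z| ≤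
      ε / 2 + 2 * ‖f‖ / δ ^ 2 * (32 / ((N + 1 : ℕ) : ℝ) ^ 2) := fun N => by
    have hJ := isMollifier_jackson N
    refine (hJ.abs_conv_sub_le_mean f z).trans ?_
    calc _ ≤ mean ((ε / 2) • (jackson N).ker +
          (2 * ‖f‖ / δ ^ 2) • ((jackson N).ker * normC ^ 2)) := by
          refine mean_mono fun y => ?_
          simp only [ContinuousMap.mul_apply, ContinuousMap.abs_apply, ContinuousMap.sub_apply,
            translate_apply, ContinuousMap.const_apply, ContinuousMap.add_apply,
            ContinuousMap.smul_apply, ContinuousMap.pow_apply, normC_apply, smul_eq_mul]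
          have h1 : |f (y + z) - f z| ≤ ε / 2 + 2 * ‖f‖ / δ ^ 2 * ‖y‖ ^ 2 := by
            rcases lt_or_ge ‖y‖ δ with h | h
            · have := hd (a := y + z) (b := z) (by rwa [dist_eq_norm, add_sub_cancel_right])
              rw [Real.dist_eq] at this
              have : 0 ≤ 2 * ‖f‖ / δ ^ 2 * ‖y‖ ^ 2 := by positivity
              linarith
            · have h2 : |f (y + z) - f z| ≤ 2 * ‖f‖ := by
                refine (abs_sub _ _).trans ?_
                have a := f.norm_coe_le_norm (y + z)
                have b := f.norm_coe_le_norm z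
                rw [Real.norm_eq_abs] at a b
                linarith
              have h3 : 2 * ‖f‖ ≤ 2 * ‖f‖ / δ ^ 2 * ‖y‖ ^ 2 := by
                rw [div_mul_eq_mul_div, le_div_iff₀ (by positivity)]
                gcongr
              linarith
          have := mul_le_mul_of_nonneg_left h1 (hJ.nonneg y)
          linarith
      _ ≤ _ := by
          rw [map_add, map_smul, map_smul, hJ.mean_ker, smul_eq_mul, smul_eq_mul, mul_one]
          gcongr
          exact hJ.moment
  have ht : Tendsto (fun N : ℕ => 2 * ‖f‖ / δ ^ 2 * (32 / ((N + 1 : ℕ) : ℝ) ^ 2)) atTop (𝓝 0) := by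
    have h1 : Tendsto (fun N : ℕ => (((N + 1 : ℕ) : ℝ) ^ 2)) atTop atTop :=
      (tendsto_pow_atTop two_ne_zero).comp
        ((tendsto_natCast_atTop_atTop (R := ℝ)).comp (tendsto_add_atTop_nat 1))
    simpa using (h1.const_div_atTop 32).const_mul (2 * ‖f‖ / δ ^ 2)
  obtain ⟨N₀, hN₀⟩ := eventually_atTop.1 (ht.eventually (gt_mem_nhds (half_pos hε)))
  refine ⟨N₀, fun N hN => ?_⟩
  rw [Real.dist_eq]
  have := hN₀ N hN
  linarith [hb N]

/-- After convolution with a fixed trigonometric kernel only finitely many frequencies remain, and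
on each the cut-offs sum to one. No convergence of the Littlewood–Paley series of `f` itself is
presupposed. -/
theorem hasSum_conv_lpC (P : DyadicPartition) (K : TrigKernel) (f : C(T2, ℝ)) (z : T2) :
    HasSum (fun κ => K.conv (lpC P κ (distOf f)) z) (K.conv f z) := by
  simp only [TrigKernel.conv, ContinuousMap.sum_apply]
  refine hasSum_sum fun m _ => ?_
  have h1 : HasSum (fun κ => (P.cutoff κ (freqVec m) + P.cutoff κ (freqVec (-m))) / 2) 1 := by
    simpa using ((P.hasSum_cutoff (freqVec m)).add (P.hasSum_cutoff (freqVec (-m)))).div_const 2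
  have h2 : HasSum (fun κ => mean (lpC P κ (distOf f) * cosC m)) (mean (f * cosC m)) := by
    simp only [mean_lpC_mul_cosC]
    simpa using! h1.mul_right (mean (f * cosC m))
  have h3 : HasSum (fun κ => mean (lpC P κ (distOf f) * sinC m)) (mean (f * sinC m)) := by
    simp only [mean_lpC_mul_sinC]
    simpa using! h1.mul_right (mean (f * sinC m))
  simp only [ContinuousMap.smul_apply, ContinuousMap.add_apply, smul_eq_mul]
  exact ((h2.mul_right _).add (h3.mul_right _)).mul_left _

/-- The constant in the embedding of Besov spaces in Hölder spaces. -/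
def holderConst (β θ : ℝ) : ℝ := 320 * Real.pi * (2 : ℝ) ^ β * (1 - (2 : ℝ) ^ (θ - β))⁻¹

theorem holderConst_pos {β θ : ℝ} (h : θ < β) : 0 < holderConst β θ := by
  have := two_rpow_lt_one h
  have : 0 < 1 - (2 : ℝ) ^ (θ - β) := by linarith
  have := Real.pi_pos
  unfold holderConst
  positivity

/-- For each block the trivial bound and Bernstein's inequality are interpolated with weights `1-θ`
and `θ`, and the results form a geometric series because `θ < β`. The sum is bounded after
mollification, uniformly in the kernel, and the mollification is then removed. -/
theorem isHolder_of_besovNorm_le {P : DyadicPartition} {β θ R : ℝ} (hR : 0 ≤ R) (hθ : 0 ≤ θ)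
    (hθβ : θ < β) (hθ1 : θ ≤ 1) {f : C(T2, ℝ)}
    (hf : besovNorm P β (distOf f) ≤ ENNReal.ofReal R) :
    IsHolder θ (holderConst β θ * R) f := by
  set b : ℕ → ℝ := fun κ => 320 * Real.pi * (2 : ℝ) ^ β * ((2 : ℝ) ^ (θ - β)) ^ κ * R with hb
  have hsum : HasSum b (holderConst β θ * R) :=
    ((hasSum_geometric_of_lt_one (by positivity) (two_rpow_lt_one hθβ)).mul_left _).mul_right _
  have hpi := Real.pi_gt_three
  set M : ℕ → ℝ := fun κ => (2 : ℝ) ^ (-(β * ((κ : ℝ) - 1))) * R with hM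
  have hM0 : ∀ κ, 0 ≤ M κ := fun κ => by positivity
  have hbM : ∀ κ, b κ = 320 * Real.pi * (2 ^ κ) ^ θ * M κ := fun κ => by
    simp only [hb, hM]
    have : (2 : ℝ) ^ β * ((2 : ℝ) ^ (θ - β)) ^ κ =
        (2 ^ κ) ^ θ * (2 : ℝ) ^ (-(β * ((κ : ℝ) - 1))) := by
      rw [← Real.rpow_natCast, ← Real.rpow_natCast, ← Real.rpow_mul zero_le_two,
        ← Real.rpow_mul zero_le_two, ← Real.rpow_add zero_lt_two, ← Real.rpow_add zero_lt_two]
      congr 1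
      ring
    linear_combination (320 * Real.pi * R) * this
  have hlp := abs_lpC_le_of_besovNorm_le hR hf
  have hMb : ∀ κ, M κ ≤ b κ := fun κ => by
    rw [hbM]
    have h1 : (1 : ℝ) ≤ (2 ^ κ) ^ θ := Real.one_le_rpow (one_le_pow₀ one_le_two) hθ
    have : 1 ≤ 320 * Real.pi * (2 ^ κ) ^ θ := by nlinarith
    nlinarith [hM0 κ]
  have hinc : ∀ κ z h, |lpC P κ (distOf f) (z + h) - lpC P κ (distOf f) z| ≤ b κ * ‖h‖ ^ θ := by
    intro κ z h
    have h1 := abs_lpC_apply_add_sub_le P κ (distOf f) (hlp κ) z h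
    have h2 : |lpC P κ (distOf f) (z + h) - lpC P κ (distOf f) z| ≤ 2 * M κ := by
      refine (abs_sub _ _).trans ?_
      linarith [hlp κ (z + h), hlp κ z]
    set a := |lpC P κ (distOf f) (z + h) - lpC P κ (distOf f) z|
    have ha0 : 0 ≤ a := abs_nonneg _
    have hq : 0 ≤ 1 - θ := by linarith
    have e1 : a ≤ 160 * Real.pi * M κ * (2 ^ κ * ‖h‖) := by
      refine h1.trans (le_of_eq ?_)
      simp only [hM]
      ring
    have e2 : a ≤ 160 * Real.pi * M κ := by nlinarith [hM0 κ]
    have e0 : 0 ≤ 160 * Real.pi * M κ := by positivity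
    calc a = a ^ (1 - θ) * a ^ θ := by
          rw [← Real.rpow_add_of_nonneg ha0 hq hθ]
          simp
      _ ≤ (160 * Real.pi * M κ) ^ (1 - θ) * (160 * Real.pi * M κ * (2 ^ κ * ‖h‖)) ^ θ := by
          gcongr
      _ = (160 * Real.pi * M κ) ^ (1 - θ) * (160 * Real.pi * M κ) ^ θ *
            ((2 ^ κ) ^ θ * ‖h‖ ^ θ) := by
          rw [Real.mul_rpow e0 (by positivity), Real.mul_rpow (by positivity) (norm_nonneg _)]
          ring
      _ = 160 * Real.pi * M κ * ((2 ^ κ) ^ θ * ‖h‖ ^ θ) := by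
          rw [← Real.rpow_add_of_nonneg e0 hq hθ]
          simp
      _ ≤ _ := by
          rw [hbM]
          have : 0 ≤ 160 * Real.pi * M κ * ((2 ^ κ) ^ θ * ‖h‖ ^ θ) := by positivity
          linarith
  constructor
  · intro z
    refine le_of_tendsto (tendsto_conv_jackson f z).abs (Eventually.of_forall fun N => ?_)
    rw [← (hasSum_conv_lpC P (jackson N) f z).tsum_eq, ← Real.norm_eq_abs]
    exact tsum_of_norm_bounded hsum fun κ =>
      (isMollifier_jackson N).abs_conv_le (fun y => (hlp κ y).trans (hMb κ)) z
  · intro z h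
    refine le_of_tendsto ((tendsto_conv_jackson f (z + h)).sub (tendsto_conv_jackson f z)).abs
      (Eventually.of_forall fun N => ?_)
    rw [← ((hasSum_conv_lpC P (jackson N) f (z + h)).sub
      (hasSum_conv_lpC P (jackson N) f z)).tsum_eq, ← Real.norm_eq_abs]
    refine tsum_of_norm_bounded (hsum.mul_right _) fun κ => ?_
    have : (jackson N).conv (lpC P κ (distOf f)) (z + h) - (jackson N).conv (lpC P κ (distOf f)) z
        = (jackson N).conv (translate h (lpC P κ (distOf f)) - lpC P κ (distOf f)) z := by
      rw [TrigKernel.conv_sub, TrigKernel.conv_translate]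
      rfl
    rw [this]
    exact (isMollifier_jackson N).abs_conv_le (fun y => hinc κ y h) z

/-- The periodic lift is Lipschitz on a ball that contains the chosen representatives of `z` and `z
+ h`, and `‖h‖ ≤ ‖h‖^θ` because distances on the torus are at most one. -/
theorem SmoothT2.exists_isHolder (φ : SmoothT2) {θ : ℝ} (hθ1 : θ ≤ 1) :
    ∃ K, IsHolder θ K φ.1 := by
  have hφ : ContDiff ℝ ∞ (periodicLift φ.1) := φ.2
  have hll : LocallyLipschitz (periodicLift φ.1) :=
    (hφ.of_le (m := 1) (by exact_mod_cast le_top)).locallyLipschitz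
  obtain ⟨C, hC⟩ := hll.locallyLipschitzOn (s := Metric.closedBall (0 : Fin 2 → ℝ) 2)
    |>.exists_lipschitzOnWith_of_compact (isCompact_closedBall _ _)
  refine ⟨max ‖φ.1‖ C, fun z => (φ.1.norm_coe_le_norm z).trans (le_max_left _ _),
    fun z h => ?_⟩
  choose x hx hx1 hx2 using fun i => exists_real_rep (z i)
  choose y hy hy1 hy2 using fun i => exists_real_rep (h i)
  have e1 : φ.1 (z + h) = periodicLift φ.1 (x + y) := by
    simp only [periodicLift, Pi.add_apply, AddCircle.coe_add, hx, hy]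
    rfl
  have e2 : φ.1 z = periodicLift φ.1 x := by
    simp only [periodicLift, hx]
  have hxb : x ∈ Metric.closedBall (0 : Fin 2 → ℝ) 2 := by
    rw [mem_closedBall_zero_iff, pi_norm_le_iff_of_nonneg zero_le_two]
    intro i
    rw [Real.norm_eq_abs]
    linarith [hx2 i]
  have hxyb : x + y ∈ Metric.closedBall (0 : Fin 2 → ℝ) 2 := by
    rw [mem_closedBall_zero_iff, pi_norm_le_iff_of_nonneg zero_le_two]
    intro i
    rw [Real.norm_eq_abs, Pi.add_apply]
    linarith [abs_add_le (x i) (y i), hx2 i, hy2 i]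
  have h1 := hC.dist_le_mul _ hxyb _ hxb
  rw [Real.dist_eq, dist_eq_norm, add_sub_cancel_left] at h1
  have h2 : ‖y‖ ≤ ‖h‖ := by
    rw [pi_norm_le_iff_of_nonneg (norm_nonneg _)]
    intro i
    rw [Real.norm_eq_abs, hy1]
    exact norm_le_pi_norm h i
  have h3 : ‖h‖ ≤ ‖h‖ ^ θ := by
    rcases eq_or_lt_of_le (norm_nonneg h) with h0 | h0
    · rw [← h0]
      positivity
    · simpa using Real.rpow_le_rpow_of_exponent_ge h0 (norm_torus_le_one h) hθ1
  rw [e1, e2]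
  calc _ ≤ C * ‖y‖ := h1
    _ ≤ max ‖φ.1‖ C * ‖h‖ ^ θ := by
      gcongr
      · exact le_max_right _ _
      · exact h2.trans h3

theorem distOf_sub (f g : C(T2, ℝ)) : distOf (f - g) = distOf f - distOf g := by
  refine Subtype.ext (LinearMap.ext fun φ => ?_)
  change mean ((f - g) * φ.1) = mean (f * φ.1) - mean (g * φ.1)
  rw [sub_mul, map_sub]

section Curve

variable {P : DyadicPartition} {β θ : ℝ}

/-- Elements of the completion are handled as a smooth function plus a remainder of Besov norm less
than one. -/
theorem MemC.exists_isHolder (hθ : 0 ≤ θ) (hθβ : θ < β) (hθ1 : θ ≤ 1) {f : C(T2, ℝ)}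
    (hf : MemC P β (distOf f)) : ∃ K, IsHolder θ K f := by
  obtain ⟨φ, hφ⟩ := hf 1 one_pos
  obtain ⟨K, hK⟩ := SmoothT2.exists_isHolder φ hθ1
  rw [← distOf_sub] at hφ
  have h1 := isHolder_of_besovNorm_le (R := 1) zero_le_one hθ hθβ hθ1 (by simpa using hφ.le)
  exact ⟨_, by simpa using h1.add hK⟩

theorem ContinuousInC.eventually_isHolder {I : Set ℝ} {v : ℝ → C(T2, ℝ)} (hθ : 0 ≤ θ)
    (hθβ : θ < β) (hθ1 : θ ≤ 1) (hv : ContinuousInC P β I fun t => distOf (v t)) {t : ℝ}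
    (ht : t ∈ I) {ε : ℝ} (hε : 0 < ε) : ∀ᶠ r in 𝓝[I] t, IsHolder θ ε (v r - v t) := by
  have hC := holderConst_pos hθβ
  have h1 : (0 : ℝ≥0∞) < ENNReal.ofReal (ε / holderConst β θ) := by
    rw [ENNReal.ofReal_pos]
    positivity
  filter_upwards [(hv t ht).2.eventually (gt_mem_nhds h1)] with r hr
  rw [← distOf_sub] at hr
  have := isHolder_of_besovNorm_le (by positivity) hθ hθβ hθ1 hr.le
  rwa [mul_div_cancel₀ _ hC.ne'] at this

theorem ContinuousInC.continuousOn {I : Set ℝ} {v : ℝ → C(T2, ℝ)} (hβ : 0 < β)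
    (hv : ContinuousInC P β I fun t => distOf (v t)) : ContinuousOn v I := by
  intro t ht
  refine Metric.tendsto_nhds.2 fun ε hε => ?_
  filter_upwards [hv.eventually_isHolder le_rfl hβ zero_le_one ht (half_pos hε)] with r hr
  rw [dist_eq_norm]
  exact ((ContinuousMap.norm_le _ (half_pos hε).le).2 hr.1).trans_lt (half_lt_self hε)

theorem ContinuousInC.exists_isHolder {I J : Set ℝ} (hJ : IsCompact J) (hJI : J ⊆ I)
    {v : ℝ → C(T2, ℝ)} (hθ : 0 ≤ θ) (hθβ : θ < β) (hθ1 : θ ≤ 1)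
    (hv : ContinuousInC P β I fun t => distOf (v t)) : ∃ K, ∀ r ∈ J, IsHolder θ K (v r) := by
  refine hJ.induction_on (p := fun s => ∃ K, ∀ r ∈ s, IsHolder θ K (v r)) ⟨0, by simp⟩ ?_ ?_ ?_
  · rintro s t hst ⟨K, hK⟩
    exact ⟨K, fun r hr => hK r (hst hr)⟩
  · rintro s t ⟨K, hK⟩ ⟨K', hK'⟩
    exact ⟨max K K', fun r hr => hr.elim (fun h => (hK r h).mono (le_max_left _ _))
      fun h => (hK' r h).mono (le_max_right _ _)⟩
  · intro t ht
    obtain ⟨K, hK⟩ := (hv t (hJI ht)).1.exists_isHolder hθ hθβ hθ1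
    refine ⟨_, nhdsWithin_mono t hJI
      (hv.eventually_isHolder hθ hθβ hθ1 (hJI ht) one_pos), 1 + K, fun r hr => ?_⟩
    have : IsHolder θ 1 (v r - v t) := hr
    simpa using this.add hK

end Curve

/-! ### Signed powers -/

/-- The signed power `x |x|^{q-1}`. -/
def signedPow (q : ℕ) (x : ℝ) : ℝ := x * |x| ^ (q - 1)

theorem signedPow_neg (q : ℕ) (x : ℝ) : signedPow q (-x) = -signedPow q x := by
  simp [signedPow]

theorem signedPow_odd {k : ℕ} (hk : Even (k - 1)) (hk1 : 1 ≤ k) (x : ℝ) :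
    signedPow k x = x ^ k := by
  rw [signedPow, hk.pow_abs, mul_comm, ← pow_succ, Nat.sub_add_cancel hk1]

/-- By symmetry `x ≥ |y|`. For `y ≥ 0` the bound holds with constant one; for opposite signs `|x -
y| ≤ 2x`, which accounts for the `2`. -/
theorem abs_signedPow_sub_ge (q : ℕ) (x y : ℝ) :
    |x - y| * max |x| |y| ^ (q - 1) ≤ 2 * |signedPow q x - signedPow q y| := by
  wlog hxy : |y| ≤ |x| generalizing x y with H
  · have := H y x (le_of_not_ge hxy)
    rwa [abs_sub_comm x, max_comm, abs_sub_comm (signedPow q x)]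
  wlog hx : 0 ≤ x generalizing x y with H
  · have := H (-x) (-y) (by simpa using hxy) (by linarith)
    rw [signedPow_neg, signedPow_neg, abs_neg, abs_neg] at this
    rw [show -x - -y = -(x - y) by ring, abs_neg,
      show -signedPow q x - -signedPow q y = -(signedPow q x - signedPow q y) by ring,
      abs_neg] at this
    exact this
  rw [max_eq_left hxy]
  rw [abs_of_nonneg hx] at hxy ⊢
  have hx0 : 0 ≤ x ^ (q - 1) := by positivity
  have h1 : signedPow q x = x * x ^ (q - 1) := by rw [signedPow, abs_of_nonneg hx]
  have hyx := abs_le.1 hxy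
  rw [abs_of_nonneg (by linarith : 0 ≤ x - y), h1]
  rcases le_total 0 y with hy | hy
  · have h2 : signedPow q y ≤ y * x ^ (q - 1) := by
      rw [signedPow]
      gcongr
    have := le_abs_self (x * x ^ (q - 1) - signedPow q y)
    nlinarith [mul_nonneg (by linarith : 0 ≤ x - y) hx0]
  · have h2 : signedPow q y ≤ 0 := mul_nonpos_of_nonpos_of_nonneg hy (by positivity)
    have := le_abs_self (x * x ^ (q - 1) - signedPow q y)
    nlinarith

theorem abs_pow_sub_pow_le_max (x y : ℝ) (k : ℕ) :
    |x ^ k - y ^ k| ≤ k * (|x - y| * max |x| |y| ^ (k - 1)) := by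
  have := abs_pow_sub_pow_le x y k
  linarith

theorem abs_signedPow_sub_le {q : ℕ} (hq : 1 ≤ q) (x y : ℝ) :
    |signedPow q x - signedPow q y| ≤ q * (|x - y| * max |x| |y| ^ (q - 1)) := by
  set M := max |x| |y|
  have hM : 0 ≤ M := (abs_nonneg x).trans (le_max_left _ _)
  have h1 : signedPow q x - signedPow q y =
      (x - y) * |x| ^ (q - 1) + y * (|x| ^ (q - 1) - |y| ^ (q - 1)) := by
    simp only [signedPow]
    ring
  have h2 : |y * (|x| ^ (q - 1) - |y| ^ (q - 1))| ≤ (q - 1 : ℕ) * (|x - y| * M ^ (q - 1)) := by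
    rcases Nat.lt_or_ge q 2 with h | h
    · have : q - 1 = 0 := by omega
      simp [this]
    · have h3 := abs_pow_sub_pow_le_max |x| |y| (q - 1)
      rw [abs_abs, abs_abs] at h3
      have h4 : M ^ (q - 1) = M * M ^ (q - 1 - 1) := by
        rw [← pow_succ', show q - 1 - 1 + 1 = q - 1 by omega]
      rw [abs_mul, h4]
      calc |y| * |(|x| ^ (q - 1) - |y| ^ (q - 1))|
          ≤ M * ((q - 1 : ℕ) * (|x - y| * M ^ (q - 1 - 1))) := by
            gcongr
            · exact le_max_right _ _
            · exact h3.trans (mul_le_mul_of_nonneg_left (mul_le_mul_of_nonneg_right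
                (abs_abs_sub_abs_le x y) (by positivity)) (by positivity))
        _ = _ := by ring
  rw [h1]
  refine (abs_add_le _ _).trans ?_
  have h3 : |(x - y) * |x| ^ (q - 1)| ≤ |x - y| * M ^ (q - 1) := by
    rw [abs_mul, abs_pow, abs_abs]
    gcongr
    exact le_max_left _ _
  have h4 : ((q - 1 : ℕ) : ℝ) = q - 1 := by push_cast [hq]; ring
  rw [h4] at h2
  linarith

/-- The inequality of Stroock and Varopoulos. -/
theorem signedPow_sub_sq_le {q : ℕ} (hq : 1 ≤ q) (x y : ℝ) :
    (signedPow q x - signedPow q y) ^ 2 ≤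
      2 * (q : ℝ) ^ 2 * ((x - y) * (x ^ (2 * q - 1) - y ^ (2 * q - 1))) := by
  -- The exponent `2q-1` is odd, so the ordinary power is a signed power and the lower bound above
  -- applies to it.
  have hev : Even (2 * q - 1 - 1) := ⟨q - 1, by omega⟩
  have h1 := abs_signedPow_sub_ge (2 * q - 1) x y
  rw [signedPow_odd hev (by omega), signedPow_odd hev (by omega)] at h1
  have h2 := abs_signedPow_sub_le hq x y
  have h3 : (x - y) * (x ^ (2 * q - 1) - y ^ (2 * q - 1)) =
      |x - y| * |x ^ (2 * q - 1) - y ^ (2 * q - 1)| := by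
    have hodd : Odd (2 * q - 1) := ⟨q - 1, by omega⟩
    rw [← abs_mul, abs_of_nonneg]
    rcases le_total x y with h | h
    · exact mul_nonneg_of_nonpos_of_nonpos (by linarith)
        (sub_nonpos.2 (hodd.strictMono_pow.monotone h))
    · exact mul_nonneg (by linarith) (sub_nonneg.2 (hodd.strictMono_pow.monotone h))
  rw [h3, ← sq_abs]
  set M := max |x| |y|
  -- Both sides are compared with `|x-y|² M^(2q-2)`.
  calc _ ≤ (q * (|x - y| * M ^ (q - 1))) ^ 2 := by gcongr
    _ = (q : ℝ) ^ 2 * (|x - y| * (|x - y| * M ^ (2 * q - 1 - 1))) := by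
        rw [show 2 * q - 1 - 1 = (q - 1) * 2 by omega, pow_mul]
        ring
    _ ≤ (q : ℝ) ^ 2 * (|x - y| * (2 * |x ^ (2 * q - 1) - y ^ (2 * q - 1)|)) := by gcongr
    _ = _ := by ring

/-- Only the power `θ` of the increment is kept and the rest is estimated by `M^(1-θ)`. The
increment of the signed power then pays for `|x-y|^θ M^((q-1)θ)`, and homogeneity leaves `M^(k-qθ)`.
-/
theorem abs_pow_sub_pow_le_rpow {q k : ℕ} (hq : 1 ≤ q) (hk : 1 ≤ k) {θ : ℝ} (hθ : 0 ≤ θ)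
    (hθ1 : θ ≤ 1) (x y : ℝ) :
    |x ^ k - y ^ k| ≤
      4 * k * (|signedPow q x - signedPow q y| ^ θ * max |x| |y| ^ (k - q * θ)) := by
  set M := max |x| |y|
  have hM : 0 ≤ M := (abs_nonneg x).trans (le_max_left _ _)
  rcases hM.eq_or_lt with h0 | hM0
  · have hx : x = 0 := abs_nonpos_iff.1 (h0 ▸ le_max_left _ _)
    have hy : y = 0 := abs_nonpos_iff.1 (h0 ▸ le_max_right _ _)
    rw [hx, hy, sub_self, abs_zero]
    positivity
  have h1 := abs_pow_sub_pow_le_max x y k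
  have h2 : |x - y| ≤ 2 * M :=
    (abs_sub _ _).trans (by linarith [le_max_left |x| |y|, le_max_right |x| |y|])
  have h3 := abs_signedPow_sub_ge q x y
  have h4 : 0 ≤ 1 - θ := by linarith
  have h5 : |x - y| ≤ 2 * (|x - y| ^ θ * M ^ (1 - θ)) := by
    calc |x - y| = |x - y| ^ θ * |x - y| ^ (1 - θ) := by
          rw [← Real.rpow_add_of_nonneg (abs_nonneg _) hθ h4]
          simp
      _ ≤ |x - y| ^ θ * (2 * M) ^ (1 - θ) := by gcongr
      _ = 2 ^ (1 - θ) * (|x - y| ^ θ * M ^ (1 - θ)) := by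
          rw [Real.mul_rpow zero_le_two hM]
          ring
      _ ≤ _ := by
          gcongr
          simpa using Real.rpow_le_rpow_of_exponent_le one_le_two (by linarith : 1 - θ ≤ 1)
  have h6 : |x - y| ^ θ * M ^ (((q : ℝ) - 1) * θ) ≤ 2 * |signedPow q x - signedPow q y| ^ θ := by
    have h7 : M ^ (((q : ℝ) - 1) * θ) = (M ^ (q - 1)) ^ θ := by
      rw [Real.rpow_mul hM, ← Real.rpow_natCast M (q - 1)]
      push_cast [hq]
      rfl
    rw [h7, ← Real.mul_rpow (abs_nonneg _) (by positivity)]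
    calc _ ≤ (2 * |signedPow q x - signedPow q y|) ^ θ := by gcongr
      _ = 2 ^ θ * |signedPow q x - signedPow q y| ^ θ :=
          Real.mul_rpow zero_le_two (abs_nonneg _)
      _ ≤ _ := by
          gcongr
          simpa using Real.rpow_le_rpow_of_exponent_le one_le_two hθ1
  have h8 : M ^ (1 - θ) * M ^ (k - 1) = M ^ (((q : ℝ) - 1) * θ) * M ^ (k - q * θ) := by
    rw [← Real.rpow_natCast M (k - 1), ← Real.rpow_add hM0, ← Real.rpow_add hM0]
    congr 1
    push_cast [hk]
    ring
  calc _ ≤ _ := h1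
    _ ≤ k * (2 * (|x - y| ^ θ * M ^ (1 - θ)) * M ^ (k - 1)) := by gcongr
    _ = 2 * k * (|x - y| ^ θ * (M ^ (1 - θ) * M ^ (k - 1))) := by ring
    _ = 2 * k * (|x - y| ^ θ * M ^ (((q : ℝ) - 1) * θ) * M ^ (k - q * θ)) := by
        rw [h8]
        ring
    _ ≤ 2 * k * (2 * |signedPow q x - signedPow q y| ^ θ * M ^ (k - q * θ)) := by gcongr
    _ = _ := by ring

/-! ### The dissipation -/

/-- The signed power of a continuous function. -/
def signedPowC (q : ℕ) (f : C(T2, ℝ)) : C(T2, ℝ) := f * |f| ^ (q - 1)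

theorem signedPowC_apply (q : ℕ) (f : C(T2, ℝ)) (z : T2) :
    signedPowC q f z = signedPow q (f z) := by
  simp [signedPowC, signedPow]

/-- The function `- ∂ᵢ² (K * f)`. -/
def TrigKernel.convNegLap (K : TrigKernel) (i : Fin 2) (f : C(T2, ℝ)) : C(T2, ℝ) :=
  ∑ m ∈ K.freq, (4 * Real.pi ^ 2 * (m i : ℝ) ^ 2) • K.coeff m •
    (mean (f * cosC m) • cosC m + mean (f * sinC m) • sinC m)

theorem mFourier_single (m : Fin 2 → ℤ) (i : Fin 2) (x : ℝ) :
    𝐞 m (Pi.single i (x : UnitAddCircle)) =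
      Complex.exp (((2 * Real.pi * m i * x : ℝ) : ℂ) * Complex.I) := by
  have h : 𝐞 m (Pi.single i (x : UnitAddCircle)) = fourier (m i) (x : UnitAddCircle) := by
    rw [UnitAddTorus.mFourier, ContinuousMap.coe_mk, Finset.prod_eq_single i]
    · rw [Pi.single_eq_same]
    · intro j _ hj
      rw [Pi.single_eq_of_ne hj, fourier_eval_zero]
    · simp
  rw [h, fourier_coe_apply]
  congr 1
  push_cast
  ring

theorem cosC_single (m : Fin 2 → ℤ) (i : Fin 2) (x : ℝ) :
    cosC m (Pi.single i (x : UnitAddCircle)) = Real.cos (2 * Real.pi * m i * x) := by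
  rw [cosC_apply, mFourier_single, Complex.exp_ofReal_mul_I_re]

theorem sinC_single (m : Fin 2 → ℤ) (i : Fin 2) (x : ℝ) :
    sinC m (Pi.single i (x : UnitAddCircle)) = Real.sin (2 * Real.pi * m i * x) := by
  rw [sinC_apply, mFourier_single, Complex.exp_ofReal_mul_I_im]

/-- Discrete integration by parts: the product of first differences becomes a second difference of
`V` alone. -/
theorem mean_translate_sub_mul_translate_sub (V g : C(T2, ℝ)) (y : T2) :
    mean ((translate y V - V) * (translate y g - g)) =
      mean (((2 : ℝ) • V - translate y V - translate (-y) V) * g) := by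
  have h1 : mean (translate y V * translate y g) = mean (V * g) := by
    rw [← mean_translate y (V * g)]
    rfl
  have h2 : mean (V * translate y g) = mean (translate (-y) V * g) := by
    rw [← mean_translate (-y) (V * translate y g)]
    congr 1
    ext z
    simp
  rw [sub_mul, mul_sub, mul_sub, map_sub, map_sub, map_sub, h1, h2, sub_mul, sub_mul, map_sub,
    map_sub, smul_mul_assoc, map_smul, smul_eq_mul]
  ring

theorem two_smul_sub_translate_conv (K : TrigKernel) (f : C(T2, ℝ)) (y : T2) :
    (2 : ℝ) • K.conv f - translate y (K.conv f) - translate (-y) (K.conv f) =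
      ∑ m ∈ K.freq, (2 - 2 * cosC m y) • K.coeff m •
        (mean (f * cosC m) • cosC m + mean (f * sinC m) • sinC m) := by
  ext z
  simp only [TrigKernel.conv, ContinuousMap.sub_apply, ContinuousMap.smul_apply,
    ContinuousMap.sum_apply, translate_apply, ContinuousMap.add_apply, smul_eq_mul,
    Finset.mul_sum, ← Finset.sum_sub_distrib, cosC_apply_add, sinC_apply_add, cosC_apply_neg,
    sinC_apply_neg]
  exact Finset.sum_congr rfl fun m _ => by ring

/-- Telescoping over `k` steps and Cauchy–Schwarz; by translation invariance all steps have the same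
mean. -/
theorem mean_translate_nsmul_sub_sq_le (w : C(T2, ℝ)) (y : T2) (k : ℕ) :
    mean ((translate (k • y) w - w) ^ 2) ≤ (k : ℝ) ^ 2 * mean ((translate y w - w) ^ 2) := by
  have h1 : mean ((translate (k • y) w - w) ^ 2) ≤
      mean ((k : ℝ) • ∑ l ∈ Finset.range k, translate (l • y) ((translate y w - w) ^ 2)) := by
    refine mean_mono fun z => ?_
    have h2 : w (z + k • y) - w z = ∑ l ∈ Finset.range k, (w (z + l • y + y) - w (z + l • y)) := by
      have := Finset.sum_range_sub (fun l => w (z + l • y)) k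
      simp only [zero_smul, add_zero] at this
      rw [← this]
      refine Finset.sum_congr rfl fun l _ => ?_
      rw [succ_nsmul, add_assoc]
    simp only [ContinuousMap.pow_apply, ContinuousMap.sub_apply, translate_apply,
      ContinuousMap.smul_apply, ContinuousMap.sum_apply, smul_eq_mul]
    rw [h2]
    simpa using sq_sum_le_card_mul_sum_sq (s := Finset.range k)
      (f := fun l => w (z + l • y + y) - w (z + l • y))
  rw [map_smul, map_sum] at h1
  simp only [mean_translate, Finset.sum_const, Finset.card_range, nsmul_eq_mul, smul_eq_mul] at h1
  linarith

theorem tendsto_sq_mul_two_sub_two_cos (c : ℝ) :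
    Tendsto (fun k : ℕ => (k : ℝ) ^ 2 * (2 - 2 * Real.cos (c / k))) atTop (𝓝 (c ^ 2)) := by
  have hder : HasDerivAt (fun t : ℝ => Real.sin (c / 2 * t)) (c / 2) 0 := by
    simpa using ((hasDerivAt_id (0 : ℝ)).const_mul (c / 2)).sin
  have h0 : Tendsto (fun k : ℕ => ((k : ℝ))⁻¹) atTop (𝓝[≠] 0) :=
    (tendsto_inv_atTop_nhdsGT_zero.comp (tendsto_natCast_atTop_atTop (R := ℝ))).mono_right
      (nhdsWithin_mono _ fun x hx => ne_of_gt hx)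
  have h1 := ((hder.tendsto_slope_zero.comp h0).pow 2).const_mul 4
  rw [show 4 * (c / 2) ^ 2 = c ^ 2 by ring] at h1
  refine h1.congr fun k => ?_
  have h2 : Real.cos (c / k) = 1 - 2 * Real.sin (c / 2 * (k : ℝ)⁻¹) ^ 2 := by
    have := Real.cos_two_mul' (c / 2 * (k : ℝ)⁻¹)
    rw [Real.cos_sq', show 2 * (c / 2 * (k : ℝ)⁻¹) = c / k by ring] at this
    linarith
  simp only [Function.comp_apply, zero_add, mul_zero, Real.sin_zero, sub_zero, inv_inv,
    smul_eq_mul, h2]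
  ring

/-- The shift is divided into `k` small ones. For a small shift the pointwise Stroock–Varopoulos
inequality and discrete integration by parts give a second difference of `K.conv f`, which on mode
`m` is multiplication by `2 - 2 cos`. Times `k²` this converges to the second derivative, so the
signed power never has to be differentiated. -/
theorem mean_translate_single_signedPowC_le (K : TrigKernel) {q : ℕ} (hq : 1 ≤ q) (f : C(T2, ℝ))
    (i : Fin 2) (x : ℝ) :
    mean ((translate (Pi.single i (x : UnitAddCircle)) (signedPowC q (K.conv f)) -
      signedPowC q (K.conv f)) ^ 2) ≤
      2 * (q : ℝ) ^ 2 * (x ^ 2 * mean (K.convNegLap i f * K.conv f ^ (2 * q - 1))) := by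
  set V := K.conv f
  set w := signedPowC q V
  set g := V ^ (2 * q - 1)
  set d : (Fin 2 → ℤ) → ℝ := fun m => mean ((K.coeff m •
    (mean (f * cosC m) • cosC m + mean (f * sinC m) • sinC m)) * g) with hd
  have hlim : Tendsto (fun k : ℕ => 2 * (q : ℝ) ^ 2 * ∑ m ∈ K.freq,
      (k : ℝ) ^ 2 * (2 - 2 * Real.cos (2 * Real.pi * m i * x / k)) * d m) atTop
      (𝓝 (2 * (q : ℝ) ^ 2 * ∑ m ∈ K.freq, (2 * Real.pi * m i * x) ^ 2 * d m)) :=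
    (tendsto_finsetSum _ fun m _ => (tendsto_sq_mul_two_sub_two_cos _).mul_const _).const_mul _
  have hD : x ^ 2 * mean (K.convNegLap i f * g) =
      ∑ m ∈ K.freq, (2 * Real.pi * m i * x) ^ 2 * d m := by
    rw [TrigKernel.convNegLap, Finset.sum_mul, map_sum, Finset.mul_sum]
    refine Finset.sum_congr rfl fun m _ => ?_
    rw [smul_mul_assoc, map_smul, smul_eq_mul]
    ring
  rw [hD]
  refine ge_of_tendsto hlim ?_
  filter_upwards [eventually_gt_atTop 0] with k hk
  have hk' : (k : ℝ) ≠ 0 := by positivity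
  set y : T2 := Pi.single i ((x / k : ℝ) : UnitAddCircle) with hy
  have hky : k • y = Pi.single i (x : UnitAddCircle) := by
    rw [hy, ← Pi.single_smul, ← AddCircle.coe_nsmul, nsmul_eq_mul, mul_div_cancel₀ _ hk']
  rw [← hky]
  refine (mean_translate_nsmul_sub_sq_le w y k).trans ?_
  have h1 : mean ((translate y w - w) ^ 2) ≤
      mean ((2 * (q : ℝ) ^ 2) • ((translate y V - V) * (translate y g - g))) := by
    refine mean_mono fun z => ?_
    simp only [ContinuousMap.pow_apply, ContinuousMap.sub_apply, translate_apply,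
      ContinuousMap.smul_apply, ContinuousMap.mul_apply, smul_eq_mul, w, g, signedPowC_apply]
    exact signedPow_sub_sq_le hq _ _
  rw [map_smul, mean_translate_sub_mul_translate_sub, two_smul_sub_translate_conv,
    Finset.sum_mul, map_sum, smul_eq_mul] at h1
  refine (mul_le_mul_of_nonneg_left h1 (sq_nonneg (k : ℝ))).trans (le_of_eq ?_)
  rw [mul_left_comm, Finset.mul_sum]
  congr 1
  refine Finset.sum_congr rfl fun m _ => ?_
  rw [smul_mul_assoc, map_smul, smul_eq_mul, hy, cosC_single, mul_div_assoc']
  simp only [hd]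
  ring

/-- The dissipation controls the increments of the signed power. -/
theorem mean_translate_signedPowC_le (K : TrigKernel) {q : ℕ} (hq : 1 ≤ q) (f : C(T2, ℝ)) :
    0 ≤ mean ((K.convNegLap 0 f + K.convNegLap 1 f) * K.conv f ^ (2 * q - 1)) ∧
    ∀ h, mean ((translate h (signedPowC q (K.conv f)) - signedPowC q (K.conv f)) ^ 2) ≤
      4 * (q : ℝ) ^ 2 * ‖h‖ ^ 2 *
        mean ((K.convNegLap 0 f + K.convNegLap 1 f) * K.conv f ^ (2 * q - 1)) := by
  have hs := mean_translate_single_signedPowC_le K hq f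
  set V := K.conv f
  set w := signedPowC q V
  set g := V ^ (2 * q - 1)
  have hq0 : (0 : ℝ) < q := by exact_mod_cast hq
  -- By the directional bound with `x = 1`, a positive multiple of this mean dominates the mean of a
  -- square.
  have hn : ∀ i, 0 ≤ mean (K.convNegLap i f * g) := fun i => by
    have h1 := hs i 1
    have h2 : 0 ≤ mean ((translate (Pi.single i ((1 : ℝ) : UnitAddCircle)) w - w) ^ 2) :=
      mean_nonneg fun z => by
        rw [ContinuousMap.pow_apply]
        positivity
    have h3 : 0 < 2 * (q : ℝ) ^ 2 := by positivity
    have h4 := h2.trans h1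
    rw [one_pow, one_mul] at h4
    exact nonneg_of_mul_nonneg_right h4 h3
  rw [add_mul, map_add]
  refine ⟨add_nonneg (hn 0) (hn 1), fun h => ?_⟩
  choose x hx hx1 hx2 using fun i => exists_real_rep (h i)
  set s : Fin 2 → T2 := fun i => Pi.single i (x i : UnitAddCircle)
  have hh : h = s 0 + s 1 := by
    ext i
    fin_cases i <;> simp [s, hx]
  have hxh : ∀ i, x i ^ 2 ≤ ‖h‖ ^ 2 := fun i => by
    rw [← sq_abs, hx1]
    gcongr
    exact norm_le_pi_norm h i
  -- The shift is made one coordinate at a time, and the square of the sum of the two increments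
  -- costs a factor two.
  have h1 : mean ((translate h w - w) ^ 2) ≤
      mean ((2 : ℝ) • (translate (s 1) ((translate (s 0) w - w) ^ 2)) +
        (2 : ℝ) • (translate (s 1) w - w) ^ 2) := by
    refine mean_mono fun z => ?_
    simp only [ContinuousMap.pow_apply, ContinuousMap.sub_apply, translate_apply,
      ContinuousMap.smul_apply, ContinuousMap.add_apply, smul_eq_mul]
    rw [hh, add_comm (s 0), ← add_assoc]
    nlinarith [sq_nonneg (w (z + s 1 + s 0) - w (z + s 1) - (w (z + s 1) - w z))]
  rw [map_add, map_smul, map_smul, mean_translate, smul_eq_mul, smul_eq_mul] at h1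
  have h2 : ∀ i, x i ^ 2 * mean (K.convNegLap i f * g) ≤
      ‖h‖ ^ 2 * mean (K.convNegLap i f * g) := fun i =>
    mul_le_mul_of_nonneg_right (hxh i) (hn i)
  have h3 := hs 0 (x 0)
  have h4 := hs 1 (x 1)
  have hq2 : 0 ≤ 2 * (q : ℝ) ^ 2 := by positivity
  have h5 := mul_le_mul_of_nonneg_left (h2 0) hq2
  have h6 := mul_le_mul_of_nonneg_left (h2 1) hq2
  linarith

/-! ### Interpolation -/

/-- A pointwise form of Hölder's inequality: when `a` and `b` bound the means of `x` and `y`,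
integration makes the bracket at most `u + v + w = 1`. Positivity of `a` and `b` is why upper
bounds, and not the means themselves, enter the lemmas below. -/
theorem rpow_mul_rpow_le_of_add_eq {x y a b u v w : ℝ} (hx : 0 ≤ x) (hy : 0 ≤ y) (ha : 0 < a)
    (hb : 0 < b) (hu : 0 ≤ u) (hv : 0 ≤ v) (hw : 0 ≤ w) (h : u + v + w = 1) :
    x ^ u * y ^ v ≤ a ^ u * b ^ v * (u * (x / a) + v * (y / b) + w) := by
  have h1 := Real.geom_mean_le_arith_mean3_weighted hu hv hw (div_nonneg hx ha.le)
    (div_nonneg hy hb.le) zero_le_one h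
  rw [Real.one_rpow, mul_one, mul_one, Real.div_rpow hx ha.le, Real.div_rpow hy hb.le,
    div_mul_div_comm, div_le_iff₀ (by positivity)] at h1
  linarith

theorem mean_abs_pow_le {V : C(T2, ℝ)} {k r : ℕ} (hr : Even r) (hkr : k ≤ r) (hr0 : 0 < r) {B : ℝ}
    (hB0 : 0 < B) (hB : mean (V ^ r) ≤ B) : mean |V ^ k| ≤ B ^ ((k : ℝ) / r) := by
  have hr0' : (0 : ℝ) < r := by exact_mod_cast hr0
  have hkr' : (k : ℝ) / r ≤ 1 := (div_le_one hr0').2 (by exact_mod_cast hkr)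
  have h1 : mean |V ^ k| ≤ mean (B ^ ((k : ℝ) / r) • (((k : ℝ) / r / B) • V ^ r +
      ContinuousMap.const _ (1 - (k : ℝ) / r))) := by
    refine mean_mono fun z => ?_
    simp only [ContinuousMap.abs_apply, ContinuousMap.pow_apply, ContinuousMap.smul_apply,
      ContinuousMap.add_apply, ContinuousMap.const_apply, smul_eq_mul]
    have h2 := rpow_mul_rpow_le_of_add_eq (u := (k : ℝ) / r) (v := 0) (w := 1 - (k : ℝ) / r)
      (hr.pow_nonneg (V z)) zero_le_one hB0 one_pos (by positivity) le_rfl (by linarith) (by ring)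
    have h3 : (V z ^ r) ^ ((k : ℝ) / r) = |V z ^ k| := by
      rw [← hr.pow_abs, ← Real.rpow_natCast, ← Real.rpow_mul (abs_nonneg _),
        mul_div_cancel₀ _ hr0'.ne', Real.rpow_natCast, abs_pow]
    rw [h3, Real.rpow_zero, mul_one, mul_one] at h2
    refine h2.trans (le_of_eq ?_)
    ring
  refine h1.trans ?_
  rw [map_smul, map_add, map_smul, mean_const, smul_eq_mul, smul_eq_mul]
  have h2 : (k : ℝ) / r / B * mean (V ^ r) ≤ (k : ℝ) / r := by
    rw [div_mul_eq_mul_div, div_le_iff₀ hB0]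
    gcongr
  have h3 : 0 ≤ B ^ ((k : ℝ) / r) := by positivity
  nlinarith

/-- Hölder's inequality with exponents `θ/2` for the squared increments of the signed power,
`(k-qθ)/r` for the `r`-th power and the remainder for the constant one, available because the torus
has mass one. -/
theorem mean_abs_translate_pow_sub_le {V : C(T2, ℝ)} {q k r : ℕ} (hq : 1 ≤ q) (hk : 1 ≤ k)
    (hr : Even r) (hr0 : 0 < r) {θ A B : ℝ} (hθ : 0 ≤ θ) (hθ1 : θ ≤ 1) (hqk : q * θ ≤ k)
    (hω : θ / 2 + (k - q * θ) / r ≤ 1) (hA0 : 0 < A) (hB0 : 0 < B) (hB : mean (V ^ r) ≤ B)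
    (hA : ∀ h, mean ((translate h (signedPowC q V) - signedPowC q V) ^ 2) ≤
      4 * (q : ℝ) ^ 2 * ‖h‖ ^ 2 * A) (h : T2) :
    mean |translate h (V ^ k) - V ^ k| ≤
      16 * k * q * (A ^ (θ / 2) * B ^ ((k - q * θ) / r)) * ‖h‖ ^ θ := by
  have hr0' : (0 : ℝ) < r := by exact_mod_cast hr0
  have hq0 : (1 : ℝ) ≤ q := by exact_mod_cast hq
  rcases eq_or_ne h 0 with rfl | hh
  · have : |translate 0 (V ^ k) - V ^ k| = 0 := by
      ext z
      simp
    rw [this, map_zero]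
    positivity
  have hh' : 0 < ‖h‖ := norm_pos_iff.2 hh
  set η := ((k : ℝ) - q * θ) / r with hη
  have hη0 : 0 ≤ η := div_nonneg (by linarith) hr0'.le
  have hη1 : η ≤ 1 := by linarith
  set a := 4 * (q : ℝ) ^ 2 * ‖h‖ ^ 2 * A with ha
  have ha0 : 0 < a := by positivity
  -- The larger of the two values is controlled by `x^r + y^r`, whose mean is twice that of `V^r`.
  set b := 2 * B with hb
  have hb0 : 0 < b := by positivity
  set w := signedPowC q V with hw
  have h1 : mean |translate h (V ^ k) - V ^ k| ≤ mean ((4 * k * (a ^ (θ / 2) * b ^ η)) •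
      ((θ / 2 / a) • (translate h w - w) ^ 2 + (η / b) • (translate h (V ^ r) + V ^ r) +
        ContinuousMap.const _ (1 - θ / 2 - η))) := by
    refine mean_mono fun z => ?_
    simp only [ContinuousMap.abs_apply, ContinuousMap.pow_apply, ContinuousMap.smul_apply,
      ContinuousMap.add_apply, ContinuousMap.sub_apply, translate_apply,
      ContinuousMap.const_apply, smul_eq_mul]
    set x := V (z + h)
    set y := V z
    have h2 := abs_pow_sub_pow_le_rpow hq hk hθ hθ1 x y
    have hwx : w (z + h) = signedPow q x := signedPowC_apply _ _ _
    have hwy : w z = signedPow q y := signedPowC_apply _ _ _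
    rw [hwx, hwy]
    set M := max |x| |y| with hM
    have hM0 : 0 ≤ M := (abs_nonneg x).trans (le_max_left _ _)
    have h3 : M ^ r ≤ x ^ r + y ^ r := by
      have e1 := hr.pow_nonneg x
      have e2 := hr.pow_nonneg y
      rcases max_cases |x| |y| with ⟨hm, -⟩ | ⟨hm, -⟩
      · rw [hM, hm, hr.pow_abs]
        linarith
      · rw [hM, hm, hr.pow_abs]
        linarith
    have h4 : M ^ (k - q * θ) ≤ (x ^ r + y ^ r) ^ η := by
      have : M ^ (k - q * θ) = (M ^ r) ^ η := by
        rw [← Real.rpow_natCast, ← Real.rpow_mul hM0, hη, mul_div_cancel₀ _ hr0'.ne']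
      rw [this]
      gcongr
    have h5 : |signedPow q x - signedPow q y| ^ θ =
        ((signedPow q x - signedPow q y) ^ 2) ^ (θ / 2) := by
      rw [← sq_abs, ← Real.rpow_natCast, ← Real.rpow_mul (abs_nonneg _)]
      congr 1
      push_cast
      ring
    have h6 := rpow_mul_rpow_le_of_add_eq (u := θ / 2) (v := η) (w := 1 - θ / 2 - η)
      (sq_nonneg (signedPow q x - signedPow q y))
      (add_nonneg (hr.pow_nonneg x) (hr.pow_nonneg y)) ha0 hb0 (by positivity) hη0
      (by linarith) (by ring)
    calc _ ≤ _ := h2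
      _ ≤ 4 * k * (((signedPow q x - signedPow q y) ^ 2) ^ (θ / 2) * (x ^ r + y ^ r) ^ η) := by
          rw [h5]
          gcongr
      _ ≤ 4 * k * (a ^ (θ / 2) * b ^ η * (θ / 2 * ((signedPow q x - signedPow q y) ^ 2 / a) +
            η * ((x ^ r + y ^ r) / b) + (1 - θ / 2 - η))) := by gcongr
      _ = _ := by ring
  refine h1.trans ?_
  rw [map_smul, map_add, map_add, map_smul, map_smul, map_add, mean_translate, mean_const,
    smul_eq_mul, smul_eq_mul, smul_eq_mul]
  have h2 : θ / 2 / a * mean ((translate h w - w) ^ 2) ≤ θ / 2 := by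
    rw [div_mul_eq_mul_div, div_le_iff₀ ha0]
    gcongr
    exact hA h
  have h3 : η / b * (mean (V ^ r) + mean (V ^ r)) ≤ η := by
    rw [div_mul_eq_mul_div, div_le_iff₀ hb0]
    gcongr
    linarith
  have h4 : a ^ (θ / 2) ≤ 2 * q * ‖h‖ ^ θ * A ^ (θ / 2) := by
    have e1 : a = (2 * q * ‖h‖) ^ (2 : ℝ) * A := by
      rw [Real.rpow_two, ha]
      ring
    rw [e1, Real.mul_rpow (by positivity) hA0.le, ← Real.rpow_mul (by positivity),
      mul_div_cancel₀ _ two_ne_zero, Real.mul_rpow (by positivity) hh'.le]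
    gcongr
    have : (1 : ℝ) ≤ 2 * q := by linarith
    simpa using Real.rpow_le_rpow_of_exponent_le this hθ1
  have h5 : b ^ η ≤ 2 * B ^ η := by
    rw [hb, Real.mul_rpow zero_le_two hB0.le]
    gcongr
    simpa using Real.rpow_le_rpow_of_exponent_le one_le_two hη1
  calc _ ≤ 4 * k * (a ^ (θ / 2) * b ^ η) * 1 := by
        gcongr
        linarith
    _ ≤ 4 * k * (2 * q * ‖h‖ ^ θ * A ^ (θ / 2) * (2 * B ^ η)) * 1 := by gcongr
    _ = _ := by ring

/-- Young's inequality with three factors. -/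
theorem exists_young_const {c δ u v : ℝ} (hc : 0 ≤ c) (hδ : 0 < δ) (hu : 0 ≤ u) (hv : 0 ≤ v)
    (huv : u + v < 1) : ∃ C, 0 ≤ C ∧ ∀ R X Y : ℝ, 0 ≤ R → 0 ≤ X → 0 ≤ Y →
      c * (R * (X ^ u * Y ^ v)) ≤ δ * (X + Y) + C * R ^ (1 / (1 - u - v)) := by
  set w := 1 - u - v with hw
  have hw0 : 0 < w := by linarith
  -- This compensates for the factor `δ` put in front of both `X` and `Y`.
  set c' := c * δ ^ (-(u + v)) with hc'
  have hc'0 : 0 ≤ c' := by positivity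
  refine ⟨c' ^ (1 / w), by positivity, fun R X Y hR hX hY => ?_⟩
  have h1 := Real.geom_mean_le_arith_mean3_weighted hu hv hw0.le (by positivity : 0 ≤ δ * X)
    (by positivity : 0 ≤ δ * Y) (by positivity : 0 ≤ (c' * R) ^ (1 / w)) (by linarith)
  have h2 : (δ * X) ^ u * (δ * Y) ^ v * ((c' * R) ^ (1 / w)) ^ w = c * (R * (X ^ u * Y ^ v)) := by
    rw [← Real.rpow_mul (by positivity), one_div_mul_cancel hw0.ne', Real.rpow_one,
      Real.mul_rpow hδ.le hX, Real.mul_rpow hδ.le hY, hc']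
    have h3 : δ ^ u * δ ^ v * δ ^ (-(u + v)) = 1 := by
      rw [← Real.rpow_add hδ, ← Real.rpow_add hδ]
      simp
    linear_combination (c * R * X ^ u * Y ^ v) * h3
  rw [h2] at h1
  refine h1.trans ?_
  rw [Real.mul_rpow hc'0 hR]
  have h3 : 0 ≤ c' ^ (1 / w) * R ^ (1 / w) := by positivity
  have h4 : u ≤ 1 := by linarith
  have h5 : v ≤ 1 := by linarith
  have h6 : w ≤ 1 := by linarith
  have h7 : 0 ≤ δ * X := by positivity
  have h8 : 0 ≤ δ * Y := by positivity
  nlinarith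

/-- The noise terms are controlled by the dissipation and the damping. -/
theorem exists_pairing_pow_le {α θ δ : ℝ} {q k r : ℕ} (hq : 1 ≤ q) (hk : 1 ≤ k) (hkr : k < r)
    (hr : Even r) (hθ : 0 ≤ θ) (hθ1 : θ ≤ 1) (hαθ : α < θ) (hqk : q * θ ≤ k)
    (hω : θ / 2 + (k - q * θ) / r < 1) (hδ : 0 < δ) :
    ∃ C, 0 ≤ C ∧ ∀ (P : DyadicPartition) (u : DistT2) (K : TrigKernel) (f : C(T2, ℝ)) (R : ℝ),
      0 ≤ R → besovNorm P (-α) u ≤ ENNReal.ofReal R →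
      |pairing P u (K.conv f ^ k)| ≤
        δ * (mean ((K.convNegLap 0 f + K.convNegLap 1 f) * K.conv f ^ (2 * q - 1)) +
          mean (K.conv f ^ r)) +
        C * (R ^ (1 / (1 - (k : ℝ) / r)) + R ^ (1 / (1 - θ / 2 - (k - q * θ) / r))) := by
  have hr0 : 0 < r := by omega
  have hr0' : (0 : ℝ) < r := by exact_mod_cast hr0
  have hkr' : (k : ℝ) / r < 1 := (div_lt_one hr0').2 (by exact_mod_cast hkr)
  have hpc := pairConst_pos hαθ
  -- The duality bound needs both the `L¹` norm and the `L¹` modulus of the power. The norm involves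
  -- only `Y`, hence `u = 0`; each of the two may use half of `δ`.
  obtain ⟨C₁, hC₁, H₁⟩ := exists_young_const (c := pairConst α θ) (δ := δ / 2) (u := 0)
    (v := (k : ℝ) / r) hpc.le (by positivity) le_rfl (by positivity) (by linarith)
  obtain ⟨C₂, hC₂, H₂⟩ := exists_young_const (c := pairConst α θ * (16 * k * q)) (δ := δ / 2)
    (u := θ / 2) (v := ((k : ℝ) - q * θ) / r) (by positivity) (by positivity) (by positivity)
    (div_nonneg (by linarith) hr0'.le) hω
  refine ⟨max C₁ C₂, hC₁.trans (le_max_left _ _), fun P u K f R hR hu => ?_⟩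
  obtain ⟨hA0, hA⟩ := mean_translate_signedPowC_le K hq f
  set V := K.conv f
  set A := mean ((K.convNegLap 0 f + K.convNegLap 1 f) * V ^ (2 * q - 1))
  set B := mean (V ^ r)
  have hB0 : 0 ≤ B := mean_nonneg fun z => hr.pow_nonneg _
  refine le_of_forall_pos_le_add fun ε hε => ?_
  -- Makes the dissipation and the damping strictly positive; the total cost `2 δ ε'` is `ε`.
  set ε' := ε / (2 * δ) with hε'
  have hε'0 : 0 < ε' := by positivity
  have h1 := mean_abs_pow_le (k := k) hr hkr.le hr0 (by positivity : 0 < B + ε')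
    (by linarith : mean (V ^ r) ≤ B + ε')
  have h2 := mean_abs_translate_pow_sub_le hq hk hr hr0 hθ hθ1 hqk hω.le
    (by positivity : 0 < A + ε') (by positivity : 0 < B + ε') (by linarith)
    (fun h => (hA h).trans (by gcongr; linarith))
  set X := A + ε'
  set Y := B + ε'
  have hX : 0 < X := by positivity
  have hY : 0 < Y := by positivity
  have hmod : HasL1Modulus θ (Y ^ ((k : ℝ) / r) + 16 * k * q * (X ^ (θ / 2) *
      Y ^ (((k : ℝ) - q * θ) / r))) (V ^ k) := by
    refine ⟨h1.trans (le_add_of_nonneg_right (by positivity)), fun h => (h2 h).trans ?_⟩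
    gcongr
    exact le_add_of_nonneg_left (by positivity)
  have h3 := abs_pairing_le hR hθ hαθ (by linarith) hu hmod
  have h4 := H₁ R X Y hR hX.le hY.le
  have h5 := H₂ R X Y hR hX.le hY.le
  rw [Real.rpow_zero, one_mul, sub_zero] at h4
  have e1 : C₁ * R ^ (1 / (1 - (k : ℝ) / r)) ≤ max C₁ C₂ * R ^ (1 / (1 - (k : ℝ) / r)) := by
    gcongr
    exact le_max_left _ _
  have e2 : C₂ * R ^ (1 / (1 - θ / 2 - ((k : ℝ) - q * θ) / r)) ≤
      max C₁ C₂ * R ^ (1 / (1 - θ / 2 - ((k : ℝ) - q * θ) / r)) := by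
    gcongr
    exact le_max_right _ _
  have e3 : δ * (X + Y) = δ * (A + B) + ε := by
    simp only [X, Y, hε']
    field_simp
    ring
  linarith

/-! ### The modes as eigenfunctions of the Laplacian -/

/-- The cosine and sine modes as one family. -/
def mode (p : (Fin 2 → ℤ) × Bool) : SmoothT2 := bif p.2 then cosMode p.1 else sinMode p.1

/-- The modes as continuous functions. -/
abbrev modeC (p : (Fin 2 → ℤ) × Bool) : C(T2, ℝ) := (mode p).1

/-- The eigenvalue of `-Δ` for the frequency `m`. -/
def eigenvalue (m : Fin 2 → ℤ) : ℝ := 4 * Real.pi ^ 2 * ((m 0 : ℝ) ^ 2 + (m 1 : ℝ) ^ 2)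

theorem TrigKernel.conv_eq_sum_mode (K : TrigKernel) (f : C(T2, ℝ)) :
    K.conv f = ∑ p ∈ K.freq ×ˢ Finset.univ, (K.coeff p.1 * mean (f * modeC p)) • modeC p := by
  rw [Finset.sum_product, TrigKernel.conv]
  refine Finset.sum_congr rfl fun m _ => ?_
  rw [Fintype.sum_bool, smul_add, smul_smul, smul_smul]
  rfl

theorem TrigKernel.convNegLap_eq_sum_mode (K : TrigKernel) (f : C(T2, ℝ)) :
    K.convNegLap 0 f + K.convNegLap 1 f = ∑ p ∈ K.freq ×ˢ Finset.univ,
      (eigenvalue p.1 * (K.coeff p.1 * mean (f * modeC p))) • modeC p := by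
  rw [Finset.sum_product, TrigKernel.convNegLap, TrigKernel.convNegLap, ← Finset.sum_add_distrib]
  refine Finset.sum_congr rfl fun m _ => ?_
  rw [Fintype.sum_bool, ← add_smul, smul_add, smul_add, smul_smul, smul_smul, smul_smul,
    smul_smul, eigenvalue, ← mul_add, ← mul_assoc, ← mul_assoc]
  rfl

theorem iteratedDeriv_two_cos_sin (A B b : ℝ) :
    iteratedDeriv 2 (fun h : ℝ => A * Real.cos (b * h) + B * Real.sin (b * h)) 0 = -b ^ 2 * A := by
  have h1 : ∀ (A B h : ℝ), HasDerivAt (fun h : ℝ => A * Real.cos (b * h) + B * Real.sin (b * h))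
      (b * B * Real.cos (b * h) + -(b * A) * Real.sin (b * h)) h := fun A B h => by
    have hb : HasDerivAt (fun h : ℝ => b * h) b h := by
      simpa using (hasDerivAt_id h).const_mul b
    refine ((hb.cos.const_mul A).fun_add (hb.sin.const_mul B)).congr_deriv ?_
    ring
  rw [iteratedDeriv_succ, iteratedDeriv_one]
  have h2 : deriv (fun h : ℝ => A * Real.cos (b * h) + B * Real.sin (b * h)) =
      fun h => b * B * Real.cos (b * h) + -(b * A) * Real.sin (b * h) :=
    funext fun h => (h1 A B h).deriv
  rw [h2, (h1 _ _ 0).deriv]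
  simp
  ring

theorem laplace_modeC (p : (Fin 2 → ℤ) × Bool) (z : T2) :
    laplace (modeC p) z = -eigenvalue p.1 * modeC p z := by
  obtain ⟨m, b⟩ := p
  have h : ∀ i, iteratedDeriv 2 (fun h : ℝ => modeC (m, b) (z + Pi.single i (h : UnitAddCircle))) 0
      = -(2 * Real.pi * m i) ^ 2 * modeC (m, b) z := fun i => by
    cases b
    · have : (fun h : ℝ => modeC (m, false) (z + Pi.single i (h : UnitAddCircle))) =
          fun h => sinC m z * Real.cos (2 * Real.pi * m i * h) +
            cosC m z * Real.sin (2 * Real.pi * m i * h) := funext fun h => by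
        change sinC m _ = _
        rw [sinC_apply_add, cosC_single, sinC_single]
      rw [this, iteratedDeriv_two_cos_sin]
      rfl
    · have : (fun h : ℝ => modeC (m, true) (z + Pi.single i (h : UnitAddCircle))) =
          fun h => cosC m z * Real.cos (2 * Real.pi * m i * h) +
            -sinC m z * Real.sin (2 * Real.pi * m i * h) := funext fun h => by
        change cosC m _ = _
        rw [cosC_apply_add, cosC_single, sinC_single]
        ring
      rw [this, iteratedDeriv_two_cos_sin]
      rfl
  rw [laplace, Fin.sum_univ_two, h, h, eigenvalue]
  ring

/-! ### Continuity in time -/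

/-- The increment splits into `⟨Z r - Z t, f r⟩`, small by duality, and `⟨Z t, f r - f t⟩`. In the
latter the function is uniformly small in a bounded Hölder set, so uniform continuity in time
suffices for `f`. -/
theorem continuousOn_pairing {P : DyadicPartition} {α θ K R : ℝ} (hα : 0 < α) (hαθ : α < θ)
    (hθ2 : θ ≤ 2) (hR : 0 ≤ R) {I J : Set ℝ} (hJI : J ⊆ I) {Z : ℝ → DistT2}
    (hZ : ContinuousInC P (-α) I Z)
    (hZR : ∀ r ∈ J, besovNorm P (-α) (Z r) ≤ ENNReal.ofReal R) {f : ℝ → C(T2, ℝ)}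
    (hf : ContinuousOn f J) (hfK : ∀ r ∈ J, IsHolder θ K (f r)) :
    ContinuousOn (fun r => pairing P (Z r) (f r)) J := by
  intro t ht
  have hθ : 0 ≤ θ := (hα.trans hαθ).le
  have hK : 0 ≤ K := (hfK t ht).nonneg
  have hpc := pairConst_pos hαθ
  refine Metric.tendsto_nhds.2 fun ε hε => ?_
  obtain ⟨δ, hδ, H⟩ := exists_forall_abs_pairing_le P hα hαθ hθ2 (by positivity : 0 ≤ K + K) hR
    (by positivity : 0 < ε / 4)
  set ρ := ε / (4 * pairConst α θ * (K + 1)) with hρ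
  have hρ0 : 0 < ρ := by positivity
  have h1 : ∀ᶠ r in 𝓝[J] t, besovNorm P (-α) (Z r - Z t) < ENNReal.ofReal ρ :=
    ((hZ t (hJI ht)).2.mono_left (nhdsWithin_mono t hJI)).eventually
      (gt_mem_nhds (ENNReal.ofReal_pos.2 hρ0))
  have h2 : ∀ᶠ r in 𝓝[J] t, dist (f r) (f t) < δ := (hf t ht).eventually (Metric.ball_mem_nhds _ hδ)
  filter_upwards [h1, h2, self_mem_nhdsWithin] with r hr1 hr2 hrJ
  have e1 := pairing_sub_left hR hθ hαθ hθ2 hR (hZR r hrJ) (hZR t ht) (hfK r hrJ).hasL1Modulus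
  have e2 := pairing_sub_right hR hθ hαθ hθ2 (hZR t ht) (hfK r hrJ).hasL1Modulus
    (hfK t ht).hasL1Modulus
  have b1 := abs_pairing_le hρ0.le hθ hαθ hθ2 hr1.le (hfK r hrJ).hasL1Modulus
  have b2 := H (Z t) (f r - f t) (hZR t ht) ((hfK r hrJ).sub (hfK t ht)) fun z => by
    rw [dist_eq_norm] at hr2
    exact ((f r - f t).norm_coe_le_norm z).trans hr2.le
  have b3 : pairConst α θ * (ρ * K) ≤ ε / 4 := by
    have : pairConst α θ * (ρ * K) = ε / 4 * (K / (K + 1)) := by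
      rw [hρ]
      field_simp
    rw [this]
    have : K / (K + 1) ≤ 1 := (div_le_one (by positivity)).2 (by linarith)
    nlinarith
  rw [Real.dist_eq, show pairing P (Z r) (f r) - pairing P (Z t) (f t) =
    pairing P (Z r - Z t) (f r) + pairing P (Z t) (f r - f t) by rw [e1, e2]; ring]
  have := abs_add_le (pairing P (Z r - Z t) (f r)) (pairing P (Z t) (f r - f t))
  linarith

theorem NoiseSpace.continuousInC {P : DyadicPartition} {n : ℕ} {α T : ℝ} {Z : ℕ → ℝ → DistT2}
    (hZ : NoiseSpace P n α T Z) {k : ℕ} (hk : k ∈ Finset.Icc 1 n) :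
    ContinuousInC P (-α) (Ioc 0 T) (Z k) := by
  rw [Finset.mem_Icc] at hk
  rcases hk.1.eq_or_lt with rfl | h
  · exact fun t ht => ⟨(hZ.1 t (Ioc_subset_Icc_self ht)).1,
      (hZ.1 t (Ioc_subset_Icc_self ht)).2.mono_left (nhdsWithin_mono t Ioc_subset_Icc_self)⟩
  · exact hZ.2 k (Finset.mem_Icc.2 ⟨h, hk.2⟩)

theorem modeC_exists_isHolder (p : (Fin 2 → ℤ) × Bool) {θ : ℝ} (hθ1 : θ ≤ 1) :
    ∃ K, IsHolder θ K (modeC p) := SmoothT2.exists_isHolder (mode p) hθ1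

/-- The right-hand side of the equation tested against a mode. -/
def drift (P : DyadicPartition) (n : ℕ) (a : ℝ) (Z : ℕ → ℝ → DistT2) (v : ℝ → C(T2, ℝ))
    (p : (Fin 2 → ℤ) × Bool) (r : ℝ) : ℝ :=
  -(eigenvalue p.1 + 1) * mean (v r * modeC p) -
    nonlinearity P n a (v r) (fun k => Z k r) (modeC p)

theorem nonlinearity_eq (P : DyadicPartition) (n : ℕ) (a : ℝ) (v : C(T2, ℝ)) (Z : ℕ → DistT2)
    (φ : C(T2, ℝ)) : nonlinearity P n a v Z φ =
      a * mean (v ^ n * φ) + ∑ j ∈ Finset.range n, pairing P (Z (n - j)) (v ^ j * φ) := rfl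

/-! ### The energy identity. -/

section Energy

variable {P : DyadicPartition} {n : ℕ} {a α β T θ R s t : ℝ} {x : DistT2} {Z : ℕ → ℝ → DistT2}
  {v : ℝ → C(T2, ℝ)}

theorem sub_mem_Icc_of_mem_range {n j : ℕ} (hj : j ∈ Finset.range n) :
    n - j ∈ Finset.Icc 1 n := by
  have := Finset.mem_range.1 hj
  exact Finset.mem_Icc.2 ⟨by omega, by omega⟩

theorem IsWeakSolution.continuousOn_drift (hv : IsWeakSolution P n a β T x Z v)
    (hZ : NoiseSpace P n α T Z) (hα : 0 < α) (hαθ : α < θ) (hθβ : θ < β) (hθ1 : θ ≤ 1)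
    (hs : 0 < s) (htT : t ≤ T) (hR : 0 ≤ R)
    (hZR : ∀ k ∈ Finset.Icc 1 n, ∀ r ∈ Icc s t, besovNorm P (-α) (Z k r) ≤ ENNReal.ofReal R)
    (p : (Fin 2 → ℤ) × Bool) : ContinuousOn (drift P n a Z v p) (Icc s t) := by
  have hθ : 0 < θ := hα.trans hαθ
  have hJ : Icc s t ⊆ Ioc 0 T := fun r hr => ⟨hs.trans_le hr.1, hr.2.trans htT⟩
  have hvc : ContinuousOn v (Icc s t) :=
    (ContinuousInC.continuousOn (hθ.trans hθβ) hv.continuous).mono hJ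
  obtain ⟨K, hK⟩ := ContinuousInC.exists_isHolder isCompact_Icc hJ hθ.le hθβ hθ1 hv.continuous
  obtain ⟨K', hK'⟩ := modeC_exists_isHolder p hθ1
  unfold drift
  simp only [nonlinearity_eq]
  refine ContinuousOn.sub ?_ (ContinuousOn.add ?_ (continuousOn_finsetSum _ fun j hj => ?_))
  · exact continuousOn_const.mul (mean.continuous.comp_continuousOn (hvc.mul continuousOn_const))
  · exact continuousOn_const.mul
      (mean.continuous.comp_continuousOn ((hvc.pow n).mul continuousOn_const))
  · obtain ⟨K'', hK''⟩ := exists_isHolder_pow θ K j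
    have hk := sub_mem_Icc_of_mem_range hj
    exact continuousOn_pairing hα hαθ (by linarith) hR hJ (hZ.continuousInC hk) (hZR _ hk)
      ((hvc.pow j).mul continuousOn_const) fun r hr => (hK'' _ (hK r hr)).mul hK'

/-- A mode is an eigenfunction of the Laplacian, so the weak equation is an integral equation for
one Fourier coefficient; its integrand is continuous and the fundamental theorem of calculus
applies. -/
theorem IsWeakSolution.hasDerivAt_mean_mul_modeC (hv : IsWeakSolution P n a β T x Z v)
    (p : (Fin 2 → ℤ) × Bool) (hs : 0 < s) (htT : t ≤ T)
    (hc : ContinuousOn (drift P n a Z v p) (Icc s t)) {r : ℝ} (hr : r ∈ Ioo s t) :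
    HasDerivAt (fun r => mean (v r * modeC p)) (drift P n a Z v p r) r := by
  have h1 : ∀ y ∈ Ioo s t, mean (v y * modeC p) =
      mean (v s * modeC p) + ∫ τ in s..y, drift P n a Z v p τ := fun y hy => by
    have h2 := hv.equation (mode p) s y hs hy.1.le (hy.2.le.trans htT)
    have h3 : ∀ τ, (∫ z, v τ z * (laplace (mode p).1 z - (mode p).1 z) ∂torusMeasure) -
        nonlinearity P n a (v τ) (fun k => Z k τ) (mode p).1 = drift P n a Z v p τ := fun τ => by
      rw [drift]
      congr 1
      simp only [laplace_modeC]
      rw [mean_apply, ← integral_const_mul]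
      refine integral_congr_ae (ae_of_all _ fun z => ?_)
      simp only [ContinuousMap.mul_apply]
      ring
    simp only [h3] at h2
    change mean (v y * modeC p) - mean (v s * modeC p) = _ at h2
    linarith
  have hint : IntervalIntegrable (drift P n a Z v p) volume s r := by
    refine (hc.mono ?_).intervalIntegrable
    rw [uIcc_of_le hr.1.le]
    exact Icc_subset_Icc_right hr.2.le
  have hder := intervalIntegral.integral_hasDerivAt_right hint
    ((hc.mono Ioo_subset_Icc_self).stronglyMeasurableAtFilter isOpen_Ioo r hr)
    (hc.continuousAt (Icc_mem_nhds hr.1 hr.2))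
  refine (hder.const_add (mean (v s * modeC p))).congr_of_eventuallyEq ?_
  filter_upwards [isOpen_Ioo.mem_nhds hr] with y hy using h1 y hy

theorem nonlinearity_conv (hR : 0 ≤ R) (hα : 0 < α) (hαθ : α < θ) (hθ1 : θ ≤ 1)
    {Z : ℕ → DistT2} (hZR : ∀ k ∈ Finset.Icc 1 n, besovNorm P (-α) (Z k) ≤ ENNReal.ofReal R)
    {v : C(T2, ℝ)} {M : ℝ} (hv : IsHolder θ M v) (K : TrigKernel) (g : C(T2, ℝ)) :
    nonlinearity P n a v Z (K.conv g) = ∑ p ∈ K.freq ×ˢ Finset.univ,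
      (K.coeff p.1 * mean (g * modeC p)) * nonlinearity P n a v Z (modeC p) := by
  simp only [nonlinearity_eq, mul_add, Finset.sum_add_distrib]
  have hmul : ∀ w : C(T2, ℝ), w * K.conv g = ∑ p ∈ K.freq ×ˢ Finset.univ,
      (K.coeff p.1 * mean (g * modeC p)) • (w * modeC p) := fun w => by
    rw [K.conv_eq_sum_mode, Finset.mul_sum]
    simp only [mul_smul_comm]
  congr 1
  · rw [hmul, map_sum, Finset.mul_sum]
    refine Finset.sum_congr rfl fun p _ => ?_
    rw [map_smul, smul_eq_mul]
    ring
  · simp only [Finset.mul_sum]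
    rw [Finset.sum_comm]
    refine Finset.sum_congr rfl fun j hj => ?_
    rw [hmul, pairing_sum hR (hα.trans hαθ).le hαθ (by linarith)
      (hZR _ (sub_mem_Icc_of_mem_range hj))]
    intro p _
    obtain ⟨K', hK'⟩ := modeC_exists_isHolder p hθ1
    obtain ⟨K'', hK''⟩ := exists_isHolder_pow θ M j
    exact ⟨_, ((hK'' _ hv).mul hK').hasL1Modulus⟩

/-- The energy identity for the mollified solution. -/
theorem IsWeakSolution.hasDerivAt_energy (hv : IsWeakSolution P n a β T x Z v)
    (hZ : NoiseSpace P n α T Z) (hα : 0 < α) (hαθ : α < θ) (hθβ : θ < β) (hθ1 : θ ≤ 1)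
    (hs : 0 < s) (htT : t ≤ T) (hR : 0 ≤ R)
    (hZR : ∀ k ∈ Finset.Icc 1 n, ∀ r ∈ Icc s t, besovNorm P (-α) (Z k r) ≤ ENNReal.ofReal R)
    (K : TrigKernel) (p : ℕ) {r : ℝ} (hr : r ∈ Ioo s t) :
    HasDerivAt (fun r => mean (K.conv (v r) ^ p))
      (p * (-mean ((K.convNegLap 0 (v r) + K.convNegLap 1 (v r)) * K.conv (v r) ^ (p - 1)) -
        mean (K.conv (v r) * K.conv (v r) ^ (p - 1)) -
        nonlinearity P n a (v r) (fun k => Z k r) (K.conv (K.conv (v r) ^ (p - 1))))) r := by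
  have hθ : 0 < θ := hα.trans hαθ
  have hJ : Icc s t ⊆ Ioc 0 T := fun r hr => ⟨hs.trans_le hr.1, hr.2.trans htT⟩
  obtain ⟨M, hM⟩ := ContinuousInC.exists_isHolder isCompact_Icc hJ hθ.le hθβ hθ1 hv.continuous
  have hr' := Ioo_subset_Icc_self hr
  have h1 : ∀ q, HasDerivAt (fun r => mean (v r * modeC q)) (drift P n a Z v q r) r := fun q =>
    hv.hasDerivAt_mean_mul_modeC q hs htT
      (hv.continuousOn_drift hZ hα hαθ hθβ hθ1 hs htT hR hZR q) hr
  -- A finite combination of fixed modes with differentiable coefficients, so the derivative exists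
  -- in the space of continuous functions and the chain rule applies to the mean of the power.
  have h2 : HasDerivAt (fun r => K.conv (v r)) (∑ q ∈ K.freq ×ˢ Finset.univ,
      (K.coeff q.1 * drift P n a Z v q r) • modeC q) r := by
    simp only [K.conv_eq_sum_mode]
    refine HasDerivAt.fun_sum fun q _ => ?_
    have h4 := (h1 q).const_mul (K.coeff q.1)
    exact h4.smul_const (modeC q)
  have h3 := mean.hasFDerivAt.comp_hasDerivAt r (h2.pow p)
  refine h3.congr_deriv ?_
  set g := K.conv (v r) ^ (p - 1) with hg
  rw [nonlinearity_conv hR hα hαθ hθ1 (fun k hk => hZR k hk r hr') (hM r hr') K g,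
    K.convNegLap_eq_sum_mode, K.conv_eq_sum_mode (v r)]
  have h5 : ∀ S : C(T2, ℝ), mean ((p : C(T2, ℝ)) * g * S) = p * mean (S * g) := fun S => by
    rw [← smul_eq_mul (p : ℝ), ← map_smul]
    congr 1
    ext z
    simp
    ring
  have h6 : ∀ c : (Fin 2 → ℤ) × Bool → ℝ,
      mean ((∑ q ∈ K.freq ×ˢ Finset.univ, c q • modeC q) * g) =
        ∑ q ∈ K.freq ×ˢ Finset.univ, c q * mean (g * modeC q) := fun c => by
    rw [Finset.sum_mul, map_sum]
    refine Finset.sum_congr rfl fun q _ => ?_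
    rw [smul_mul_assoc, map_smul, smul_eq_mul, mul_comm g]
  rw [h5, h6, h6, h6, ← Finset.sum_neg_distrib, ← Finset.sum_sub_distrib,
    ← Finset.sum_sub_distrib]
  congr 1
  refine Finset.sum_congr rfl fun q _ => ?_
  rw [drift]
  ring

end Energy

/-! ### The commutator error -/

theorem tendsto_natCast_rpow_neg {θ : ℝ} (hθ : 0 < θ) (C : ℝ) :
    Tendsto (fun N : ℕ => C * (N : ℝ) ^ (-θ)) atTop (𝓝 0) := by
  simpa using ((tendsto_rpow_neg_atTop hθ).comp
    (tendsto_natCast_atTop_atTop (R := ℝ))).const_mul C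

/-- Each of the two mollifications in the test term costs `N^(-θ)` in sup norm, while in Hölder norm
there is only boundedness. Together this is what `exists_forall_abs_pairing_le` requires. -/
theorem exists_commutator_bound {θ : ℝ} (hθ : 0 < θ) (hθ1 : θ ≤ 1) (M : ℝ) (j l : ℕ) :
    ∃ C, 0 ≤ C ∧ ∀ (N : ℕ) (K : TrigKernel) (v : C(T2, ℝ)), 0 < N → IsMollifier K N →
      IsHolder θ M v →
      IsHolder θ C (v ^ j * K.conv (K.conv v ^ l) - K.conv v ^ j * K.conv v ^ l) ∧
      ∀ z, |(v ^ j * K.conv (K.conv v ^ l) - K.conv v ^ j * K.conv v ^ l) z| ≤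
        C * (N : ℝ) ^ (-θ) := by
  obtain ⟨A, hA⟩ := exists_isHolder_pow θ M j
  obtain ⟨B, hB⟩ := exists_isHolder_pow θ M l
  set C₁ := 2 * A * B + 2 * A * B
  set C₂ := A * (B * 33) + j * (M * 33 * M ^ (j - 1)) * B
  refine ⟨max 0 (max C₁ C₂), le_max_left _ _, fun N K v hN hK hv => ?_⟩
  set V := K.conv v
  have hV : IsHolder θ M V := hK.isHolder_conv hv
  have hM := hv.nonneg
  have hA' := hA v hv
  have hB' := hB V hV
  have hcB := hK.isHolder_conv hB'
  refine ⟨((hA'.mul hcB).sub ((hA V hV).mul hB')).mono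
    ((le_max_left C₁ C₂).trans (le_max_right _ _)), fun z => ?_⟩
  set ρ := (N : ℝ) ^ (-θ)
  have hρ : 0 ≤ ρ := by positivity
  have hA0 := hA'.nonneg
  have hB0 := hB'.nonneg
  have h1 := hK.abs_conv_sub_le hN hθ.le (by linarith) hM hv.2 z
  have h2 := hK.abs_conv_sub_le hN hθ.le (by linarith) hB0 hB'.2 z
  have h3 : |v z ^ j - V z ^ j| ≤ j * (M * (33 * ρ) * M ^ (j - 1)) := by
    refine (abs_pow_sub_pow_le_max _ _ j).trans ?_
    rw [abs_sub_comm (v z)]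
    have : max |v z| |V z| ≤ M := max_le (hv.1 z) (hV.1 z)
    gcongr
  have h4 : (v ^ j * K.conv (V ^ l) - V ^ j * V ^ l) z =
      v z ^ j * (K.conv (V ^ l) z - (V ^ l) z) + (v z ^ j - V z ^ j) * (V ^ l) z := by
    simp only [ContinuousMap.sub_apply, ContinuousMap.mul_apply, ContinuousMap.pow_apply]
    ring
  have h5 : |v z ^ j| ≤ A := by simpa using hA'.1 z
  have h6 := hB'.1 z
  rw [h4]
  refine (abs_add_le _ _).trans ?_
  rw [abs_mul, abs_mul]
  calc _ ≤ A * (B * (33 * ρ)) + j * (M * (33 * ρ) * M ^ (j - 1)) * B := by gcongr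
    _ = C₂ * ρ := by simp only [C₂]; ring
    _ ≤ _ := by
      gcongr
      exact (le_max_right C₁ C₂).trans (le_max_right _ _)

/-- The threshold for `N` depends only on the bounds for `v` and `Z`, so a single kernel serves all
times of a compact interval. -/
theorem eventually_nonlinearity_conv (P : DyadicPartition) {α θ R η : ℝ} (hα : 0 < α)
    (hαθ : α < θ) (hθ1 : θ ≤ 1) (hR : 0 ≤ R) (M a : ℝ) (n l : ℕ) (hη : 0 < η) :
    ∀ᶠ N : ℕ in atTop, ∀ (K : TrigKernel) (v : C(T2, ℝ)) (Z : ℕ → DistT2), IsMollifier K N →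
      IsHolder θ M v → (∀ k ∈ Finset.Icc 1 n, besovNorm P (-α) (Z k) ≤ ENNReal.ofReal R) →
      |nonlinearity P n a v Z (K.conv (K.conv v ^ l)) - (a * mean (K.conv v ^ n * K.conv v ^ l) +
        ∑ j ∈ Finset.range n, pairing P (Z (n - j)) (K.conv v ^ j * K.conv v ^ l))| ≤ η := by
  have hθ : 0 < θ := hα.trans hαθ
  choose C hC hCb using fun j => exists_commutator_bound hθ hθ1 M j l
  -- One share for each of the `n` noise terms and one for the damping.
  set η' := η / (n + 1) with hη'
  have hη'0 : 0 < η' := by positivity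
  choose δ hδ hδb using fun j =>
    exists_forall_abs_pairing_le P hα hαθ (by linarith) (hC j) hR hη'0
  have h1 : ∀ᶠ N : ℕ in atTop, ∀ j ∈ Finset.range n, C j * (N : ℝ) ^ (-θ) < δ j :=
    (Finset.eventually_all _).2 fun j _ =>
      (tendsto_natCast_rpow_neg hθ (C j)).eventually (gt_mem_nhds (hδ j))
  have h2 : ∀ᶠ N : ℕ in atTop, |a| * C n * (N : ℝ) ^ (-θ) < η' :=
    (tendsto_natCast_rpow_neg hθ (|a| * C n)).eventually (gt_mem_nhds hη'0)
  filter_upwards [h1, h2, eventually_gt_atTop 0] with N hN1 hN2 hN0 K v Z hK hv hZ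
  have hb := fun j => hCb j N K v hN0 hK hv
  set V := K.conv v
  set g := V ^ l
  have hV : IsHolder θ M V := hK.isHolder_conv hv
  obtain ⟨B, hB⟩ := exists_isHolder_pow θ M l
  have hg := hB V hV
  have e1 : nonlinearity P n a v Z (K.conv g) - (a * mean (V ^ n * g) +
        ∑ j ∈ Finset.range n, pairing P (Z (n - j)) (V ^ j * g)) =
      a * mean (v ^ n * K.conv g - V ^ n * g) +
        ∑ j ∈ Finset.range n, pairing P (Z (n - j)) (v ^ j * K.conv g - V ^ j * g) := by
    rw [nonlinearity_eq, map_sub, add_sub_add_comm, ← Finset.sum_sub_distrib, ← mul_sub]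
    congr 1
    refine Finset.sum_congr rfl fun j hj => ?_
    obtain ⟨A, hA⟩ := exists_isHolder_pow θ M j
    rw [pairing_sub_right hR hθ.le hαθ (by linarith) (hZ _ (sub_mem_Icc_of_mem_range hj))
      ((hA v hv).mul (hK.isHolder_conv hg)).hasL1Modulus ((hA V hV).mul hg).hasL1Modulus]
  have e2 : |a * mean (v ^ n * K.conv g - V ^ n * g)| ≤ η' := by
    rw [abs_mul]
    have : |mean (v ^ n * K.conv g - V ^ n * g)| ≤ C n * (N : ℝ) ^ (-θ) :=
      (abs_mean_le _).trans (mean_le_of_le fun z => (hb n).2 z)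
    calc _ ≤ |a| * (C n * (N : ℝ) ^ (-θ)) := by gcongr
      _ ≤ η' := by rw [← mul_assoc]; exact hN2.le
  have e3 : |∑ j ∈ Finset.range n, pairing P (Z (n - j)) (v ^ j * K.conv g - V ^ j * g)| ≤
      n * η' := by
    refine (Finset.abs_sum_le_sum_abs _ _).trans ?_
    refine (Finset.sum_le_card_nsmul _ _ η' fun j hj => ?_).trans (by simp)
    exact hδb j _ _ (hZ _ (sub_mem_Icc_of_mem_range hj)) (hb j).1
      fun z => ((hb j).2 z).trans (hN1 j hj).le
  rw [e1]
  refine (abs_add_le _ _).trans ((add_le_add e2 e3).trans (le_of_eq ?_))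
  rw [hη']
  field_simp
  ring

/-! ### Comparison for the differential inequality -/

/-- Above the level `L`, where `c L^l = 2K`, half of the damping absorbs `K`. If `F t` exceeds `L`,
then `F` does so on the whole interval and `F^(1-l)` grows at least linearly; this bounds `F t`
independently of `F s`. -/
theorem le_max_of_deriv_le_neg_rpow {F F' : ℝ → ℝ} {s t c K l : ℝ} (hst : s < t) (hc : 0 < c)
    (hK : 0 < K) (hl : 1 < l) (hF : ContinuousOn F (Icc s t))
    (hd : ∀ r ∈ Ioo s t, HasDerivAt F (F' r) r)
    (hle : ∀ r ∈ Ioo s t, F' r ≤ -c * F r ^ l + K) :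
    F t ≤ max (((l - 1) * (c / 2) * (t - s)) ^ (-(1 / (l - 1)))) ((2 * K / c) ^ (1 / l)) := by
  by_contra! hcon
  obtain ⟨hX, hL⟩ := max_lt_iff.1 hcon
  set L := (2 * K / c) ^ (1 / l) with hLdef
  have hl0 : 0 < l := by linarith
  have hL0 : 0 < L := by positivity
  have hLl : L ^ l = 2 * K / c := by
    rw [hLdef, ← Real.rpow_mul (by positivity), one_div_mul_cancel hl0.ne', Real.rpow_one]
  have hder : ∀ r ∈ Ioo s t, L < F r → F' r ≤ -(c / 2) * F r ^ l := fun r hr hLr => by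
    have h1 := hle r hr
    have h2 : L ^ l ≤ F r ^ l := by gcongr
    rw [hLl, div_le_iff₀ hc] at h2
    linarith
  have hgt : ∀ r ∈ Icc s t, L < F r := by
    by_contra! hex
    obtain ⟨r₀, hr₀, hFr₀⟩ := hex
    have hcomp : IsCompact (Icc s t ∩ F ⁻¹' Iic L) :=
      isCompact_Icc.of_isClosed_subset (hF.preimage_isClosed_of_isClosed isClosed_Icc isClosed_Iic)
        inter_subset_left
    -- The last time at which `F ≤ L`; afterwards `F` decreases, which contradicts `F t > L`.
    obtain ⟨σ, hσ, hmax⟩ := hcomp.exists_isGreatest ⟨r₀, hr₀, hFr₀⟩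
    have hanti : AntitoneOn F (Icc σ t) := by
      refine antitoneOn_of_deriv_nonpos (convex_Icc _ _) (hF.mono (Icc_subset_Icc_left hσ.1.1))
        ?_ ?_
      · rw [interior_Icc]
        exact fun r hr => (hd r ⟨hσ.1.1.trans_lt hr.1, hr.2⟩).differentiableAt.differentiableWithinAt
      · rw [interior_Icc]
        intro r hr
        have hr' : r ∈ Ioo s t := ⟨hσ.1.1.trans_lt hr.1, hr.2⟩
        rw [(hd r hr').deriv]
        have hLr : L < F r := by
          by_contra! h
          exact absurd (hmax ⟨Ioo_subset_Icc_self hr', h⟩) (not_le.2 hr.1)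
        refine (hder r hr' hLr).trans ?_
        have : 0 ≤ c / 2 * F r ^ l := mul_nonneg (by positivity) (Real.rpow_nonneg (hL0.trans hLr).le _)
        linarith
    have h1 := hanti (left_mem_Icc.2 hσ.1.2) (right_mem_Icc.2 hσ.1.2) hσ.1.2
    have h2 : F σ ≤ L := hσ.2
    linarith
  have hpos : ∀ r ∈ Icc s t, 0 < F r := fun r hr => hL0.trans (hgt r hr)
  have hmono : MonotoneOn (fun r => F r ^ (1 - l) - (l - 1) * (c / 2) * r) (Icc s t) := by
    have hdG : ∀ r ∈ Ioo s t, HasDerivAt (fun r => F r ^ (1 - l) - (l - 1) * (c / 2) * r)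
        (F' r * (1 - l) * F r ^ (1 - l - 1) - (l - 1) * (c / 2)) r := fun r hr => by
      have h1 := (hd r hr).rpow_const (p := 1 - l) (Or.inl (hpos r (Ioo_subset_Icc_self hr)).ne')
      have h2 := (hasDerivAt_id r).const_mul ((l - 1) * (c / 2))
      rw [mul_one] at h2
      exact h1.fun_sub h2
    refine monotoneOn_of_deriv_nonneg (convex_Icc _ _) ?_ ?_ ?_
    · exact (hF.rpow_const fun r hr => Or.inl (hpos r hr).ne').sub
        (continuousOn_const.mul continuousOn_id)
    · rw [interior_Icc]
      exact fun r hr => (hdG r hr).differentiableAt.differentiableWithinAt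
    · rw [interior_Icc]
      intro r hr
      rw [(hdG r hr).deriv]
      have hr' := Ioo_subset_Icc_self hr
      have h1 := hder r hr (hgt r hr')
      have h2 : F r ^ (1 - l - 1) * F r ^ l = 1 := by
        rw [← Real.rpow_add (hpos r hr')]
        simp
      have h3 : 0 ≤ F r ^ (1 - l - 1) := Real.rpow_nonneg (hpos r hr').le _
      have h4 := mul_le_mul_of_nonneg_left h1 h3
      have h5 : F r ^ (1 - l - 1) * F' r ≤ -(c / 2) := by
        refine h4.trans (le_of_eq ?_)
        linear_combination (-(c / 2)) * h2
      nlinarith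
  have h1 := hmono (left_mem_Icc.2 hst.le) (right_mem_Icc.2 hst.le) hst.le
  have h2 : 0 < F s ^ (1 - l) := Real.rpow_pos_of_pos (hpos s (left_mem_Icc.2 hst.le)) _
  have hFt := hpos t (right_mem_Icc.2 hst.le)
  set Q := (l - 1) * (c / 2) * (t - s) with hQ
  have hQ0 : 0 < Q := by
    have : 0 < l - 1 := by linarith
    have : 0 < t - s := by linarith
    positivity
  have h3 : Q ≤ F t ^ (1 - l) := by
    simp only at h1
    linarith
  have h4 : (F t ^ (1 - l)) ^ (-(1 / (l - 1))) ≤ Q ^ (-(1 / (l - 1))) := by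
    refine Real.rpow_le_rpow_of_nonpos hQ0 h3 ?_
    have : 0 ≤ 1 / (l - 1) := one_div_nonneg.2 (by linarith)
    linarith
  have h5 : (F t ^ (1 - l)) ^ (-(1 / (l - 1))) = F t := by
    have h6 : l - 1 ≠ 0 := by linarith
    rw [← Real.rpow_mul hFt.le, show (1 - l) * -(1 / (l - 1)) = 1 by field_simp; ring,
      Real.rpow_one]
  linarith

/-! ### The energy estimate -/

/-- The first exponent of the noise in the energy estimate. -/
def noiseExp₁ (n p j : ℕ) : ℝ := 1 / (1 - ((p + j - 1 : ℕ) : ℝ) / (p + n - 1 : ℕ))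

/-- The second exponent of the noise in the energy estimate, where `θ` is the regularity at which
the noise terms are interpolated. -/
def noiseExp₂ (θ : ℝ) (n p j : ℕ) : ℝ :=
  1 / (1 - θ / 2 - (((p + j - 1 : ℕ) : ℝ) - (p / 2 : ℕ) * θ) / (p + n - 1 : ℕ))

/-- Jensen's inequality; it turns the damping into a superlinear function of the energy. -/
theorem mean_pow_rpow_le {V : C(T2, ℝ)} {k r : ℕ} (hr : Even r) (hk : Even k) (hkr : k ≤ r)
    (hk0 : 0 < k) : mean (V ^ k) ^ ((r : ℝ) / k) ≤ mean (V ^ r) := by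
  have hr0 : 0 < r := by omega
  have hr0' : (0 : ℝ) < r := by exact_mod_cast hr0
  have hk0' : (0 : ℝ) < k := by exact_mod_cast hk0
  have hB0 : 0 ≤ mean (V ^ r) := mean_nonneg fun z => hr.pow_nonneg _
  have hF0 : 0 ≤ mean (V ^ k) := mean_nonneg fun z => hk.pow_nonneg _
  refine le_of_forall_pos_le_add fun ε hε => ?_
  have h1 := mean_abs_pow_le (k := k) hr hkr hr0 (by positivity : 0 < mean (V ^ r) + ε)
    (by linarith : mean (V ^ r) ≤ mean (V ^ r) + ε)
  have h2 : mean (V ^ k) ≤ (mean (V ^ r) + ε) ^ ((k : ℝ) / r) :=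
    (mean_mono fun z => le_abs_self _).trans h1
  calc _ ≤ ((mean (V ^ r) + ε) ^ ((k : ℝ) / r)) ^ ((r : ℝ) / k) := by gcongr
    _ = _ := by
      rw [← Real.rpow_mul (by positivity), div_mul_div_cancel₀ hr0'.ne', div_self hk0'.ne',
        Real.rpow_one]

theorem tendsto_mean_conv_jackson_pow {θ M : ℝ} (hθ : 0 < θ) (hθ1 : θ ≤ 1) {f : C(T2, ℝ)}
    (hf : IsHolder θ M f) (p : ℕ) :
    Tendsto (fun N => mean ((jackson N).conv f ^ p)) atTop (𝓝 (mean (f ^ p))) := by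
  have h1 : Tendsto (fun N => (jackson N).conv f) atTop (𝓝 f) := by
    rw [tendsto_iff_norm_sub_tendsto_zero]
    refine squeeze_zero (fun _ => norm_nonneg _) (fun N => ?_)
      ((tendsto_natCast_rpow_neg hθ (M * 33)).comp (tendsto_add_atTop_nat 1))
    have hM := hf.nonneg
    refine (ContinuousMap.norm_le _ (by simp only [Function.comp_apply]; positivity)).2 fun z => ?_
    have := (isMollifier_jackson N).abs_conv_sub_le N.succ_pos hθ.le (by linarith) hM hf.2 z
    simp only [Function.comp_apply, mul_assoc]
    exact this
  exact (mean.continuous.comp (continuous_pow p)).continuousAt.tendsto.comp h1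

/-- The differential inequality is established for the mollified energy, integrated by comparison,
and only then are the mollification and the commutator error `η` sent to zero. Hence no derivative
of `∫ v^p` itself is needed. -/
theorem exists_energy_bound {n p : ℕ} (hn : Odd n) (hn3 : 3 ≤ n) (hp : Even p) (hp2 : 2 ≤ p)
    {α θ a : ℝ} (hα : 0 < α) (hαθ : α < θ) (hθ1 : θ ≤ 1) (hθn : θ * (n - 1) ≤ 1) (ha : 0 < a) :
    ∃ C, 0 < C ∧ ∀ (P : DyadicPartition) (β T s t : ℝ) (x : DistT2) (Z : ℕ → ℝ → DistT2)
      (v : ℝ → C(T2, ℝ)) (R : ℕ → ℝ), α < β → 0 < s → s < t → t ≤ T → NoiseSpace P n α T Z →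
      IsWeakSolution P n a β T x Z v → (∀ j, 0 ≤ R j) →
      (∀ j ∈ Finset.range n, ∀ r ∈ Icc s t,
        besovNorm P (-α) (Z (n - j) r) ≤ ENNReal.ofReal (R j)) →
      mean (v t ^ p) ≤ max (((((p + n - 1 : ℕ) : ℝ) / p - 1) * (p * a / 2 / 2) * (t - s)) ^
          (-(1 / (((p + n - 1 : ℕ) : ℝ) / p - 1))))
        ((C * ∑ j ∈ Finset.range n, (R j ^ noiseExp₁ n p j + R j ^ noiseExp₂ θ n p j)) ^
          (1 / (((p + n - 1 : ℕ) : ℝ) / p))) := by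
  obtain ⟨q, hq⟩ := hp.two_dvd
  have hq1 : 1 ≤ q := by omega
  set r := p + n - 1 with hr
  have hreven : Even r := by
    obtain ⟨m, hm⟩ := hn
    exact ⟨q + m, by omega⟩
  have hpr : p < r := by omega
  have hp0 : (0 : ℝ) < p := by exact_mod_cast (by omega : 0 < p)
  have hn0 : (0 : ℝ) < n := by exact_mod_cast (by omega : 0 < n)
  have hr0 : (0 : ℝ) < r := by exact_mod_cast (by omega : 0 < r)
  have hl : (1 : ℝ) < (r : ℝ) / p := (one_lt_div hp0).2 (by exact_mod_cast hpr)
  have hθ : 0 < θ := hα.trans hαθ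
  -- The `n` noise terms together may use all of the dissipation and half of the damping.
  set δ := min 1 (a / 2) / n with hδ
  have hδ0 : 0 < δ := by positivity
  have hex : ∀ j, ∃ C, 0 ≤ C ∧ (j ∈ Finset.range n → ∀ (P : DyadicPartition) (u : DistT2)
      (K : TrigKernel) (f : C(T2, ℝ)) (R : ℝ), 0 ≤ R → besovNorm P (-α) u ≤ ENNReal.ofReal R →
      |pairing P u (K.conv f ^ (p + j - 1))| ≤
        δ * (mean ((K.convNegLap 0 f + K.convNegLap 1 f) * K.conv f ^ (p - 1)) +
          mean (K.conv f ^ r)) + C * (R ^ noiseExp₁ n p j + R ^ noiseExp₂ θ n p j)) := fun j => by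
    by_cases hj : j ∈ Finset.range n
    · have hjn := Finset.mem_range.1 hj
      have hk : ((p + j - 1 : ℕ) : ℝ) = 2 * q + j - 1 := by
        rw [Nat.cast_sub (by omega), hq]
        push_cast
        ring
      have hr' : (r : ℝ) = 2 * q + n - 1 := by
        rw [hr, Nat.cast_sub (by omega), hq]
        push_cast
        ring
      have hq' : (1 : ℝ) ≤ q := by exact_mod_cast hq1
      have hj' : (j : ℝ) + 1 ≤ n := by exact_mod_cast hjn
      obtain ⟨C, hC, H⟩ := exists_pairing_pow_le (q := q) (k := p + j - 1) (r := r) hq1 (by omega)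
        (by omega) hreven hθ.le hθ1 hαθ (by rw [hk]; nlinarith [Nat.cast_nonneg (α := ℝ) j])
        (by
          -- After clearing denominators the condition is `θ(n-1)/2 < n-j`, true since `θ(n-1) ≤ 1 ≤
          -- n-j`.
          rw [div_add_div _ _ two_ne_zero hr0.ne', div_lt_one (by positivity), hk, hr']
          nlinarith) hδ0
      refine ⟨C, hC, fun _ P u K f R hR hu => ?_⟩
      have := H P u K f R hR hu
      rw [noiseExp₁, noiseExp₂, show p / 2 = q by omega, ← hr]
      rwa [← hq] at this
    · exact ⟨0, le_rfl, fun h => absurd h hj⟩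
  choose Cj hCj hpair using hex
  set C := ∑ j ∈ Finset.range n, Cj j with hC
  have hC0 : 0 ≤ C := Finset.sum_nonneg fun j _ => hCj j
  refine ⟨4 * (C + 1) / a, by positivity, fun P β T s t x Z v R hαβ hs hst htT hZ hv hR hZR => ?_⟩
  -- The solution is only known to be Hölder below `β`, and `β` may be smaller than `θ`. The
  -- exponent `θ'` enters the qualitative limits alone, so the constant does not depend on `β`.
  obtain ⟨θ', hθ'α, hθ'⟩ := exists_between (lt_min hαβ (hαθ.trans_le hθ1))
  have hθ'β := hθ'.trans_le (min_le_left _ _)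
  have hθ'1 := (hθ'.trans_le (min_le_right _ _)).le
  have hJ : Icc s t ⊆ Ioc 0 T := fun r hr => ⟨hs.trans_le hr.1, hr.2.trans htT⟩
  have hvc : ContinuousOn v (Icc s t) :=
    (ContinuousInC.continuousOn (hα.trans hαβ) hv.continuous).mono hJ
  obtain ⟨M, hM⟩ := ContinuousInC.exists_isHolder isCompact_Icc hJ (hα.trans hθ'α).le hθ'β hθ'1
    hv.continuous
  -- A common bound for all noise terms, used for continuity and commutator errors but not in the
  -- final constant.
  set Rs := ∑ j ∈ Finset.range n, R j with hRs
  have hRs0 : 0 ≤ Rs := Finset.sum_nonneg fun j _ => hR j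
  have hZRs : ∀ k ∈ Finset.Icc 1 n, ∀ r ∈ Icc s t,
      besovNorm P (-α) (Z k r) ≤ ENNReal.ofReal Rs := fun k hk r hr => by
    rw [Finset.mem_Icc] at hk
    have hj : n - k ∈ Finset.range n := Finset.mem_range.2 (by omega)
    have := hZR (n - k) hj r hr
    rw [show n - (n - k) = k by omega] at this
    exact this.trans (ENNReal.ofReal_le_ofReal (Finset.single_le_sum (fun j _ => hR j) hj))
  set E := ∑ j ∈ Finset.range n, (R j ^ noiseExp₁ n p j + R j ^ noiseExp₂ θ n p j) with hE
  have hEj : ∀ j, 0 ≤ R j ^ noiseExp₁ n p j + R j ^ noiseExp₂ θ n p j := fun j =>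
    add_nonneg (Real.rpow_nonneg (hR j) _) (Real.rpow_nonneg (hR j) _)
  have hE0 : 0 ≤ E := Finset.sum_nonneg fun j _ => hEj j
  set X := (((r : ℝ) / p - 1) * (p * a / 2 / 2) * (t - s)) ^ (-(1 / ((r : ℝ) / p - 1))) with hX
  have key : ∀ η : ℝ, 0 < η →
      mean (v t ^ p) ≤ max X ((4 * (C * E + η) / a) ^ (1 / ((r : ℝ) / p))) := fun η hη => by
    have hev := (tendsto_add_atTop_nat 1).eventually
      (eventually_nonlinearity_conv P hα hθ'α hθ'1 hRs0 M a n (p - 1) hη)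
    refine le_of_tendsto (tendsto_mean_conv_jackson_pow (hα.trans hθ'α) hθ'1
      (hM t (right_mem_Icc.2 hst.le)) p) ?_
    filter_upwards [hev] with N hN
    set K := jackson N
    have hcont : ContinuousOn (fun r => mean (K.conv (v r) ^ p)) (Icc s t) := by
      have hKc : Continuous fun f => K.conv f := by
        unfold TrigKernel.conv
        fun_prop
      exact mean.continuous.comp_continuousOn ((hKc.comp_continuousOn hvc).pow p)
    refine (le_max_of_deriv_le_neg_rpow (c := p * a / 2) (K := p * (C * E + η)) hst (by positivity)
      (by positivity) hl hcont (fun τ hτ => hv.hasDerivAt_energy hZ hα hθ'α hθ'β hθ'1 hs htT hRs0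
        hZRs K p hτ) ?_).trans (le_of_eq ?_)
    · intro τ hτ
      have hτ' := Ioo_subset_Icc_self hτ
      have herr := hN K (v τ) (fun k => Z k τ) (isMollifier_jackson N) (hM τ hτ')
        fun k hk => hZRs k hk τ hτ'
      have hdis := (mean_translate_signedPowC_le K hq1 (v τ)).1
      rw [← hq] at hdis
      set V := K.conv (v τ)
      set D := mean ((K.convNegLap 0 (v τ) + K.convNegLap 1 (v τ)) * V ^ (p - 1))
      set B := mean (V ^ r)
      have hB0 : 0 ≤ B := mean_nonneg fun z => hreven.pow_nonneg _
      have hVp : V * V ^ (p - 1) = V ^ p := by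
        rw [← pow_succ', Nat.sub_add_cancel (by omega)]
      have hVr : V ^ n * V ^ (p - 1) = V ^ r := by
        rw [← pow_add, hr]
        congr 1
        omega
      have hVj : ∀ j, V ^ j * V ^ (p - 1) = V ^ (p + j - 1) := fun j => by
        rw [← pow_add]
        congr 1
        omega
      rw [hVr] at herr
      simp only [hVj] at herr
      rw [hVp]
      have hFp : 0 ≤ mean (V ^ p) := mean_nonneg fun z => hp.pow_nonneg _
      have hFB : mean (V ^ p) ^ ((r : ℝ) / p) ≤ B :=
        mean_pow_rpow_le hreven hp hpr.le (by omega)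
      have hsum : |∑ j ∈ Finset.range n, pairing P (Z (n - j) τ) (V ^ (p + j - 1))| ≤
          min 1 (a / 2) * (D + B) + C * E := by
        refine (Finset.abs_sum_le_sum_abs _ _).trans ?_
        calc _ ≤ ∑ j ∈ Finset.range n, (δ * (D + B) +
              C * (R j ^ noiseExp₁ n p j + R j ^ noiseExp₂ θ n p j)) := by
              refine Finset.sum_le_sum fun j hj => ?_
              refine (hpair j hj P (Z (n - j) τ) K (v τ) (R j) (hR j) (hZR j hj τ hτ')).trans ?_
              have : Cj j ≤ C := Finset.single_le_sum (fun j _ => hCj j) hj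
              have := mul_le_mul_of_nonneg_right this (hEj j)
              linarith
          _ = _ := by
            have e0 : (n : ℝ) * δ = min 1 (a / 2) := by
              rw [hδ]
              field_simp
            rw [Finset.sum_add_distrib, Finset.sum_const, Finset.card_range, nsmul_eq_mul,
              ← mul_assoc, e0, hE, Finset.mul_sum]
      have h1 : min 1 (a / 2) * (D + B) ≤ D + a / 2 * B := by
        have e1 := mul_le_mul_of_nonneg_right (min_le_left 1 (a / 2)) hdis
        have e2 := mul_le_mul_of_nonneg_right (min_le_right 1 (a / 2)) hB0
        linarith
      have h2 := neg_le_of_abs_le hsum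
      have h3 := neg_le_of_abs_le herr
      have h4 : -D - mean (V ^ p) - nonlinearity P n a (v τ) (fun k => Z k τ)
          (K.conv (V ^ (p - 1))) ≤ -(a / 2) * mean (V ^ p) ^ ((r : ℝ) / p) + (C * E + η) := by
        have := mul_le_mul_of_nonneg_left hFB (by positivity : 0 ≤ a / 2)
        linarith
      refine (mul_le_mul_of_nonneg_left h4 hp0.le).trans (le_of_eq ?_)
      ring
    -- With `c = p a / 2` and `K = p (C E + η)`, the quotient `2K/c` is `4 (C E + η)/a`.
    · congr 2
      field_simp
      norm_num
  have hlim : Tendsto (fun η : ℝ => max X ((4 * (C * E + η) / a) ^ (1 / ((r : ℝ) / p)))) (𝓝[>] 0)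
      (𝓝 (max X ((4 * (C * E + 0) / a) ^ (1 / ((r : ℝ) / p))))) := by
    have hc : Continuous fun η : ℝ => max X ((4 * (C * E + η) / a) ^ (1 / ((r : ℝ) / p))) :=
      continuous_const.max ((by fun_prop : Continuous fun η : ℝ =>
        4 * (C * E + η) / a).rpow_const fun _ => Or.inr (by positivity))
    exact (hc.tendsto 0).mono_left nhdsWithin_le_nhds
  refine (ge_of_tendsto hlim (eventually_nhdsWithin_of_forall key)).trans ?_
  gcongr
  rw [add_zero]
  have : 0 ≤ E / a := by positivity
  calc 4 * (C * E) / a ≤ 4 * (C * E) / a + 4 * (E / a) := by linarith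
    _ = _ := by ring

/-! ### The estimate in terms of weighted suprema -/

theorem eLpNorm_pow_eq_ofReal_mean {p : ℕ} (hp : Even p) (hp0 : p ≠ 0) (f : C(T2, ℝ)) :
    eLpNorm f p torusMeasure ^ p = ENNReal.ofReal (mean (f ^ p)) := by
  have hp' : (p : ℝ) ≠ 0 := Nat.cast_ne_zero.2 hp0
  rw [eLpNorm_eq_lintegral_rpow_enorm_toReal (Nat.cast_ne_zero.2 hp0) (ENNReal.natCast_ne_top p),
    ENNReal.toReal_natCast, ← ENNReal.rpow_natCast, ← ENNReal.rpow_mul, one_div_mul_cancel hp',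
    ENNReal.rpow_one, mean_apply,
    ofReal_integral_eq_lintegral_ofReal (integrable_continuousMap (f ^ p))
      (ae_of_all _ fun z => hp.pow_nonneg _)]
  refine lintegral_congr fun z => ?_
  rw [ENNReal.rpow_natCast, ← ofReal_norm, ← ENNReal.ofReal_pow (norm_nonneg _),
    Real.norm_eq_abs, hp.pow_abs]
  rfl

/-- The supremum over `[t/2, t]` is controlled by the weighted supremum over `[0, t]`. -/
theorem iSup_Icc_half_rpow_le (b : ℝ → ℝ≥0∞) {e γ t : ℝ} (he : 0 < e) (hγ : 0 ≤ γ) (ht : 0 < t) :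
    (⨆ r ∈ Icc (t / 2) t, b r) ^ e ≤ ENNReal.ofReal (2 ^ γ) *
      (ENNReal.ofReal (t ^ (-γ)) * ⨆ r ∈ Icc 0 t, ENNReal.ofReal (r ^ γ) * b r ^ e) := by
  rw [← ENNReal.le_rpow_inv_iff he]
  refine iSup₂_le fun r hr => ?_
  rw [ENNReal.le_rpow_inv_iff he]
  have hr0 : 0 < r := (half_pos ht).trans_le hr.1
  -- On `[t/2, t]` one has `2r/t ≥ 1`, so the weight can be inserted at a cost of `2^γ`.
  have h1 : 1 ≤ 2 ^ γ * (t ^ (-γ) * r ^ γ) := by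
    rw [Real.rpow_neg ht.le, ← div_eq_inv_mul, ← Real.div_rpow hr0.le ht.le,
      ← Real.mul_rpow zero_le_two (by positivity)]
    refine Real.one_le_rpow ?_ hγ
    rw [← mul_div_assoc, le_div_iff₀ ht]
    linarith [hr.1]
  calc b r ^ e = 1 * b r ^ e := (one_mul _).symm
    _ ≤ ENNReal.ofReal (2 ^ γ * (t ^ (-γ) * r ^ γ)) * b r ^ e := by
      gcongr
      exact ENNReal.one_le_ofReal.2 h1
    _ = ENNReal.ofReal (2 ^ γ) * (ENNReal.ofReal (t ^ (-γ)) *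
        (ENNReal.ofReal (r ^ γ) * b r ^ e)) := by
      rw [ENNReal.ofReal_mul (by positivity), ENNReal.ofReal_mul (by positivity)]
      ring
    _ ≤ _ := by
      gcongr
      exact le_iSup₂_of_le r ⟨hr0.le, hr.2⟩ le_rfl

/-- Finite weighted suprema over `[0, t]` give bounds on `[t/2, t]` with controlled powers. -/
theorem exists_bound_Icc_half {n : ℕ} {e : ℕ → Fin 5 → ℝ} (he0 : ∀ j i, 0 < e j i) {α' t : ℝ}
    (hα'0 : 0 < α') (ht : 0 < t) (B : ℕ → ℝ → ℝ≥0∞) {A : ℕ → Fin 5 → ℝ≥0∞}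
    (hA : ∀ j i, A j i = ENNReal.ofReal (t ^ (-(α' * e j i))) *
      ⨆ r ∈ Icc 0 t, ENNReal.ofReal (r ^ (α' * e j i)) * B j r ^ e j i)
    (hST : ∑ j ∈ Finset.range n, ∑ i, A j i ≠ ⊤) :
    ∃ R : ℕ → ℝ, (∀ j, 0 ≤ R j) ∧
      (∀ j ∈ Finset.range n, ∀ r ∈ Icc (t / 2) t, B j r ≤ ENNReal.ofReal (R j)) ∧
      ∀ j ∈ Finset.range n, ∀ i, ENNReal.ofReal (R j ^ e j i) ≤
        ENNReal.ofReal (∑ j ∈ Finset.range n, ∑ i : Fin 5, 2 ^ (α' * e j i)) * A j i := by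
  have hAT : ∀ j ∈ Finset.range n, ∀ i, A j i ≠ ⊤ := fun j hj i h => hST <| top_le_iff.1 <|
    h ▸ (Finset.single_le_sum (f := A j) (fun _ _ => zero_le) (Finset.mem_univ i)).trans
      (Finset.single_le_sum (f := fun j => ∑ i, A j i) (fun _ _ => zero_le) hj)
  set b : ℕ → ℝ≥0∞ := fun j => ⨆ r ∈ Icc (t / 2) t, B j r with hbdef
  have hbA : ∀ j i, b j ^ e j i ≤ ENNReal.ofReal (2 ^ (α' * e j i)) * A j i := fun j i =>
    hA j i ▸ iSup_Icc_half_rpow_le (B j) (he0 j i) (mul_pos hα'0 (he0 j i)).le ht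
  have hbT : ∀ j ∈ Finset.range n, b j ≠ ⊤ := fun j hj h => by
    have := hbA j 0
    rw [h, ENNReal.top_rpow_of_pos (he0 j 0), top_le_iff] at this
    exact ENNReal.mul_ne_top ENNReal.ofReal_ne_top (hAT j hj 0) this
  refine ⟨fun j => (b j).toReal, fun j => ENNReal.toReal_nonneg, fun j hj r hr => ?_,
    fun j hj i => ?_⟩
  · rw [ENNReal.ofReal_toReal (hbT j hj)]
    exact le_iSup₂_of_le r hr le_rfl
  · rw [← ENNReal.ofReal_rpow_of_nonneg ENNReal.toReal_nonneg (he0 j i).le,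
      ENNReal.ofReal_toReal (hbT j hj)]
    refine (hbA j i).trans ?_
    gcongr
    exact (Finset.single_le_sum (f := fun i => (2 : ℝ) ^ (α' * e j i))
      (fun _ _ => by positivity) (Finset.mem_univ i)).trans
      (Finset.single_le_sum (f := fun j => ∑ i, (2 : ℝ) ^ (α' * e j i))
        (fun _ _ => Finset.sum_nonneg fun _ _ => by positivity) hj)

/-- The exponents of the norms of the noise, indexed as in the final estimate. -/
def noiseExp (n p j : ℕ) (i : Fin 5) : ℝ :=
  if j < n then if i = 0 then noiseExp₁ n p j else noiseExp₂ (1 / ((n : ℝ) - 1)) n p j else 1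

/-- For `j < n` the exponents evaluate to `(p+n-1)/(n-j)` and `(p+n-1)/(n-j-1/2)`. -/
theorem noiseExp_pos {n p : ℕ} (hn3 : 3 ≤ n) (hp : Even p) (hp2 : 2 ≤ p) (j : ℕ) (i : Fin 5) :
    0 < noiseExp n p j i := by
  obtain ⟨q, rfl⟩ := hp.two_dvd
  have hn : (3 : ℝ) ≤ n := by exact_mod_cast hn3
  have hq : (1 : ℝ) ≤ q := by exact_mod_cast (by omega : 1 ≤ q)
  have hr : ((2 * q + n - 1 : ℕ) : ℝ) = 2 * q + n - 1 := by
    rw [Nat.cast_sub (by omega)]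
    push_cast
    ring
  have hr0 : (0 : ℝ) < 2 * q + n - 1 := by linarith
  unfold noiseExp
  split_ifs with hj hi
  all_goals try
    have hj' : (j : ℝ) + 1 ≤ n := by exact_mod_cast hj
    have hk : ((2 * q + j - 1 : ℕ) : ℝ) = 2 * q + j - 1 := by
      rw [Nat.cast_sub (by omega)]
      push_cast
      ring
  · rw [noiseExp₁, hr, hk]
    refine one_div_pos.2 (sub_pos.2 ((div_lt_one hr0).2 ?_))
    linarith
  · rw [noiseExp₂, hr, hk, Nat.mul_div_cancel_left q two_pos]
    refine one_div_pos.2 ?_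
    have h1 : (n : ℝ) - 1 ≠ 0 := by linarith
    have : 1 - 1 / ((n : ℝ) - 1) / 2 - (2 * q + j - 1 - q * (1 / ((n : ℝ) - 1))) / (2 * q + n - 1) =
        ((n : ℝ) - j - 1 / 2) / (2 * q + n - 1) := by
      field_simp
      ring
    rw [this]
    exact div_pos (by linarith) hr0
  · exact one_pos

end

end TorusSPDE

/-! ### The main estimate. -/

open TorusSPDE

theorem mainTheorem6 (n p : ℕ) (hn : Odd n) (hn3 : 3 ≤ n) (hp : Even p) (hp2 : 2 ≤ p)
    (lam : ℝ) (hlam : lam = ((p : ℝ) + n - 1) / p)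
    (α : ℝ) (hα : 0 < α) (hα' : α < 1 / (((p : ℝ) + n - 1) * ((n : ℝ) - 1))) :
    ∃ e : ℕ → Fin 5 → ℝ, (∀ j i, 0 < e j i) ∧
      ∀ (P : TorusSPDE.DyadicPartition) (a α' : ℝ), 0 < a → 0 < α' →
        ∃ C : ℝ, 0 < C ∧
          ∀ (α₀ β T : ℝ), 0 < α₀ → α₀ < 1 / n → α < β → 0 < T →
          ∀ (x : TorusSPDE.DistT2), TorusSPDE.MemC P (-α₀) x →
          ∀ (Z : ℕ → ℝ → TorusSPDE.DistT2), TorusSPDE.NoiseSpace P n α T Z →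
          ∀ (v : ℝ → C(TorusSPDE.T2, ℝ)), TorusSPDE.IsWeakSolution P n a β T x Z v →
          ∀ t : ℝ, 0 < t → t ≤ T →
            eLpNorm (v t) p TorusSPDE.torusMeasure ^ p ≤
              ENNReal.ofReal C *
                max (ENNReal.ofReal (t ^ (-(1 / (lam - 1)))))
                  ((∑ j ∈ Finset.range n, ∑ i : Fin 5,
                    ENNReal.ofReal (t ^ (-(α' * e j i))) *
                      ⨆ r ∈ Icc 0 t, ENNReal.ofReal (r ^ (α' * e j i)) *
                        TorusSPDE.besovNorm P (-α) (Z (n - j) r) ^ e j i) ^ (1 / lam)) := by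
  have hn1 : (3 : ℝ) ≤ n := by exact_mod_cast hn3
  have hp1 : (2 : ℝ) ≤ p := by exact_mod_cast hp2
  have hlam' : lam = ((p + n - 1 : ℕ) : ℝ) / p := by
    rw [hlam, Nat.cast_sub (by omega)]
    push_cast
    rfl
  have hlam1 : 1 < lam := by
    rw [hlam, one_lt_div (by linarith)]
    linarith
  have hl0 : 0 < 1 / lam := one_div_pos.2 (one_pos.trans hlam1)
  -- A choice free of `α`: it is larger than every admissible `α` and satisfies `θ(n-1) ≤ 1`.
  set θ : ℝ := 1 / ((n : ℝ) - 1) with hθ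
  have hαθ : α < θ := hα'.trans_le
    (one_div_le_one_div_of_le (by linarith) (le_mul_of_one_le_left (by linarith) (by linarith)))
  have hθ1 : θ ≤ 1 := by
    rw [hθ, div_le_one (by linarith)]
    linarith
  have hθn : θ * (n - 1) ≤ 1 := (one_div_mul_cancel (by linarith)).le
  -- For `j < n`, the first of the five slots holds the exponent from the `L¹` norm and the other
  -- four repeat the one from the modulus. The value `1` for `j ≥ n` only keeps the exponents
  -- positive.
  refine ⟨noiseExp n p, noiseExp_pos hn3 hp hp2, fun P a α' ha hα'0 => ?_⟩
  obtain ⟨C, hC, H⟩ := exists_energy_bound hn hn3 hp hp2 hα hαθ hθ1 hθn ha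
  rw [← hlam'] at H
  set e := noiseExp n p with he
  have he0 : ∀ j i, 0 < e j i := noiseExp_pos hn3 hp hp2
  set Cx : ℝ := ∑ j ∈ Finset.range n, ∑ i : Fin 5, 2 ^ (α' * e j i) with hCx
  have hCx0 : 0 ≤ Cx := Finset.sum_nonneg fun j _ => Finset.sum_nonneg fun i _ => by positivity
  -- The comparison runs over an interval of length `t/2`; `C₁` is what remains after extracting the
  -- power of `t`.
  set C₁ : ℝ := ((lam - 1) * (p * a / 2 / 2) * (1 / 2)) ^ (-(1 / (lam - 1))) with hC₁
  have hb : 0 < (lam - 1) * (p * a / 2 / 2) * (1 / 2) := by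
    have := sub_pos.2 hlam1
    positivity
  have hC₁0 : 0 < C₁ := Real.rpow_pos_of_pos hb _
  set C₂ : ℝ := (C * Cx) ^ (1 / lam)
  have hC₂0 : 0 ≤ C₂ := Real.rpow_nonneg (by positivity) _
  refine ⟨C₁ + C₂, by positivity, fun α₀ β T _ _ hαβ hT x _ Z hZ v hv t ht htT => ?_⟩
  set A : ℕ → Fin 5 → ℝ≥0∞ := fun j i => ENNReal.ofReal (t ^ (-(α' * e j i))) *
    ⨆ r ∈ Icc 0 t, ENNReal.ofReal (r ^ (α' * e j i)) * besovNorm P (-α) (Z (n - j) r) ^ e j i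
    with hA
  change _ ≤ ENNReal.ofReal (C₁ + C₂) * max _ ((∑ j ∈ Finset.range n, ∑ i, A j i) ^ (1 / lam))
  set S := ∑ j ∈ Finset.range n, ∑ i, A j i with hS
  -- If a weighted supremum is infinite, so is the right side; otherwise the noise has finite real
  -- bounds on `[t/2, t]`.
  by_cases hST : S = ⊤
  · rw [hST, ENNReal.top_rpow_of_pos hl0, max_eq_right le_top,
      ENNReal.mul_top (ENNReal.ofReal_pos.2 (by positivity)).ne']
    exact le_top
  obtain ⟨R, hR, hZR, hRA⟩ := exists_bound_Icc_half he0 hα'0 ht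
    (fun j r => besovNorm P (-α) (Z (n - j) r)) (fun _ _ => rfl) hST
  have hbound := H P β T (t / 2) t x Z v R hαβ (half_pos ht) (half_lt_self ht) htT hZ hv hR hZR
  set E := ∑ j ∈ Finset.range n, (R j ^ noiseExp₁ n p j + R j ^ noiseExp₂ θ n p j)
  have hRe : ∀ j (c : ℝ), 0 ≤ R j ^ c := fun j c => Real.rpow_nonneg (hR j) c
  have hE : ENNReal.ofReal E ≤ ENNReal.ofReal Cx * S := by
    rw [ENNReal.ofReal_sum_of_nonneg fun j _ => add_nonneg (hRe _ _) (hRe _ _), hS, Finset.mul_sum]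
    refine Finset.sum_le_sum fun j hj => ?_
    have hj' := Finset.mem_range.1 hj
    have e₀ : noiseExp₁ n p j = e j 0 := by simp [he, noiseExp, hj']
    have e₁ : noiseExp₂ θ n p j = e j 1 := by simp [he, noiseExp, hj', hθ]
    rw [e₀, e₁, ENNReal.ofReal_add (hRe _ _) (hRe _ _)]
    refine (add_le_add (hRA j hj 0) (hRA j hj 1)).trans ?_
    rw [← mul_add]
    gcongr
    rw [Fin.sum_univ_five]
    exact le_add_right (le_add_right le_self_add)
  have hE0 : 0 ≤ E := Finset.sum_nonneg fun j _ => add_nonneg (hRe _ _) (hRe _ _)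
  have hX : ((lam - 1) * (p * a / 2 / 2) * (t - t / 2)) ^ (-(1 / (lam - 1))) =
      C₁ * t ^ (-(1 / (lam - 1))) := by
    rw [hC₁, ← Real.mul_rpow hb.le ht.le, mul_assoc _ (1 / 2) t, one_div_mul_eq_div, sub_half]
  rw [eLpNorm_pow_eq_ofReal_mean hp (by omega)]
  refine (ENNReal.ofReal_le_ofReal hbound).trans ?_
  rw [ENNReal.ofReal_max]
  refine max_le ?_ ?_
  · rw [hX, ENNReal.ofReal_mul hC₁0.le]
    gcongr
    · linarith
    · exact le_max_left _ _
  · rw [← ENNReal.ofReal_rpow_of_nonneg (mul_nonneg hC.le hE0) hl0.le]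
    calc ENNReal.ofReal (C * E) ^ (1 / lam) ≤ (ENNReal.ofReal (C * Cx) * S) ^ (1 / lam) := by
          rw [ENNReal.ofReal_mul hC.le, ENNReal.ofReal_mul hC.le, mul_assoc]
          gcongr
      _ = ENNReal.ofReal C₂ * S ^ (1 / lam) := by
          rw [ENNReal.mul_rpow_of_nonneg _ _ hl0.le,
            ENNReal.ofReal_rpow_of_nonneg (mul_nonneg hC.le hCx0) hl0.le]
      _ ≤ _ := by
          gcongr
          · linarith
          · exact le_max_right _ _
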